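/- Let $G$ be a compact connected Abelian Lie group with Lie algebra $\mathfrak g$, and let $\{K_i\}_{i\ge 0}$ be a sequence of finite connected polyhedral complexes with oriented cells such that $H_1(K_i;\mathbb Z)=0$. Write $C^k(K_i;G)$, $C^k(K_i;\mathfrak g)$ for the cellular $k$-cochains with values in $G$, $\mathfrak g$, and $$d^{G}_{i,k}:C^k(K_i;G)\to C^{k+1}(K_i;G),\qquad d^{\mathfrak g}_{i,k}:C^k(K_i;\mathfrak g)\to C^{k+1}(K_i;\mathfrak g)\qquad(k=0,1)$$ for the cellular coboundary operators (defined by incidence numbers). The group $C^0(K_i;G)$ acts on $C^1(K_i;G)$ by $c_0\cdot c_1=(d^G_{i,0}c_0)\,c_1$, so that $C^1(K_i;G)/C^0(K_i;G)=C^1(K_i;G)/\operatorname{Im} d^G_{i,0}$. For every $i>0$ let $P^k_i:C^k(K_i;G)\to C^k(K_{i-1};G)$, $k=0,1,2$, be surjective Lie group homomorphisms with $P^{k+1}_i d^G_{i,k}=d^G_{i-1,k}P^k_i$ for $k=0,1$. Let $P^1_{ij}:C^1(K_i;G)\to C^1(K_j;G)$, $i\ge j$, be the composite of $P^1_i,P^1_{i-1},\dots,P^1_{j+1}$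 (the identity if $i=j$), and let $\bar P^1_{ij}:C^1(K_i;G)/C^0(K_i;G)\to C^1(K_j;G)/C^0(K_j;G)$ be the homomorphism it induces. Let $P_{i\bullet}:\operatorname{Im} d^{\mathfrak g}_{i,1}\to\operatorname{Im} d^{\mathfrak g}_{i-1,1}$ be the linear map induced by $P^2_i$ on Lie algebras. Let $\langle\cdot,\cdot\rangle_i$ be any inner product on $\operatorname{Im} d^{\mathfrak g}_{i,1}$, for each $i\ge 0$. Define bilinear forms $\langle\cdot,\cdot\rangle^r_i$ on $\operatorname{Im} d^{\mathfrak g}_{i,1}$ inductively: $\langle\cdot,\cdot\rangle^r_0=\langle\cdot,\cdot\rangle_0$, and for $i>0$, with respect to the decomposition $$\operatorname{Im} d^{\mathfrak g}_{i,1}=\operatorname{Im}P_{i\bullet}^*\oplus(\operatorname{Im}P_{i\bullet}^*)^{\perp}$$ (adjoint and orthogonal complement taken with respect to the original inner products $\langle\cdot,\cdot\rangle_i$, $\langle\cdot,\cdot\rangle_{i-1}$), $\langle\cdot,\cdot\rangle^r_i$ is the pullback of $\langle\cdot,\cdot\rangle^r_{i-1}$ via $P_{i\bullet}$ on the first summand,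 equals $\langle\cdot,\cdot\rangle_i$ on the second, and makes the two summands orthogonal. Then the forms $\langle\cdot,\cdot\rangle^r_i$ are inner products. The group $\operatorname{Im} d^G_{i,1}$ is a compact connected Abelian Lie group with Lie algebra $\operatorname{Im} d^{\mathfrak g}_{i,1}$; let $H^r_{\beta,i}$ be its heat kernel at time $\beta>0$ (the fundamental solution at the identity of $\partial_tH=-\Delta H$, where $\Delta\ge 0$ is the Laplacian of the invariant metric defined by $\langle\cdot,\cdot\rangle^r_i$), which exists. Define the probability measure $$\mu^r_{\beta,i}=z_{\beta,i}\,\bigl(H^r_{\beta,i}\circ d^G_{i,1}\bigr)\cdot\nu_i$$ on $C^1(K_i;G)$, where $\nu_i$ is the normalized Haar measure on $C^1(K_i;G)$ and $z_{\beta,i}$ is a normalization constant, and let $\bar\mu^r_{\beta,i}$ be its pushforward to $C^1(K_i;G)/C^0(K_i;G)$. Then for every $\beta>0$ the triple $\bigl(C^1(K_i;G)/C^0(K_i;G),\,\bar P^1_{ij},\,\bar\mu^r_{\beta,i}\bigr)$ is a projective system of measures: the maps $\bar P^1_{ij}$ are continuous, $\bar P^1_{ii}=\mathrm{id}$ and $\bar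 P^1_{jk}\bar P^1_{ij}=\bar P^1_{ik}$ for $i\ge j\ge k$, the $\bar\mu^r_{\beta,i}$ are Borel probability measures, and the pushforward of $\bar\mu^r_{\beta,i}$ under $\bar P^1_{ij}$ is $\bar\mu^r_{\beta,j}$ for all $i\ge j$. Consequently it has a limit measure: there is a unique Borel probability measure on the projective limit $\{(x_i)\in\prod_i C^1(K_i;G)/C^0(K_i;G):\bar P^1_{ij}x_i=x_j \text{ for } i\ge j\}$ whose image under the projection to the $i$-th factor is $\bar\mu^r_{\beta,i}$ for every $i$. -/

import Mathlib

open MeasureTheory Filter Topology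
open scoped Manifold ContDiff

set_option linter.unusedSectionVars false

noncomputable section

namespace AbelianGauge

/-! ### Finite polyhedral complexes, orientations of cells, incidence numbers, first homology -/

/-- A finite polyhedral complex in `ℝ^N`: a finite set of (nonempty) convex polytopes that contains
every nonempty face of each of its members and in which any two members meet in a common
(possibly empty) face. The faces of a polytope are its exposed subsets; Mathlib's `IsExposed`
counts the empty set and the polytope itself among them. -/
structure PolyhedralComplex (N : ℕ) where
  cells : Finset (Set (EuclideanSpace ℝ (Fin N)))
  nonempty : ∀ s ∈ cells, s.Nonempty
  polytope : ∀ s ∈ cells, ∃ t : Finset (EuclideanSpace ℝ (Fin N)), s = convexHull ℝ (t : Set _)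
  face_mem : ∀ s ∈ cells, ∀ f : Set (EuclideanSpace ℝ (Fin N)),
    f.Nonempty → IsExposed ℝ s f → f ∈ cells
  inter_face : ∀ s ∈ cells, ∀ t ∈ cells, IsExposed ℝ s (s ∩ t) ∧ IsExposed ℝ t (s ∩ t)

namespace PolyhedralComplex

variable {N : ℕ} (K : PolyhedralComplex N)

/-- The underlying space `|K|`, the union of all cells. -/
def support : Set (EuclideanSpace ℝ (Fin N)) := ⋃ s ∈ K.cells, s

/-- The `k`-cells of `K`: the polytopes of `K` whose affine span has dimension `k`. -/
def Cell (k : ℕ) : Type :=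
  {s : Set (EuclideanSpace ℝ (Fin N)) // s ∈ K.cells ∧ Module.finrank ℝ (vectorSpan ℝ s) = k}

instance (k : ℕ) : Finite (K.Cell k) :=
  Set.Finite.to_subtype (K.cells.finite_toSet.subset (fun _ hs => hs.1))

instance (k : ℕ) : Fintype (K.Cell k) := Fintype.ofFinite _

instance (k : ℕ) : DecidableEq (K.Cell k) := Classical.decEq _

/-- An orientation of the 1-cells and the 2-cells of `K` (0-cells carry the positive orientation;
cells of dimension at least 3 are not needed below).
An edge is oriented by naming one endpoint as source and the other as target. A polygon is oriented
by a direction of travel along its boundary, that is, by listing its vertices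
`v 0, v 1, …, v (m - 1)` without repetition in a cyclic order such that its edges are exactly the
segments from `v j` to the cyclically next vertex. -/
structure CellOrientation where
  src : K.Cell 1 → K.Cell 0
  tgt : K.Cell 1 → K.Cell 0
  edge_eq : ∀ e : K.Cell 1, e.1 = convexHull ℝ ((src e).1 ∪ (tgt e).1)
  sides : K.Cell 2 → ℕ
  vert : ∀ p : K.Cell 2, Fin (sides p) → K.Cell 0
  vert_injective : ∀ p : K.Cell 2, Function.Injective (vert p)
  vert_range : ∀ (p : K.Cell 2) (v : K.Cell 0), v.1 ⊆ p.1 ↔ ∃ j, vert p j = v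
  side_iff : ∀ (p : K.Cell 2) (s : Set (EuclideanSpace ℝ (Fin N))),
    (s ∈ K.cells ∧ Module.finrank ℝ (vectorSpan ℝ s) = 1 ∧ s ⊆ p.1) ↔
      ∃ j, s = convexHull ℝ ((vert p j).1 ∪ (vert p (finRotate _ j)).1)

end PolyhedralComplex

namespace PolyhedralComplex.CellOrientation

variable {N : ℕ} {K : PolyhedralComplex N} (O : K.CellOrientation)

/-- The incidence number `[e : v]` of an oriented edge and a vertex: `1` at the target of the edge,
`-1` at its source, `0` elsewhere. -/
def inc₁ (e : K.Cell 1) (v : K.Cell 0) : ℤ :=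
  (if O.tgt e = v then 1 else 0) - (if O.src e = v then 1 else 0)

/-- The incidence number `[p : e]` of an oriented polygon and an oriented edge: `1` if the boundary
of `p` traverses `e` from source to target, `-1` if it traverses `e` from target to source,
`0` if `e` is not an edge of `p`. -/
def inc₂ (p : K.Cell 2) (e : K.Cell 1) : ℤ :=
  ∑ j : Fin (O.sides p),
    ((if O.src e = O.vert p j ∧ O.tgt e = O.vert p (finRotate _ j) then 1 else 0) -
      (if O.tgt e = O.vert p j ∧ O.src e = O.vert p (finRotate _ j) then 1 else 0))

end PolyhedralComplex.CellOrientation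

/-- The boundary homomorphism on integral chains given by a matrix of incidence numbers. -/
def boundary {ι κ : Type*} [Fintype κ] (M : κ → ι → ℤ) : (κ → ℤ) →+ (ι → ℤ) where
  toFun c i := ∑ k, c k * M k i
  map_zero' := by ext i; simp
  map_add' a b := by ext i; simp [add_mul, Finset.sum_add_distrib]

/-- The coboundary homomorphism on cochains with values in a (multiplicative) Abelian group. -/
def coboundary {ι κ : Type*} [Fintype ι] (M : κ → ι → ℤ) (G : Type*) [CommGroup G] :
    (ι → G) →* (κ → G) where
  toFun c k := ∏ i, c i ^ M k i
  map_one' := by ext k; simp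
  map_mul' a b := by ext k; simp [mul_zpow, Finset.prod_mul_distrib]

/-- The coboundary map on cochains with values in a real vector space. -/
def linCoboundary {ι κ : Type*} [Fintype ι] (M : κ → ι → ℤ) (L : Type*) [AddCommGroup L]
    [Module ℝ L] : (ι → L) →ₗ[ℝ] (κ → L) where
  toFun c k := ∑ i, M k i • c i
  map_add' a b := by ext k; simp [Finset.sum_add_distrib]
  map_smul' r a := by
    ext k
    simp only [Pi.smul_apply, RingHom.id_apply, Finset.smul_sum]
    exact Finset.sum_congr rfl fun i _ => smul_comm _ _ _

/-- The first homology group of `K` with integer coefficients, `Ker ∂₁ / Im ∂₂`. -/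
def PolyhedralComplex.CellOrientation.H₁ {N : ℕ} {K : PolyhedralComplex N}
    (O : K.CellOrientation) : Type :=
  (boundary O.inc₁).ker ⧸ (boundary O.inc₂).range.addSubgroupOf (boundary O.inc₁).ker

/-! ### The Lie algebra of an Abelian Lie group -/

section LieAlg

variable (G : Type*) [CommGroup G] [TopologicalSpace G] [IsTopologicalGroup G]

/-- The Lie algebra of an Abelian Lie group `G`, realized as the space of one-parameter subgroups
`ℝ → G` (continuous homomorphisms, which for a Lie group are automatically smooth and correspond
to their velocities at `0`). For Abelian `G` the sum is the pointwise product and `r • X` is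
`t ↦ X (r t)`; the Lie bracket is zero. -/
def LieAlg : Type _ := Additive (Multiplicative ℝ →ₜ* G)

instance : AddCommGroup (LieAlg G) := inferInstanceAs (AddCommGroup (Additive _))

variable {G}

namespace LieAlg

/-- The value `exp (t X)` at time `t` of the one-parameter subgroup `X`. -/
def flow (X : LieAlg G) (t : ℝ) : G := X.toMul (Multiplicative.ofAdd t)

/-- A one-parameter subgroup from a continuous additive-to-multiplicative map. -/
def ofFlow (f : ℝ → G) (hc : Continuous f) (hadd : ∀ s t, f (s + t) = f s * f t) : LieAlg G :=
  Additive.ofMul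
    { toMonoidHom := MonoidHom.mk' (fun t : Multiplicative ℝ => f t.toAdd)
        (fun s t => hadd s.toAdd t.toAdd)
      continuous_toFun := hc.comp continuous_toAdd }

@[simp] theorem flow_ofFlow (f : ℝ → G) (hc hadd) (t : ℝ) : (ofFlow f hc hadd).flow t = f t := rfl

theorem ext {X Y : LieAlg G} (h : ∀ t, X.flow t = Y.flow t) : X = Y :=
  ContinuousMonoidHom.ext (A := Multiplicative ℝ) (B := G) h

theorem continuous_flow (X : LieAlg G) : Continuous X.flow :=
  (ContinuousMonoidHom.continuous_toFun (X.toMul)).comp continuous_ofAdd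

theorem flow_add_time (X : LieAlg G) (s t : ℝ) : X.flow (s + t) = X.flow s * X.flow t :=
  map_mul (X.toMul) (Multiplicative.ofAdd s) (Multiplicative.ofAdd t)

@[simp] theorem flow_zero_time (X : LieAlg G) : X.flow 0 = 1 := map_one (X.toMul)

@[simp] theorem add_flow (X Y : LieAlg G) (t : ℝ) : (X + Y).flow t = X.flow t * Y.flow t := rfl

instance : SMul ℝ (LieAlg G) where
  smul r X := ofFlow (fun t => X.flow (r * t)) (X.continuous_flow.comp (continuous_const_mul r))
    (fun s t => by rw [mul_add, flow_add_time])

@[simp] theorem smul_flow (r : ℝ) (X : LieAlg G) (t : ℝ) : (r • X).flow t = X.flow (r * t) := rfl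

@[simp] theorem zero_flow (t : ℝ) : (0 : LieAlg G).flow t = 1 := rfl

instance : Module ℝ (LieAlg G) where
  one_smul X := ext fun t => by simp
  mul_smul r s X := ext fun t => by simp only [smul_flow]; congr 1; ring
  smul_zero r := ext fun t => by simp
  smul_add r X Y := ext fun t => by simp
  add_smul r s X := ext fun t => by simp [add_mul, flow_add_time]
  zero_smul X := ext fun t => by simp

/-- The exponential map. -/
def exp (X : LieAlg G) : G := X.flow 1

end LieAlg

/-- The linear map between Lie algebras induced by a Lie group homomorphism `G^ι → G^κ`,
where the Lie algebra of `G^ι` is identified with `(LieAlg G)^ι`. -/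
def lieMap {ι κ : Type*} (Φ : (ι → G) →ₜ* (κ → G)) : (ι → LieAlg G) →ₗ[ℝ] (κ → LieAlg G) where
  toFun X k := LieAlg.ofFlow (fun t => Φ (fun i => (X i).flow t) k)
    ((continuous_apply k).comp
      ((map_continuous Φ).comp (continuous_pi fun i => (X i).continuous_flow)))
    (fun s t => by
      have h : (fun i => (X i).flow (s + t)) =
          (fun i => (X i).flow s) * (fun i => (X i).flow t) := by
        ext i; exact (X i).flow_add_time s t
      rw [h, map_mul, Pi.mul_apply])
  map_add' X Y := by
    ext k
    refine LieAlg.ext fun t => ?_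
    have h : (fun i => ((X + Y) i).flow t) = (fun i => (X i).flow t) * (fun i => (Y i).flow t) := by
      ext i; rfl
    simp only [LieAlg.flow_ofFlow, Pi.add_apply, LieAlg.add_flow] at h ⊢
    rw [h, map_mul, Pi.mul_apply]
  map_smul' r X := by
    ext k
    exact LieAlg.ext fun t => rfl

@[simp] theorem lieMap_flow {ι κ : Type*} (Φ : (ι → G) →ₜ* (κ → G)) (X : ι → LieAlg G) (k : κ)
    (t : ℝ) : (lieMap Φ X k).flow t = Φ (fun i => (X i).flow t) k := rfl

theorem LieAlg.sum_flow {ι : Type*} (s : Finset ι) (X : ι → LieAlg G) (t : ℝ) :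
    (∑ i ∈ s, X i).flow t = ∏ i ∈ s, (X i).flow t := by
  classical
  induction s using Finset.induction_on with
  | empty => simp
  | insert a s ha ih => simp [Finset.sum_insert ha, Finset.prod_insert ha, ih]

theorem LieAlg.zsmul_flow (n : ℤ) (X : LieAlg G) (t : ℝ) :
    (n • X).flow t = X.flow t ^ n := by
  let φ : LieAlg G →+ Additive G :=
    { toFun := fun Y => Additive.ofMul (Y.flow t)
      map_zero' := rfl
      map_add' := fun _ _ => rfl }
  exact congrArg Additive.toMul (map_zsmul φ n X)

theorem linCoboundary_flow {ι κ : Type*} [Fintype ι] (M : κ → ι → ℤ) (X : ι → LieAlg G) (t : ℝ) :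
    (fun k => (linCoboundary M (LieAlg G) X k).flow t) =
      coboundary M G (fun i => (X i).flow t) := by
  ext k
  simp [linCoboundary, coboundary, LieAlg.sum_flow, LieAlg.zsmul_flow]

end LieAlg

/-! ### Cochains, coboundary operators and cochain maps -/

section Cochains

variable {N N' N'' : ℕ} {K : PolyhedralComplex N} {K' : PolyhedralComplex N'}
  {K'' : PolyhedralComplex N''}
variable (G : Type*) [CommGroup G]

/-- `d₀ : C⁰(K; G) → C¹(K; G)`, where `Cᵏ(K; G) = (K.Cell k → G)`. -/
abbrev d₀ (O : K.CellOrientation) : (K.Cell 0 → G) →* (K.Cell 1 → G) := coboundary O.inc₁ G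

/-- `d₁ : C¹(K; G) → C²(K; G)`. -/
abbrev d₁ (O : K.CellOrientation) : (K.Cell 1 → G) →* (K.Cell 2 → G) := coboundary O.inc₂ G

/-- The space of gauge equivalence classes `C¹(K; G) / C⁰(K; G)`: the gauge transformation `c₀` acts
by multiplication with `d₀ c₀`, so this is the quotient group by the image of `d₀`. -/
abbrev GaugeQuot (O : K.CellOrientation) : Type _ := (K.Cell 1 → G) ⧸ (d₀ G O).range

/-- The group `Im d₁ ⊆ C²(K; G)`. -/
abbrev ImD₁ (O : K.CellOrientation) : Type _ := (d₁ G O).range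

variable [TopologicalSpace G] [IsTopologicalGroup G]

/-- `Im d₁ ⊆ C²(K; 𝔤)`. -/
abbrev LieImD₁ (O : K.CellOrientation) : Type _ :=
  LinearMap.range (linCoboundary O.inc₂ (LieAlg G))

theorem continuous_coboundary {ι κ : Type*} [Fintype ι] (M : κ → ι → ℤ) :
    Continuous (coboundary M G) :=
  continuous_pi fun _ => continuous_finsetProd _ fun i _ => (continuous_apply i).zpow _

instance [CompactSpace G] (O : K.CellOrientation) : CompactSpace (ImD₁ G O) :=
  isCompact_iff_compactSpace.mp (isCompact_range (continuous_coboundary G O.inc₂))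

/-- The exponential map of the Lie group `Im d₁ ⊆ C²(K; G)`, whose Lie algebra is
`Im d₁ ⊆ C²(K; 𝔤)`; it is the restriction of the exponential map of `C²(K; G)`. -/
def imExp (O : K.CellOrientation) (X : LieImD₁ G O) : ImD₁ G O :=
  ⟨fun p => (X.1 p).exp, by
    obtain ⟨Y, hY⟩ := X.2
    exact ⟨fun e => (Y e).exp, by rw [← hY]; exact (linCoboundary_flow O.inc₂ Y 1).symm⟩⟩

/-- A cochain map `C•(K; G) → C•(K'; G)` in degrees `0, 1, 2` consisting of surjective Lie group
homomorphisms (continuous homomorphisms of Lie groups are automatically smooth). -/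
structure SurjCochainMap (O : K.CellOrientation) (O' : K'.CellOrientation) where
  P₀ : (K.Cell 0 → G) →ₜ* (K'.Cell 0 → G)
  P₁ : (K.Cell 1 → G) →ₜ* (K'.Cell 1 → G)
  P₂ : (K.Cell 2 → G) →ₜ* (K'.Cell 2 → G)
  surj₀ : Function.Surjective P₀
  surj₁ : Function.Surjective P₁
  surj₂ : Function.Surjective P₂
  comm₀ : ∀ c, P₁ (d₀ G O c) = d₀ G O' (P₀ c)
  comm₁ : ∀ c, P₂ (d₁ G O c) = d₁ G O' (P₁ c)

namespace SurjCochainMap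

variable {G} {O : K.CellOrientation} {O' : K'.CellOrientation} {O'' : K''.CellOrientation}

/-- The identity cochain map. -/
def id (O : K.CellOrientation) : SurjCochainMap G O O where
  P₀ := .id _
  P₁ := .id _
  P₂ := .id _
  surj₀ := Function.surjective_id
  surj₁ := Function.surjective_id
  surj₂ := Function.surjective_id
  comm₀ _ := rfl
  comm₁ _ := rfl

/-- The composite `g ∘ f`. -/
def comp (g : SurjCochainMap G O' O'') (f : SurjCochainMap G O O') : SurjCochainMap G O O'' where
  P₀ := g.P₀.comp f.P₀
  P₁ := g.P₁.comp f.P₁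
  P₂ := g.P₂.comp f.P₂
  surj₀ := g.surj₀.comp f.surj₀
  surj₁ := g.surj₁.comp f.surj₁
  surj₂ := g.surj₂.comp f.surj₂
  comm₀ c := (congrArg g.P₁ (f.comm₀ c)).trans (g.comm₀ _)
  comm₁ c := (congrArg g.P₂ (f.comm₁ c)).trans (g.comm₁ _)

/-- The homomorphism `C¹(K; G) / C⁰(K; G) → C¹(K'; G) / C⁰(K'; G)` induced by a cochain map. -/
def bar (f : SurjCochainMap G O O') : GaugeQuot G O →* GaugeQuot G O' :=
  QuotientGroup.map _ _ f.P₁.toMonoidHom (by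
    rintro _ ⟨c, rfl⟩
    exact ⟨f.P₀ c, (f.comm₀ c).symm⟩)

/-- The linear map `Im d₁ → Im d₁` of subspaces of `C²(K; 𝔤)` and `C²(K'; 𝔤)` induced by a cochain
map. -/
def lieP₂ (f : SurjCochainMap G O O') : LieImD₁ G O →ₗ[ℝ] LieImD₁ G O' :=
  (lieMap f.P₂).restrict (by
    rintro _ ⟨Y, rfl⟩
    refine ⟨lieMap f.P₁ Y, ?_⟩
    ext p
    refine LieAlg.ext fun t => ?_
    have h := congrFun (linCoboundary_flow O'.inc₂ (lieMap f.P₁ Y) t) p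
    rw [lieMap_flow, linCoboundary_flow, f.comm₁]
    exact h)

end SurjCochainMap

/-- The composites `P_{ij} = P_{j+1} ∘ ⋯ ∘ P_i : C•(K_i; G) → C•(K_j; G)`, `j ≤ i`, of a sequence of
cochain maps `P (i) : C•(K_{i+1}; G) → C•(K_i; G)`. -/
def iterate {G : Type*} [CommGroup G] [TopologicalSpace G] [IsTopologicalGroup G]
    {N : ℕ → ℕ} {K : ∀ i, PolyhedralComplex (N i)} {O : ∀ i, (K i).CellOrientation}
    (P : ∀ i, SurjCochainMap G (O (i + 1)) (O i)) {i j : ℕ} (h : j ≤ i) :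
    SurjCochainMap G (O i) (O j) :=
  Nat.leRecOn (C := fun m => SurjCochainMap G (O m) (O j)) h (fun {k} g => g.comp (P k))
    (SurjCochainMap.id (O j))

end Cochains

/-! ### Renormalized inner products -/

section InnerProducts

/-- The bilinear form `B` is an inner product. -/
structure IsInnerProduct {V : Type*} [AddCommGroup V] [Module ℝ V]
    (B : LinearMap.BilinForm ℝ V) : Prop where
  symm : ∀ x y, B x y = B y x
  pos : ∀ x, x ≠ 0 → 0 < B x x

variable {V W : Type*} [AddCommGroup V] [Module ℝ V] [AddCommGroup W] [Module ℝ W]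

/-- The image `Im P*` of the adjoint of `P : V → W` with respect to the inner products `B` on `V`
and `C` on `W`: `x = P* w` means that `⟨x, v⟩ = ⟨w, P v⟩` for all `v`. -/
def adjointRange (B : LinearMap.BilinForm ℝ V) (C : LinearMap.BilinForm ℝ W) (P : V →ₗ[ℝ] W) :
    Submodule ℝ V where
  carrier := {x | ∃ w, ∀ v, B x v = C w (P v)}
  add_mem' := by
    rintro x y ⟨a, ha⟩ ⟨b, hb⟩
    exact ⟨a + b, fun v => by simp [ha, hb]⟩
  zero_mem' := ⟨0, fun v => by simp⟩
  smul_mem' := by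
    rintro r x ⟨a, ha⟩
    exact ⟨r • a, fun v => by simp [ha]⟩

open Classical in
/-- One step of the renormalization. With respect to the decomposition `V = Im P* ⊕ (Im P*)ᗮ`
(adjoint and orthogonal complement for the inner products `B`, `C`) the new form is the pullback of
`D` via `P` on the first summand, equals `B` on the second one, and makes the two summands
orthogonal. (The value `0` in the absence of such a decomposition is a convention that is not met
for inner products on finite-dimensional spaces.) -/
def renormStep (B : LinearMap.BilinForm ℝ V) (C : LinearMap.BilinForm ℝ W) (P : V →ₗ[ℝ] W)
    (D : LinearMap.BilinForm ℝ W) : LinearMap.BilinForm ℝ V :=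
  let U := adjointRange B C P
  if h : IsCompl U (B.orthogonal U) then
    D.comp (P ∘ₗ U.projection _ h) (P ∘ₗ U.projection _ h) +
      B.comp ((B.orthogonal U).projection _ h.symm) ((B.orthogonal U).projection _ h.symm)
  else 0

/-- The sequence of renormalized inner products: `⟨·,·⟩ʳ₀ = ⟨·,·⟩₀`, and `⟨·,·⟩ʳ_{i+1}` is
constructed from `⟨·,·⟩_{i+1}`, `⟨·,·⟩_i` and `⟨·,·⟩ʳ_i`. -/
def renormalized {V : ℕ → Type*} [∀ i, AddCommGroup (V i)] [∀ i, Module ℝ (V i)]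
    (B : ∀ i, LinearMap.BilinForm ℝ (V i)) (P : ∀ i, V (i + 1) →ₗ[ℝ] V i) :
    ∀ i, LinearMap.BilinForm ℝ (V i)
  | 0 => B 0
  | i + 1 => renormStep (B (i + 1)) (B i) (P i) (renormalized B P i)

end InnerProducts

/-! ### Heat kernels and Villain measures -/

section HeatKernel

/-- The normalized Haar measure of a compact group. -/
abbrev haarProb (A : Type*) [Group A] [TopologicalSpace A] [IsTopologicalGroup A] [CompactSpace A]
    [MeasurableSpace A] [BorelSpace A] : Measure A := Measure.haarMeasure ⊤

variable {V A : Type*} [AddCommGroup V] [Module ℝ V] [CommGroup A]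

/-- The derivative of `f : A → ℝ` along the invariant vector field on `A` defined by the Lie algebra
element `X`, where `e` is the exponential map. -/
def invDeriv (e : V → A) (X : V) (f : A → ℝ) (a : A) : ℝ :=
  deriv (fun s : ℝ => f (a * e (s • X))) 0

/-- `H t a` (for `t > 0`) is the heat kernel of the compact connected Abelian Lie group `A` with
Lie algebra `V`, exponential map `e : V → A`, and the invariant Riemannian metric induced by the
inner product `B` on `V`. In terms of a `B`-orthonormal basis `b` of `V`, the Laplacian is
`Δ = - ∑ j, (X_j)²` where `X_j` is the invariant vector field defined by `b j`. The heat kernel is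
smooth on `(0, ∞) × A` (in exponential coordinates around every point), solves the heat equation
`∂H/∂t = - Δ H`, and converges to the Dirac measure at the identity as `t → 0`.
Integrals are with respect to the normalized Haar measure. -/
def IsHeatKernel [TopologicalSpace A] [IsTopologicalGroup A] [CompactSpace A] [MeasurableSpace A]
    [BorelSpace A] (e : V → A) (B : LinearMap.BilinForm ℝ V) (H : ℝ → A → ℝ) : Prop :=
  ∃ (m : ℕ) (b : Module.Basis (Fin m) ℝ V),
    (∀ j k, B (b j) (b k) = if j = k then 1 else 0) ∧
    (∀ a : A, ContDiffOn ℝ ∞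
      (fun q : ℝ × (Fin m → ℝ) => H q.1 (a * e (∑ j, q.2 j • b j))) (Set.Ioi 0 ×ˢ Set.univ)) ∧
    (∀ t, 0 < t → ∀ a : A,
      deriv (fun s => H s a) t = ∑ j, invDeriv e (b j) (invDeriv e (b j) (H t)) a) ∧
    (∀ f : C(A, ℝ), Tendsto (fun t => ∫ a, H t a * f a ∂(haarProb A)) (𝓝[>] 0) (𝓝 (f 1)))

open Classical in
/-- The heat kernel (with the convention `0` if there is none). -/
def heatKernel [TopologicalSpace A] [IsTopologicalGroup A] [CompactSpace A] [MeasurableSpace A]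
    [BorelSpace A] (e : V → A) (B : LinearMap.BilinForm ℝ V) : ℝ → A → ℝ :=
  if h : ∃ H, IsHeatKernel e B H then h.choose else 0

variable {N : ℕ} {K : PolyhedralComplex N} {G : Type*} [CommGroup G] [TopologicalSpace G]
  [IsTopologicalGroup G] [CompactSpace G] [SecondCountableTopology G] [MeasurableSpace G]
  [BorelSpace G]

/-- The unnormalized density `H_β ∘ d₁` on `C¹(K; G)`, where `H_β` is the heat kernel on `Im d₁`
associated to the inner product `B`. -/
def villainDensity (O : K.CellOrientation) (B : LinearMap.BilinForm ℝ (LieImD₁ G O)) (β : ℝ)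
    (c : K.Cell 1 → G) : ENNReal :=
  ENNReal.ofReal (heatKernel (imExp G O) B β ((d₁ G O).rangeRestrict c))

/-- The modified Villain measure `z (H_β ∘ d₁) ν` on `C¹(K; G)`, where `ν` is the normalized Haar
measure on `C¹(K; G)` and `z` is the normalization constant. -/
def villainMeasure (O : K.CellOrientation) (B : LinearMap.BilinForm ℝ (LieImD₁ G O)) (β : ℝ) :
    Measure (K.Cell 1 → G) :=
  (∫⁻ c, villainDensity O B β c ∂(haarProb (K.Cell 1 → G)))⁻¹ •
    (haarProb (K.Cell 1 → G)).withDensity (villainDensity O B β)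

/-- The modified Villain measure on `C¹(K; G) / C⁰(K; G)`, pushed forward by the quotient map. -/
def villainMeasureBar (O : K.CellOrientation) (B : LinearMap.BilinForm ℝ (LieImD₁ G O)) (β : ℝ) :
    Measure (GaugeQuot G O) :=
  (villainMeasure O B β).map (QuotientGroup.mk (s := (d₀ G O).range))

end HeatKernel

/-! ### Projective systems of measures -/

section Projective

variable {X : ℕ → Type*} [∀ i, TopologicalSpace (X i)] [∀ i, MeasurableSpace (X i)]

/-- A projective system of Borel probability measures: topological spaces `X i`, compatible
continuous maps `p : X i → X j` for `j ≤ i`, and Borel probability measures `μ i` on `X i` such that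
the pushforward of `μ i` along `X i → X j` is `μ j`. -/
structure IsProjectiveSystem (p : ∀ {i j : ℕ}, j ≤ i → X i → X j) (μ : ∀ i, Measure (X i)) :
    Prop where
  borel : ∀ i, BorelSpace (X i)
  continuous : ∀ {i j} (h : j ≤ i), Continuous (p h)
  map_self : ∀ i (x : X i), p le_rfl x = x
  map_map : ∀ {i j k} (h : j ≤ i) (h' : k ≤ j) (x : X i), p h' (p h x) = p (h'.trans h) x
  isProbabilityMeasure : ∀ i, IsProbabilityMeasure (μ i)
  map_eq : ∀ {i j} (h : j ≤ i), (μ i).map (p h) = μ j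

/-- The projective limit of the spaces `X i` along the maps `p`: the space of compatible families,
with the subspace topology and σ-algebra of the product (for second countable `X i` with their Borel
σ-algebras this is the Borel σ-algebra of the limit). -/
abbrev ProjLimit (p : ∀ {i j : ℕ}, j ≤ i → X i → X j) : Type _ :=
  {x : ∀ i, X i // ∀ i j (h : j ≤ i), p h (x i) = x j}

end Projective

end AbelianGauge

end

open AbelianGauge

/-! On a second countable compact Hausdorff Abelian group whose characters separate points, finite
measures are determined by their Fourier coefficients (`measure_eq_of_forall_char`), so the
projective property reduces to one computation. Since `H₁ = 0` and `G` is divisible, `Ker d₁ ⊆ Im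
d₀` (`ker_d₁_le_range_d₀`). Hence every character `χ` of `C¹/C⁰` has the form `ψ ∘ d₁` for a
character `ψ` of `Im d₁` (`exists_char_imD₁`). If `ξ` is the differential of `ψ`, the heat equation
and the Dirac initial value force the coefficient of `χ` to be `exp (-β |ξ|²)`, with the norm dual
to the renormalized inner product (`exists_fourier_villainMeasureBar`).

Pulling `χ` back along a projection replaces `ξ` by `ξ ∘ P`, where `P` is the induced map of Lie
algebras. Compatibility of the measures is therefore the identity `|ξ ∘ P| = |ξ|`, which holds when
`P` is a coisometry. The renormalization produces exactly this: `(Im P*)ᗮ = Ker P`, and on `Im P*`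
the new form is pulled back along `P` (`renormStep_spec`, `sum_sq_eq_of_coisometry`). Surjectivity
of `P` enters here; it follows from countability of the kernel of the exponential map
(`IsTorusLike.lieMap_surjective`).

The heat kernel is an arbitrary choice among functions with the defining properties, so both
existence and Fourier coefficients are needed. Existence comes from the series `∑ exp (-t |ξ_χ|²)
χ`, which converges with all derivatives because the frequencies form a discrete group. Comparison
with a Gaussian measure wrapped around the torus yields the initial value of the series, and
positivity and total mass one for every heat kernel.

The Lie theory is condensed in `isTorusLike_of_lieGroup`: the exponential map is a surjective
homomorphism, its kernel is a lattice, and lattice coordinates give characters. The limit measure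
comes from weak compactness of probability measures on the product of the compact factors
(`IsProjectiveSystem.existsUnique_limit`). -/

/-! ### One-parameter subgroups of a Lie group. -/

section OneParameterSubgroups

variable {n : ℕ} {G : Type*} [TopologicalSpace G]
    [ChartedSpace (EuclideanSpace ℝ (Fin n)) G]

section
variable [Group G] [LieGroup (𝓡 n) ∞ G]

/-- Chain rule at the identity for left translation by `g * h`, factored as translation by `h`
followed by translation by `g`. -/
theorem mfderiv_mul_left_mulInvariantVectorField (X : GroupLieAlgebra (𝓡 n) G) (g h : G) :
    mfderiv (𝓡 n) (𝓡 n) (g * ·) h (mulInvariantVectorField X h) =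
      mulInvariantVectorField X (g * h) := by
  have hd : ∀ a b : G, MDifferentiableAt (𝓡 n) (𝓡 n) (a * ·) b := fun a b =>
    (contMDiff_mul_left (I := 𝓡 n) (n := ∞)).contMDiffAt.mdifferentiableAt (by simp)
  have hg : (fun x : G => g * h * x) = (fun x => g * x) ∘ (fun x => h * x) := by
    ext x; simp [mul_assoc]
  have hm : HasMFDerivAt (𝓡 n) (𝓡 n) (g * ·) (h * 1) (mfderiv (𝓡 n) (𝓡 n) (g * ·) h) := by
    have := (hd g (h * 1)).hasMFDerivAt
    rw [mul_one] at this ⊢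
    exact this
  have h1 := hm.comp (1 : G) (hd h 1).hasMFDerivAt
  rw [← hg] at h1
  have h2 := h1.mfderiv
  unfold mulInvariantVectorField
  rw [h2]
  rfl

theorem IsMIntegralCurveOn.mul_left {X : GroupLieAlgebra (𝓡 n) G} {γ : ℝ → G} {s : Set ℝ}
    (h : IsMIntegralCurveOn γ (mulInvariantVectorField (I := 𝓡 n) X) s) (g : G) :
    IsMIntegralCurveOn (fun t => g * γ t) (mulInvariantVectorField (I := 𝓡 n) X) s := by
  intro t ht
  have hd : MDifferentiableAt (𝓡 n) (𝓡 n) (g * ·) (γ t) :=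
    (contMDiff_mul_left (I := 𝓡 n) (n := ∞)).contMDiffAt.mdifferentiableAt (by simp)
  have h1 := hd.hasMFDerivAt.comp_hasMFDerivWithinAt t (h t ht)
  have h2 : (mfderiv (𝓡 n) (𝓡 n) (g * ·) (γ t)).comp ((1 : ℝ →L[ℝ] ℝ).smulRight
      (mulInvariantVectorField (I := 𝓡 n) X (γ t))) = (1 : ℝ →L[ℝ] ℝ).smulRight
      (mulInvariantVectorField (I := 𝓡 n) X (g * γ t)) := by
    rw [← mfderiv_mul_left_mulInvariantVectorField]
    exact ContinuousLinearMap.ext fun r => map_smul (mfderiv (𝓡 n) (𝓡 n) (g * ·) (γ t)) _ _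
  exact h2 ▸ h1

/-- A local integral curve through `1` can be translated to every point without shrinking its time
interval, so the field is complete. Uniqueness of integral curves then makes the global curve a
homomorphism. -/
theorem exists_oneParameterSubgroup [T2Space G] (X : GroupLieAlgebra (𝓡 n) G) :
    ∃ γ : ℝ → G, γ 0 = 1 ∧ (∀ s t, γ (s + t) = γ s * γ t) ∧ Continuous γ ∧
      IsMIntegralCurve γ (mulInvariantVectorField (I := 𝓡 n) X) := by
  have : LieGroup (𝓡 n) (minSmoothness ℝ 3) G :=
    LieGroup.of_le (n := ∞) (by simpa using WithTop.coe_le_coe.2 (le_top : (3 : ℕ∞) ≤ ⊤))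
  have : IsManifold (𝓡 n) 1 G := IsManifold.of_le (n := ∞) (by simp)
  have hv : ContMDiff (𝓡 n) ((𝓡 n).tangent) 1
      (fun g : G => (mulInvariantVectorField X g : TangentBundle (𝓡 n) G)) :=
    (contMDiff_mulInvariantVectorField X).of_le (by simp)
  obtain ⟨γ, h0, hγ⟩ := exists_isMIntegralCurveAt_of_contMDiffAt_boundaryless (0 : ℝ)
    (hv.contMDiffAt (x := 1))
  obtain ⟨ε, hε, hγ⟩ := isMIntegralCurveAt_iff'.1 hγ
  rw [Real.ball_eq_Ioo, zero_sub, zero_add] at hγ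
  -- The translates `x * γ` all live on `(-ε, ε)`: this is the uniform existence time needed for
  -- extension to `ℝ`.
  obtain ⟨δ, hδ0, hδ⟩ := exists_isMIntegralCurve_of_isMIntegralCurveOn hv hε
    (fun x => ⟨fun t => x * γ t, by simp [h0], hγ.mul_left x⟩) 1
  refine ⟨δ, hδ0, fun s t => ?_, hδ.continuous, hδ⟩
  have h1 : IsMIntegralCurve (fun t => δ (t + s)) (mulInvariantVectorField (I := 𝓡 n) X) :=
    hδ.comp_add s
  have h2 : IsMIntegralCurve (fun t => δ s * δ t) (mulInvariantVectorField (I := 𝓡 n) X) := by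
    rw [isMIntegralCurve_iff_isMIntegralCurveOn] at hδ ⊢
    exact hδ.mul_left _
  have := isMIntegralCurve_Ioo_eq_of_contMDiff_boundaryless (t₀ := 0) hv h1 h2 (by simp [hδ0])
  rw [add_comm]
  exact congrFun this t

end
end OneParameterSubgroups

/-! ### The group law in a chart at the identity. -/

section Chart

variable {n : ℕ} {G : Type*} [TopologicalSpace G]
    [ChartedSpace (EuclideanSpace ℝ (Fin n)) G]

/-- Multiplication read in the preferred chart at the identity. -/
noncomputable def chartMul (n : ℕ) (G : Type*) [TopologicalSpace G]
    [ChartedSpace (EuclideanSpace ℝ (Fin n)) G] [Group G]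
    (q : EuclideanSpace ℝ (Fin n) × EuclideanSpace ℝ (Fin n)) : EuclideanSpace ℝ (Fin n) :=
  extChartAt (𝓡 n) (1 : G) ((extChartAt (𝓡 n) (1 : G)).symm q.1 *
    (extChartAt (𝓡 n) (1 : G)).symm q.2)

section
variable [Group G] [LieGroup (𝓡 n) ∞ G]

theorem contDiffAt_chartMul : ContDiffAt ℝ ∞ (chartMul n G)
    (extChartAt (𝓡 n) (1 : G) 1, extChartAt (𝓡 n) (1 : G) 1) := by
  rw [← contMDiffAt_iff_contDiffAt]
  have hsymm : ContMDiffAt 𝓘(ℝ, EuclideanSpace ℝ (Fin n)) (𝓡 n) ∞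
      (extChartAt (𝓡 n) (1 : G)).symm (extChartAt (𝓡 n) (1 : G) 1) :=
    (contMDiffOn_extChartAt_symm (1 : G)).contMDiffAt
      (extChartAt_target_mem_nhds (1 : G))
  have h1 := hsymm.comp (extChartAt (𝓡 n) (1 : G) 1, extChartAt (𝓡 n) (1 : G) 1)
    (contDiff_fst (𝕜 := ℝ) (n := ∞) (E := EuclideanSpace ℝ (Fin n))
      (F := EuclideanSpace ℝ (Fin n))).contMDiff.contMDiffAt
  have h2 := hsymm.comp (extChartAt (𝓡 n) (1 : G) 1, extChartAt (𝓡 n) (1 : G) 1)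
    (contDiff_snd (𝕜 := ℝ) (n := ∞) (E := EuclideanSpace ℝ (Fin n))
      (F := EuclideanSpace ℝ (Fin n))).contMDiff.contMDiffAt
  have h3 := h1.mul h2
  have h4 : ContMDiffAt (𝓡 n) 𝓘(ℝ, EuclideanSpace ℝ (Fin n)) ∞ (extChartAt (𝓡 n) (1 : G))
    ((extChartAt (𝓡 n) (1 : G)).symm (extChartAt (𝓡 n) (1 : G) 1) *
      (extChartAt (𝓡 n) (1 : G)).symm (extChartAt (𝓡 n) (1 : G) 1)) := by
    rw [extChartAt_to_inv, mul_one]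
    exact contMDiffAt_extChartAt
  exact ContMDiffAt.comp (f := (extChartAt (𝓡 n) (1 : G)).symm ∘ Prod.fst *
    (extChartAt (𝓡 n) (1 : G)).symm ∘ Prod.snd)
    (extChartAt (𝓡 n) (1 : G) 1, extChartAt (𝓡 n) (1 : G) 1) h4 h3

theorem eventually_chartMul_right_one : ∀ᶠ a in 𝓝 (extChartAt (𝓡 n) (1 : G) 1),
    chartMul n G (a, extChartAt (𝓡 n) (1 : G) 1) = a := by
  filter_upwards [extChartAt_target_mem_nhds (I := 𝓡 n) (1 : G)] with a ha
  simp only [chartMul, extChartAt_to_inv, mul_one]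
  exact (extChartAt (𝓡 n) (1 : G)).right_inv ha

theorem eventually_chartMul_left_one : ∀ᶠ a in 𝓝 (extChartAt (𝓡 n) (1 : G) 1),
    chartMul n G (extChartAt (𝓡 n) (1 : G) 1, a) = a := by
  filter_upwards [extChartAt_target_mem_nhds (I := 𝓡 n) (1 : G)] with a ha
  simp only [chartMul, extChartAt_to_inv, one_mul]
  exact (extChartAt (𝓡 n) (1 : G)).right_inv ha

/-- Multiplication by the identity on either side is trivial, so the derivative restricts to the
identity on both axes, and a linear map on a product is determined by these restrictions. -/
theorem hasStrictFDerivAt_chartMul : HasStrictFDerivAt (chartMul n G)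
    (ContinuousLinearMap.fst ℝ _ _ + ContinuousLinearMap.snd ℝ _ _)
    (extChartAt (𝓡 n) (1 : G) 1, extChartAt (𝓡 n) (1 : G) 1) := by
  set p := extChartAt (𝓡 n) (1 : G) 1 with hp
  have h := (contDiffAt_chartMul (n := n) (G := G)).hasStrictFDerivAt (by simp)
  set L := fderiv ℝ (chartMul n G) (p, p)
  have hid := hasFDerivAt_id (𝕜 := ℝ) p
  have hc := hasFDerivAt_const (𝕜 := ℝ) p p
  have e1 : L.comp ((ContinuousLinearMap.id ℝ _).prod 0) = ContinuousLinearMap.id ℝ _ :=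
    (HasFDerivAt.comp (f := fun a => (a, p)) p h.hasFDerivAt (hid.prodMk hc)).unique
      (hid.congr_of_eventuallyEq (eventually_chartMul_right_one (n := n) (G := G)))
  have e2 : L.comp ((0 : EuclideanSpace ℝ (Fin n) →L[ℝ] _).prod
      (ContinuousLinearMap.id ℝ _)) = ContinuousLinearMap.id ℝ _ :=
    (HasFDerivAt.comp (f := fun a => (p, a)) p h.hasFDerivAt (hc.prodMk hid)).unique
      (hid.congr_of_eventuallyEq (eventually_chartMul_left_one (n := n) (G := G)))
  suffices hL : L = ContinuousLinearMap.fst ℝ _ _ + ContinuousLinearMap.snd ℝ _ _ from hL ▸ h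
  refine ContinuousLinearMap.ext fun ⟨u, v⟩ => ?_
  have e3 := DFunLike.congr_fun e1 u
  have e4 := DFunLike.congr_fun e2 v
  simp only [ContinuousLinearMap.comp_apply, ContinuousLinearMap.prod_apply,
    ContinuousLinearMap.id_apply, zero_apply] at e3 e4
  have : ((u, v) : EuclideanSpace ℝ (Fin n) × EuclideanSpace ℝ (Fin n)) = (u, 0) + (0, v) := by
    simp
  rw [this, map_add L, e3, e4]
  simp

end

section
variable [Group G] [LieGroup (𝓡 n) ∞ G] 

theorem eventually_chart_mul {α : Type*} {l : Filter α} {f g : α → G}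
    (hf : Tendsto f l (𝓝 1)) (hg : Tendsto g l (𝓝 1)) :
    ∀ᶠ x in l, extChartAt (𝓡 n) (1 : G) (f x * g x) =
      chartMul n G (extChartAt (𝓡 n) (1 : G) (f x), extChartAt (𝓡 n) (1 : G) (g x)) := by
  filter_upwards [hf (extChartAt_source_mem_nhds (I := 𝓡 n) (1 : G)),
    hg (extChartAt_source_mem_nhds (I := 𝓡 n) (1 : G))] with x hx hx'
  simp only [chartMul]
  rw [(extChartAt (𝓡 n) (1 : G)).left_inv hx, (extChartAt (𝓡 n) (1 : G)).left_inv hx']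

/-- The integral curve condition at time `0`, read in the chart at `1`; the invariant field takes
the value `X` there. -/
theorem IsMIntegralCurve.hasFDerivAt_chart {X : GroupLieAlgebra (𝓡 n) G} {γ : ℝ → G}
    (h0 : γ 0 = 1) (h : IsMIntegralCurve γ (mulInvariantVectorField (I := 𝓡 n) X)) :
    HasFDerivAt (fun t => extChartAt (𝓡 n) (1 : G) (γ t))
      ((1 : ℝ →L[ℝ] ℝ).smulRight (X : EuclideanSpace ℝ (Fin n))) 0 := by
  have h1 := (h 0).2
  have h2 : ∀ g : G, g = 1 → (mulInvariantVectorField (I := 𝓡 n) X g :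
      EuclideanSpace ℝ (Fin n)) = X := by
    rintro g rfl
    have h3 : (fun x : G => 1 * x) = id := funext one_mul
    unfold mulInvariantVectorField
    rw [h3]
    exact DFunLike.congr_fun (mfderiv_id (I := 𝓡 n) (x := (1 : G))) X
  have h3 := h2 _ h0
  simp only [writtenInExtChartAt, extChartAt_model_space_eq_id, h0, modelWithCornersSelf_coe,
    Set.range_id] at h1
  rw [← h3]
  exact hasFDerivWithinAt_univ.1 h1

end

end Chart

/-! ### The exponential map of an Abelian Lie group. -/

section ExponentialMap

variable {n : ℕ} {G : Type*} [TopologicalSpace G]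
    [ChartedSpace (EuclideanSpace ℝ (Fin n)) G] [CommGroup G] [LieGroup (𝓡 n) ∞ G]
    [IsTopologicalGroup G]

theorem hasFDerivAt_chart_mul {F : Type*} [NormedAddCommGroup F] [NormedSpace ℝ F]
    {f g : F → G} {x : F} {f' g' : F →L[ℝ] EuclideanSpace ℝ (Fin n)}
    (hf : ContinuousAt f x) (hg : ContinuousAt g x) (hfx : f x = 1) (hgx : g x = 1)
    (hf' : HasFDerivAt (fun y => extChartAt (𝓡 n) (1 : G) (f y)) f' x)
    (hg' : HasFDerivAt (fun y => extChartAt (𝓡 n) (1 : G) (g y)) g' x) :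
    HasFDerivAt (fun y => extChartAt (𝓡 n) (1 : G) (f y * g y)) (f' + g') x := by
  have hm := (hasStrictFDerivAt_chartMul (n := n) (G := G)).hasFDerivAt
  have h1 := hf'.prodMk hg'
  have hm' : HasFDerivAt (chartMul n G)
    (ContinuousLinearMap.fst ℝ _ _ + ContinuousLinearMap.snd ℝ _ _)
    (extChartAt (𝓡 n) (1 : G) (f x), extChartAt (𝓡 n) (1 : G) (g x)) := by
    rw [hfx, hgx]; exact hm
  have h2 := HasFDerivAt.comp (f := fun y => (extChartAt (𝓡 n) (1 : G) (f y),
    extChartAt (𝓡 n) (1 : G) (g y))) x hm' h1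
  have hf1 : Tendsto f (𝓝 x) (𝓝 1) := hfx ▸ hf
  have hg1 : Tendsto g (𝓝 x) (𝓝 1) := hgx ▸ hg
  exact h2.congr_of_eventuallyEq (eventually_chart_mul hf1 hg1)

/-- For a homomorphism, `E x = E y * E (x - y)` transports differentiability at `0` to nearby base
points, uniformly because the group law is strictly differentiable at the identity. The strict form
is what the inverse function theorem requires. -/
theorem hasStrictFDerivAt_chart_of_hasFDerivAt
    {F : Type*} [NormedAddCommGroup F] [NormedSpace ℝ F]
    {E : F → G} {D : F →L[ℝ] EuclideanSpace ℝ (Fin n)} (hE : Continuous E)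
    (hadd : ∀ x y, E (x + y) = E x * E y)
    (hD : HasFDerivAt (fun x => extChartAt (𝓡 n) (1 : G) (E x)) D 0) :
    HasStrictFDerivAt (fun x => extChartAt (𝓡 n) (1 : G) (E x)) D 0 := by
  have hE0 : E 0 = 1 := by simpa using hadd 0 0
  set φ := extChartAt (𝓡 n) (1 : G)
  have hsub : Tendsto (fun q : F × F => q.1 - q.2) (𝓝 (0, 0)) (𝓝 0) :=
    (continuous_fst.sub continuous_snd).tendsto' _ _ (sub_zero 0)
  have hsnd : Tendsto (fun q : F × F => q.2) (𝓝 (0, 0)) (𝓝 0) :=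
    continuous_snd.tendsto ((0 : F), (0 : F))
  have hE1 : Tendsto E (𝓝 0) (𝓝 1) := hE0 ▸ hE.tendsto 0
  have hφ : Tendsto φ (𝓝 1) (𝓝 (φ 1)) := continuousAt_extChartAt (I := 𝓡 n) (1 : G)
  have hm := (hasStrictFDerivAt_chartMul (n := n) (G := G)).isLittleO
  have hlim : Tendsto (fun q : F × F => ((φ (E q.2), φ (E (q.1 - q.2))), (φ (E q.2), φ 1)))
      (𝓝 (0, 0)) (𝓝 ((φ 1, φ 1), (φ 1, φ 1))) :=
    ((hφ.comp (hE1.comp hsnd)).prodMk_nhds (hφ.comp (hE1.comp hsub))).prodMk_nhds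
      ((hφ.comp (hE1.comp hsnd)).prodMk_nhds tendsto_const_nhds)
  have h1 := hm.comp_tendsto hlim
  have h2 : (fun q : F × F => φ (E (q.1 - q.2)) - φ 1 - D (q.1 - q.2)) =o[𝓝 (0, 0)]
      fun q => q.1 - q.2 := by
    have := hD.isLittleO.comp_tendsto (k := fun q : F × F => q.1 - q.2) hsub
    simpa [Function.comp_def, hE0] using this
  have h3 : (fun q : F × F => φ (E (q.1 - q.2)) - φ 1) =O[𝓝 (0, 0)] fun q => q.1 - q.2 := by
    have h4 : (fun q : F × F => D (q.1 - q.2)) =O[𝓝 (0, 0)] fun q => q.1 - q.2 :=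
      D.isBigO_comp _ _
    simpa using h2.isBigO.add h4
  -- The products `E y * E (x - y)` and `E y * 1` are compared: only the second argument moves, by
  -- an amount of order `x - y`.
  have h5 : (fun q : F × F => chartMul n G (φ (E q.2), φ (E (q.1 - q.2))) -
      chartMul n G (φ (E q.2), φ 1) - (φ (E (q.1 - q.2)) - φ 1)) =o[𝓝 (0, 0)]
      fun q => q.1 - q.2 := by
    refine Asymptotics.IsLittleO.trans_isBigO (g := fun q : F × F => φ (E (q.1 - q.2)) - φ 1)
      ?_ h3
    refine (h1.congr_left fun q => by simp).trans_isBigO ?_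
    refine Asymptotics.IsBigO.of_bound 1 (Eventually.of_forall fun q => ?_)
    simp [Prod.norm_def]
  have h6 := h5.add h2
  refine HasStrictFDerivAt.of_isLittleO ?_
  refine h6.congr' ?_ EventuallyEq.rfl
  have h7 := eventually_chart_mul (n := n) (hE1.comp hsnd) (hE1.comp hsub)
  have h8 := (hφ.comp (hE1.comp hsnd)).eventually (eventually_chartMul_right_one (n := n) (G := G))
  filter_upwards [h7, h8] with q h7 h8
  simp only [Function.comp_apply] at h7 h8
  rw [← h7, h8, ← hadd]
  simp only [add_sub_cancel]
  rw [map_sub]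
  abel

/-- The product of the one-parameter subgroups in the coordinate directions is a homomorphism by
commutativity, and its derivative at `0` in the chart is the identity. The inverse function theorem
gives local surjectivity, and invertibility of the derivative isolates `0` in the kernel. -/
theorem exists_exponentialMap [T2Space G] : ∃ E : EuclideanSpace ℝ (Fin n) → G, Continuous E ∧
    (∀ x y, E (x + y) = E x * E y) ∧ map E (𝓝 0) = 𝓝 1 ∧ ∀ᶠ z in 𝓝[≠] 0, E z ≠ 1 := by
  set b := EuclideanSpace.basisFun (Fin n) ℝ with hb
  choose γ hγ0 hγadd hγc hγ using fun j => exists_oneParameterSubgroup (G := G) (b j)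
  have key : ∀ s : Finset (Fin n), HasFDerivAt (fun x : EuclideanSpace ℝ (Fin n) =>
      extChartAt (𝓡 n) (1 : G) (∏ j ∈ s, γ j (x j)))
      (∑ j ∈ s, (EuclideanSpace.proj (𝕜 := ℝ) j).smulRight (b j)) 0 := by
    intro s
    induction s using Finset.induction_on with
    | empty => simpa using hasFDerivAt_const _ _
    | insert a s ha ih =>
      simp only [Finset.prod_insert ha, Finset.sum_insert ha]
      refine hasFDerivAt_chart_mul (f := fun x : EuclideanSpace ℝ (Fin n) => γ a (x a))
        (g := fun x : EuclideanSpace ℝ (Fin n) => ∏ j ∈ s, γ j (x j))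
        (Continuous.continuousAt ((hγc a).comp (EuclideanSpace.proj (𝕜 := ℝ) a).continuous))
        (Continuous.continuousAt (continuous_finsetProd _ fun j _ =>
          (hγc j).comp (EuclideanSpace.proj (𝕜 := ℝ) j).continuous))
        (by simp [hγ0]) (by simp [hγ0]) ?_ ih
      have h1 := IsMIntegralCurve.hasFDerivAt_chart (hγ0 a) (hγ a)
      have h2 := HasFDerivAt.comp (f := fun x : EuclideanSpace ℝ (Fin n) => x a)
        (0 : EuclideanSpace ℝ (Fin n)) (by simpa using h1)
        (EuclideanSpace.proj (𝕜 := ℝ) a).hasFDerivAt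
      refine h2.congr_fderiv ?_
      ext1 x
      simp
  set E : EuclideanSpace ℝ (Fin n) → G := fun x => ∏ j, γ j (x j) with hEdef
  have hE : Continuous E := continuous_finsetProd _ fun j _ =>
          (hγc j).comp (EuclideanSpace.proj (𝕜 := ℝ) j).continuous
  have hadd : ∀ x y, E (x + y) = E x * E y := fun x y => by
    simp [hEdef, hγadd, Finset.prod_mul_distrib]
  have hE0 : E 0 = 1 := by simpa using hadd 0 0
  have hD : HasFDerivAt (fun x => extChartAt (𝓡 n) (1 : G) (E x))
      ((ContinuousLinearEquiv.refl ℝ (EuclideanSpace ℝ (Fin n)) :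
        EuclideanSpace ℝ (Fin n) →L[ℝ] EuclideanSpace ℝ (Fin n))) 0 := by
    refine (key Finset.univ).congr_fderiv ?_
    ext1 x
    have := b.sum_repr x
    simpa [hb] using this
  have hS := hasStrictFDerivAt_chart_of_hasFDerivAt hE hadd hD
  refine ⟨E, hE, hadd, ?_, ?_⟩
  · have h1 := hS.map_nhds_eq_of_equiv
    simp only [hE0] at h1
    have h2 : E =ᶠ[𝓝 0] (extChartAt (𝓡 n) (1 : G)).symm ∘
        (fun x => extChartAt (𝓡 n) (1 : G) (E x)) := by
      have hE1 : Tendsto E (𝓝 0) (𝓝 1) := hE0 ▸ hE.tendsto 0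
      filter_upwards [hE1 (extChartAt_source_mem_nhds (I := 𝓡 n) (1 : G))] with x hx
      exact ((extChartAt (𝓡 n) (1 : G)).left_inv hx).symm
    rw [Filter.map_congr h2, ← Filter.map_map, h1]
    have := map_extChartAt_symm_nhdsWithin_range (I := 𝓡 n) (1 : G)
    simpa using this
  · filter_upwards [hD.eventually_ne (c := extChartAt (𝓡 n) (1 : G) 1)
      ⟨1, fun z => by simp⟩] with z hz h1
    exact hz (by rw [h1])

end ExponentialMap

/-! ### Continuous characters of real vector spaces. -/

section CharactersOfVectorSpaces

/-- Averaging over an interval of length `δ` on which the integral is nonzero expresses `F` through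
its own primitive, so `F` is differentiable and satisfies `F' = k F`. Unit modulus forces `k` to be
purely imaginary. -/
theorem exists_eq_exp_of_continuous_character {f : ℝ → Circle} (hf : Continuous f)
    (hadd : ∀ s t, f (s + t) = f s * f t) : ∃ a : ℝ, ∀ t, f t = Circle.exp (t * a) := by
  set F : ℝ → ℂ := fun t => f t with hF
  have hFc : Continuous F := continuous_subtype_val.comp hf
  have hF0 : F 0 = 1 := by
    have : f 0 = 1 := by simpa using hadd 0 0
    simp [hF, this]
  have hFadd : ∀ s t, F (s + t) = F s * F t := fun s t => by simp [hF, hadd]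
  have hI : ∀ x, HasDerivAt (fun u => ∫ s in (0 : ℝ)..u, F s) (F x) x := fun x =>
    intervalIntegral.integral_hasDerivAt_right (hFc.intervalIntegrable _ _)
      (hFc.stronglyMeasurableAtFilter _ _) hFc.continuousAt
  -- If all these integrals vanished, differentiating at `0` would give `F 0 = 0`, but `F 0 = 1`.
  obtain ⟨δ, hδ⟩ : ∃ δ, (∫ s in (0 : ℝ)..δ, F s) ≠ 0 := by
    by_contra! h
    have h1 := hI 0
    rw [show (fun u => ∫ s in (0 : ℝ)..u, F s) = fun _ => 0 from funext h, hF0] at h1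
    exact zero_ne_one ((hasDerivAt_const (0 : ℝ) (0 : ℂ)).unique h1)
  set c := ∫ s in (0 : ℝ)..δ, F s
  have hrep : ∀ t, F t = c⁻¹ * ((∫ s in (0 : ℝ)..(t + δ), F s) - ∫ s in (0 : ℝ)..t, F s) := by
    intro t
    rw [intervalIntegral.integral_interval_sub_left (hFc.intervalIntegrable _ _)
      (hFc.intervalIntegrable _ _), eq_inv_mul_iff_mul_eq₀ hδ]
    have := intervalIntegral.integral_comp_add_left (a := 0) (b := δ) F t
    rw [add_zero] at this
    rw [← this]
    simp only [hFadd, intervalIntegral.integral_const_mul]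
    rw [mul_comm]
  set k := c⁻¹ * (F δ - 1)
  have hder : ∀ t, HasDerivAt F (k * F t) t := by
    intro t
    have h1 : HasDerivAt (fun u => ∫ s in (0 : ℝ)..(u + δ), F s) (F (t + δ)) t :=
      (hI (t + δ)).comp_add_const t δ
    have h2 := (h1.sub (hI t)).const_mul c⁻¹
    have h3 : HasDerivAt F (c⁻¹ * (F (t + δ) - F t)) t :=
      h2.congr_of_eventuallyEq (Eventually.of_forall hrep)
    refine h3.congr_deriv ?_
    rw [hFadd]
    ring
  have hexp : ∀ t : ℝ, HasDerivAt (fun s : ℝ => Complex.exp (-(k * s)))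
      (Complex.exp (-(k * t)) * -(k * 1)) t := fun t =>
    ((Complex.ofRealCLM.hasDerivAt.const_mul k).neg).cexp
  have hconst : ∀ t : ℝ, F t * Complex.exp (-(k * t)) = 1 := by
    intro t
    have h1 : ∀ t, HasDerivAt (fun s : ℝ => F s * Complex.exp (-(k * s))) 0 t := fun t =>
      ((hder t).mul (hexp t)).congr_deriv (by ring)
    have := is_const_of_deriv_eq_zero (fun t => (h1 t).differentiableAt)
      (fun t => (h1 t).deriv) t 0
    simpa [hF0] using this
  have hFexp : ∀ t : ℝ, F t = Complex.exp (k * t) := fun t => by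
    have := hconst t
    rw [Complex.exp_neg, mul_inv_eq_one₀ (Complex.exp_ne_zero _)] at this
    exact this
  have hre : k.re = 0 := by
    have h1 : ‖F 1‖ = 1 := Circle.norm_coe _
    rw [hFexp, Complex.norm_exp] at h1
    simpa using h1
  refine ⟨k.im, fun t => Circle.ext ?_⟩
  rw [Circle.coe_exp]
  change F t = _
  rw [hFexp]
  congr 1
  apply Complex.ext <;> simp [hre, mul_comm]

theorem exists_eq_exp_dot_of_continuous_character {ι : Type*} [Fintype ι]
    {f : (ι → ℝ) → Circle} (hf : Continuous f)
    (hadd : ∀ x y, f (x + y) = f x * f y) :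
    ∃ a : ι → ℝ, ∀ x, f x = Circle.exp (∑ j, x j * a j) := by
  classical
  choose a ha using fun j => exists_eq_exp_of_continuous_character
    (f := fun t => f (Pi.single j t)) (hf.comp (continuous_single (A := fun _ => ℝ) j))
    (fun s t => by rw [Pi.single_add, hadd])
  refine ⟨a, fun x => ?_⟩
  let φ : Multiplicative (ι → ℝ) →* Circle :=
    MonoidHom.mk' (fun x => f x.toAdd) (fun x y => hadd _ _)
  let ψ : Multiplicative (ℝ) →* Circle :=
    MonoidHom.mk' (fun x => Circle.exp x.toAdd) (fun x y => Circle.exp_add _ _)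
  have h1 := map_prod φ (fun j => Multiplicative.ofAdd (Pi.single j (x j))) Finset.univ
  have h2 := map_prod ψ (fun j => Multiplicative.ofAdd (x j * a j)) Finset.univ
  rw [← ofAdd_sum] at h1 h2
  rw [Finset.univ_sum_single] at h1
  change f x = ∏ j, f (Pi.single j (x j)) at h1
  change Circle.exp _ = ∏ j, Circle.exp _ at h2
  rw [h1]
  refine Eq.trans ?_ h2.symm
  simp [ha]

end CharactersOfVectorSpaces

/-! ### Homomorphisms from a vector space onto a compact group. -/

section OpenMapping

variable {F A : Type*} [NormedAddCommGroup F] [NormedSpace ℝ F] [FiniteDimensional ℝ F]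
  [CommGroup A] [TopologicalSpace A] [IsTopologicalGroup A] [CompactSpace A] [T2Space A]

theorem isOpenMap_of_surjective_of_add {E : F → A} (hE : Continuous E)
    (hadd : ∀ x y, E (x + y) = E x * E y) (hs : Function.Surjective E) : IsOpenMap E := by
  have : ProperSpace F := FiniteDimensional.proper_real F
  let φ : Multiplicative F →* A := MonoidHom.mk' (fun x => E x.toAdd) (fun x y => hadd _ _)
  have : SigmaCompactSpace (Multiplicative F) := inferInstanceAs (SigmaCompactSpace F)
  exact φ.isOpenMap_of_sigmaCompact hs hE

/-- The images of the open balls of integer radius form an open cover of the compact target. The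
resulting bound is used below for the lattice property, for domination under integrals, and for
discreteness of the frequencies. -/
theorem exists_closedBall_surjective_of_add {E : F → A} (hE : Continuous E)
    (hadd : ∀ x y, E (x + y) = E x * E y) (hs : Function.Surjective E) :
    ∃ R : ℝ, 0 < R ∧ ∀ a, ∃ x, ‖x‖ ≤ R ∧ E x = a := by
  have ho := isOpenMap_of_surjective_of_add hE hadd hs
  obtain ⟨t, ht⟩ := isCompact_univ.elim_finite_subcover
    (fun k : ℕ => E '' Metric.ball 0 (k : ℝ)) (fun k => ho _ Metric.isOpen_ball) (fun a _ => by
      obtain ⟨x, rfl⟩ := hs a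
      obtain ⟨k, hk⟩ := exists_nat_gt ‖x‖
      exact Set.mem_iUnion.2 ⟨k, x, by simpa using hk, rfl⟩)
  -- The sum of the finitely many radii dominates each of them; the added `1` makes the bound
  -- positive even if the sum is zero.
  refine ⟨(∑ k ∈ t, (k : ℝ)) + 1, by positivity, fun a => ?_⟩
  obtain ⟨k, hk, x, hx, rfl⟩ := Set.mem_iUnion₂.1 (ht (Set.mem_univ a))
  refine ⟨x, ?_, rfl⟩
  have h1 : (k : ℝ) ≤ ∑ k ∈ t, (k : ℝ) :=
    Finset.single_le_sum (f := fun k : ℕ => (k : ℝ)) (fun _ _ => by positivity) hk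
  have h2 : ‖x‖ < k := by simpa using hx
  linarith

end OpenMapping

/-! ### The kernel of the exponential map is a lattice. -/

section Torus

variable {n : ℕ} {G : Type*} [TopologicalSpace G]
    [ChartedSpace (EuclideanSpace ℝ (Fin n)) G] [CommGroup G] [LieGroup (𝓡 n) ∞ G]
    [IsTopologicalGroup G] [T2Space G] [CompactSpace G] [ConnectedSpace G]

/-- The image is a subgroup containing a neighbourhood of `1`, hence open and closed in a connected
group. -/
theorem surjective_of_map_nhds {F : Type*} [AddCommGroup F] [TopologicalSpace F]
    {E : F → G} (hadd : ∀ x y, E (x + y) = E x * E y)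
    (hn : map E (𝓝 0) = 𝓝 1) : Function.Surjective E := by
  let φ : Multiplicative F →* G := MonoidHom.mk' (fun x => E x.toAdd) (fun x y => hadd _ _)
  have h1 : (φ.range : Set G) ∈ 𝓝 (1 : G) := by
    rw [← hn]
    exact Filter.mem_map.2 (univ_mem' fun x => ⟨Multiplicative.ofAdd x, rfl⟩)
  have h2 : IsOpen (φ.range : Set G) := Subgroup.isOpen_of_mem_nhds _ h1
  have h3 : IsClopen (φ.range : Set G) := ⟨Subgroup.isClosed_of_isOpen _ h2, h2⟩
  have h4 := h3.eq_univ ⟨1, one_mem _⟩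
  intro g
  have : g ∈ (φ.range : Set G) := h4 ▸ Set.mem_univ g
  obtain ⟨x, hx⟩ := this
  exact ⟨x.toAdd, hx⟩

variable (n G) in
/-- A compact connected Abelian Lie group is the quotient of a vector space by the lattice spanned
by a basis, and the coordinates with respect to this basis give characters. -/
theorem exists_torus_structure : ∃ (E : EuclideanSpace ℝ (Fin n) → G) (ι : Type) (_ : Fintype ι)
    (b : Module.Basis ι ℝ (EuclideanSpace ℝ (Fin n))) (χ : ι → G →ₜ* Circle),
    Continuous E ∧ (∀ x y, E (x + y) = E x * E y) ∧ Function.Surjective E ∧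
    {x | E x = 1}.Countable ∧ (∀ i x, χ i (E x) = Circle.exp (b.repr x i * (2 * Real.pi))) ∧
    (∀ g, (∀ i, χ i g = 1) → g = 1) := by
  obtain ⟨E, hE, hadd, hn, hd⟩ := exists_exponentialMap (n := n) (G := G)
  have hs := surjective_of_map_nhds hadd hn
  have hE0 : E 0 = 1 := by simpa using hadd 0 0
  obtain ⟨R, hR, hball⟩ := exists_closedBall_surjective_of_add hE hadd hs
  let φ : EuclideanSpace ℝ (Fin n) →+ Additive G :=
    AddMonoidHom.mk' (fun x => Additive.ofMul (E x)) hadd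
  let L : Submodule ℤ (EuclideanSpace ℝ (Fin n)) := AddSubgroup.toIntSubmodule φ.ker
  have hL : ∀ x, x ∈ L ↔ E x = 1 := fun x => Iff.rfl
  have hdisc : DiscreteTopology L := by
    refine discreteTopology_of_isOpen_singleton_zero ?_
    rw [eventually_nhdsWithin_iff, eventually_nhds_iff] at hd
    obtain ⟨U, hU, hUo, h0⟩ := hd
    refine ⟨U, hUo, ?_⟩
    ext x
    constructor
    · intro hx
      by_contra hne
      exact hU x hx (fun h => hne (Subtype.ext h)) ((hL x).1 x.2)
    · rintro rfl
      exact h0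
  -- If some `v ≠ 0` were orthogonal to the kernel, the multiple of `v` of length `R + 1` would
  -- differ by a kernel element from some `y` with `‖y‖ ≤ R`. Pairing with `v` gives `(R + 1) ‖v‖ =
  -- ⟪y, v⟫ ≤ R ‖v‖`.
  have hlat : IsZLattice ℝ L := by
    refine ⟨?_⟩
    by_contra hne
    set S := Submodule.span ℝ (L : Set (EuclideanSpace ℝ (Fin n)))
    have : Sᗮ ≠ ⊥ := fun h => hne (Submodule.orthogonal_eq_bot_iff.1 h)
    obtain ⟨v, hv, hv0⟩ := Submodule.exists_mem_ne_zero_of_ne_bot this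
    have hv' : 0 < ‖v‖ := norm_pos_iff.2 hv0
    obtain ⟨y, hy, hyE⟩ := hball (E ((((R + 1) / ‖v‖) : ℝ) • v))
    have hmem : (((R + 1) / ‖v‖ : ℝ) • v) - y ∈ L := by
      rw [hL, ← mul_left_inj (E y), ← hadd, sub_add_cancel, one_mul, hyE]
    have h1 := Submodule.inner_right_of_mem_orthogonal (Submodule.subset_span hmem) hv
    rw [inner_sub_left, inner_smul_left, real_inner_self_eq_norm_sq] at h1
    have h2 := real_inner_le_norm y v
    have h3 : ((R + 1) / ‖v‖) * ‖v‖ ^ 2 = (R + 1) * ‖v‖ := by field_simp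
    simp only [conj_trivial] at h1
    rw [h3] at h1
    nlinarith
  have : Module.Free ℤ L := ZLattice.module_free ℝ L
  have : Module.Finite ℤ L := ZLattice.module_finite ℝ L
  let b₀ := Module.Free.chooseBasis ℤ L
  let b := b₀.ofZLatticeBasis ℝ L
  have hchar : ∀ i, ∃ χ : G →ₜ* Circle, ∀ x,
      χ (E x) = Circle.exp (b.repr x i * (2 * Real.pi)) := by
    intro i
    have hq : IsQuotientMap E := (isOpenMap_of_surjective_of_add hE hadd hs).isQuotientMap hE hs
    -- Kernel elements have integral lattice coordinates, so a coordinate modulo `1` descends to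
    -- `G`.
    have hwd : ∀ x y, E x = E y → Circle.exp (b.repr x i * (2 * Real.pi)) =
        Circle.exp (b.repr y i * (2 * Real.pi)) := by
      intro x y hxy
      have hmem : x - y ∈ L := by
        rw [hL, ← mul_left_inj (E y), ← hadd, sub_add_cancel, one_mul, hxy]
      have h1 := b₀.ofZLatticeBasis_repr_apply ℝ L ⟨x - y, hmem⟩ i
      simp only [map_sub] at h1
      rw [Finsupp.sub_apply] at h1
      refine Circle.exp_eq_exp.2 ⟨b₀.repr ⟨x - y, hmem⟩ i, ?_⟩
      rw [← h1]
      ring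
    let χ : G → Circle := fun g => Circle.exp (b.repr (Function.surjInv hs g) i * (2 * Real.pi))
    have hχ : ∀ x, χ (E x) = Circle.exp (b.repr x i * (2 * Real.pi)) := fun x =>
      hwd _ _ (Function.surjInv_eq hs _)
    refine ⟨{ toMonoidHom := MonoidHom.mk' χ fun g h => ?_, continuous_toFun := ?_ }, hχ⟩
    · obtain ⟨x, rfl⟩ := hs g
      obtain ⟨y, rfl⟩ := hs h
      rw [← hadd, hχ, hχ, hχ, ← Circle.exp_add]
      simp [add_mul]
    · refine hq.continuous_iff.2 ?_
      have : χ ∘ E = fun x => Circle.exp (b.coord i x * (2 * Real.pi)) := funext hχ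
      change Continuous (χ ∘ E)
      rw [this]
      exact Circle.exp.continuous.comp
        (((b.coord i).continuous_of_finiteDimensional).mul continuous_const)
  choose χ hχ using hchar
  refine ⟨E, _, inferInstance, b, χ, hE, hadd, hs, ?_, hχ, fun g hg => ?_⟩
  · have : Countable L := inferInstance
    exact (Set.to_countable (L : Set (EuclideanSpace ℝ (Fin n)))).mono fun x hx => hx
  · obtain ⟨x, rfl⟩ := hs g
    rw [← hL]
    have h1 : ∀ i, ∃ m : ℤ, b.repr x i = m := by
      intro i
      obtain ⟨m, hm⟩ := Circle.exp_eq_one.1 ((hχ i x).symm.trans (hg i))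
      exact ⟨m, mul_right_cancel₀ (by positivity) hm⟩
    choose m hm using h1
    rw [← b.sum_repr x]
    refine Submodule.sum_mem _ fun i _ => ?_
    rw [hm, Int.cast_smul_eq_zsmul, b₀.ofZLatticeBasis_apply ℝ L]
    exact Submodule.smul_mem _ _ (b₀ i).2

end Torus

/-! ### The Lie algebra of one-parameter subgroups, and induced maps. -/

section TorusLike

namespace AbelianGauge

@[simp] theorem LieAlg.exp_add {G : Type*} [CommGroup G] [TopologicalSpace G]
    [IsTopologicalGroup G] (X Y : LieAlg G) : (X + Y).exp = X.exp * Y.exp := rfl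

/-- The properties of compact connected Abelian Lie groups that do not refer to charts. -/
structure IsTorusLike (G : Type*) [CommGroup G] [TopologicalSpace G] [IsTopologicalGroup G] :
    Prop where
  finite : Module.Finite ℝ (LieAlg G)
  exp_surjective : Function.Surjective (LieAlg.exp (G := G))
  countable_ker : {X : LieAlg G | X.exp = 1}.Countable
  separates : ∀ g : G, (∀ χ : G →ₜ* Circle, χ g = 1) → g = 1

theorem isTorusLike_of_lieGroup (n : ℕ) (G : Type*) [TopologicalSpace G]
    [ChartedSpace (EuclideanSpace ℝ (Fin n)) G] [CommGroup G] [LieGroup (𝓡 n) ∞ G]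
    [IsTopologicalGroup G] [T2Space G] [CompactSpace G] [ConnectedSpace G] : IsTorusLike G := by
  obtain ⟨E, ι, _, b, χ, hE, hadd, hs, hcount, hχ, hsep⟩ := exists_torus_structure n G
  have hE0 : E 0 = 1 := by simpa using hadd 0 0
  let T : EuclideanSpace ℝ (Fin n) →ₗ[ℝ] LieAlg G :=
    { toFun := fun x => LieAlg.ofFlow (fun t => E (t • x)) (hE.comp (by fun_prop))
        (fun s t => by rw [add_smul, hadd])
      map_add' := fun x y => LieAlg.ext fun t => by simp [hadd]
      map_smul' := fun r x => LieAlg.ext fun t => by simp [smul_smul, mul_comm] }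
  have hT : ∀ x t, (T x).flow t = E (t • x) := fun x t => rfl
  have hTexp : ∀ x, (T x).exp = E x := fun x => by simp [LieAlg.exp, hT]
  -- A one-parameter subgroup is recovered from its images under the coordinate characters: each has
  -- the form `t ↦ exp (i t aᵢ)`, which prescribes the lattice coordinate `aᵢ / 2π`, and these
  -- characters separate points.
  have hTs : Function.Surjective T := by
    intro X
    choose a ha using fun i => exists_eq_exp_of_continuous_character
      (f := fun t => χ i (X.flow t)) ((map_continuous (χ i)).comp X.continuous_flow)
      (fun s t => by rw [X.flow_add_time, map_mul])
    refine ⟨∑ i, (a i / (2 * Real.pi)) • b i, LieAlg.ext fun t => ?_⟩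
    rw [hT, ← div_eq_one]
    refine hsep _ fun i => ?_
    rw [map_div, hχ, ha, div_eq_one]
    rw [map_smul, Finsupp.smul_apply, b.repr_sum_self]
    congr 1
    simp only [smul_eq_mul]
    field_simp
  refine ⟨Module.Finite.of_surjective T hTs, fun g => ?_, ?_, fun g hg => hsep g fun i => hg _⟩
  · obtain ⟨x, rfl⟩ := hs g
    exact ⟨T x, hTexp x⟩
  · refine (hcount.image T).mono fun X hX => ?_
    obtain ⟨x, rfl⟩ := hTs X
    exact ⟨x, by rwa [Set.mem_ofPred_eq, ← hTexp], rfl⟩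

section

variable {G : Type*} [CommGroup G] [TopologicalSpace G] [IsTopologicalGroup G]

theorem lieMap_exp {ι κ : Type*} (Φ : (ι → G) →ₜ* (κ → G)) (X : ι → LieAlg G) :
    (fun k => (lieMap Φ X k).exp) = Φ (fun i => (X i).exp) := rfl

/-- For each real `r`, lifting `exp (r Y)` through `Φ` and taking a logarithm `X r` gives `r Y - Φ_*
(X r)` in the kernel of the exponential map. That kernel is countable and `ℝ` is not, so two values
of `r` give the same difference; subtracting exhibits a nonzero multiple of `Y` in the image. -/
theorem IsTorusLike.lieMap_surjective (hG : IsTorusLike G) {ι κ : Type*} [Finite κ]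
    {Φ : (ι → G) →ₜ* (κ → G)} (hΦ : Function.Surjective Φ) :
    Function.Surjective (lieMap Φ) := by
  intro Y
  have h1 : ∀ r : ℝ, ∃ X, ∀ k, (r • Y k - lieMap Φ X k).exp = 1 := by
    intro r
    obtain ⟨c, hc⟩ := hΦ (fun k => (r • Y k).exp)
    choose X hX using fun i => hG.exp_surjective (c i)
    refine ⟨X, fun k => ?_⟩
    have h2 : (lieMap Φ X k).exp = Φ c k := by
      rw [← funext hX]
      exact congrFun (lieMap_exp Φ X) k
    rw [hc] at h2
    rw [← mul_left_inj (lieMap Φ X k).exp, ← LieAlg.exp_add, sub_add_cancel, one_mul, h2]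
  choose X hX using h1
  have hcount : (Set.univ.pi fun _ : κ => {Z : LieAlg G | Z.exp = 1}).Countable :=
    Set.countable_univ_pi fun _ => hG.countable_ker
  have : ¬ Set.InjOn (fun r : ℝ => fun k => r • Y k - lieMap Φ (X r) k) Set.univ := by
    intro hinj
    exact Cardinal.not_countable_real
      (Set.MapsTo.countable_of_injOn (t := Set.univ.pi fun _ : κ => {Z : LieAlg G | Z.exp = 1})
        (fun r _ k _ => hX r k) hinj hcount)
  simp only [Set.InjOn, not_forall] at this
  obtain ⟨r, -, s, -, hrs, hne⟩ := this
  refine ⟨(r - s)⁻¹ • (X r - X s), ?_⟩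
  rw [map_smul, map_sub, inv_smul_eq_iff₀ (sub_ne_zero.2 hne)]
  funext k
  have h3 := congrFun hrs k
  simp only [Pi.sub_apply, Pi.smul_apply, sub_smul]
  exact (sub_eq_sub_iff_sub_eq_sub.1 h3).symm

end

section Cochains

variable {N N' : ℕ} {K : PolyhedralComplex N} {K' : PolyhedralComplex N'}
  {G : Type*} [CommGroup G] [TopologicalSpace G] [IsTopologicalGroup G]
  {O : K.CellOrientation} {O' : K'.CellOrientation}

/-- An element of the target is a coboundary `d Y`, so it suffices to lift `Y` through the map in
degree 1. -/
theorem SurjCochainMap.lieP₂_surjective (hG : IsTorusLike G) (f : SurjCochainMap G O O') :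
    Function.Surjective f.lieP₂ := by
  rintro ⟨_, Y, rfl⟩
  obtain ⟨X, rfl⟩ := hG.lieMap_surjective f.surj₁ Y
  refine ⟨⟨_, X, rfl⟩, Subtype.ext ?_⟩
  change lieMap f.P₂ (linCoboundary O.inc₂ (LieAlg G) X) = linCoboundary O'.inc₂ (LieAlg G) _
  ext p
  refine LieAlg.ext fun t => ?_
  have h := congrFun (linCoboundary_flow O'.inc₂ (lieMap f.P₁ X) t) p
  rw [lieMap_flow, linCoboundary_flow, f.comm₁]
  exact h.symm

theorem imExp_add (X Y : LieImD₁ G O) : imExp G O (X + Y) = imExp G O X * imExp G O Y := rfl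

theorem imExp_surjective (hG : IsTorusLike G) : Function.Surjective (imExp G O) := by
  rintro ⟨_, c, rfl⟩
  choose X hX using fun i => hG.exp_surjective (c i)
  refine ⟨⟨_, X, rfl⟩, Subtype.ext ?_⟩
  have := linCoboundary_flow O.inc₂ X 1
  change (fun k => (linCoboundary O.inc₂ (LieAlg G) X k).flow 1) = _
  rw [this]
  change coboundary _ _ (fun i => (X i).exp) = _
  simp [hX]

theorem continuous_exp_sum {m : Type*} [Fintype m] (b : m → LieAlg G) :
    Continuous fun x : m → ℝ => (∑ j, x j • b j).exp := by
  simp only [LieAlg.exp, LieAlg.sum_flow, LieAlg.smul_flow, mul_one]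
  exact continuous_finsetProd _ fun j _ => (b j).continuous_flow.comp (continuous_apply j)

theorem continuous_imExp_sum {m : Type*} [Fintype m] (b : m → LieImD₁ G O) :
    Continuous fun x : m → ℝ => imExp G O (∑ j, x j • b j) := by
  refine Continuous.subtype_mk (continuous_pi fun p => ?_) _
  have := continuous_exp_sum (fun j => (b j).1 p)
  simpa using this

theorem imExp_lieP₂ (f : SurjCochainMap G O O') (X : LieImD₁ G O) :
    (imExp G O' (f.lieP₂ X)).1 = f.P₂ (imExp G O X).1 := rfl

theorem separates_imD₁ (hG : IsTorusLike G) (a : ImD₁ G O)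
    (ha : ∀ χ : ImD₁ G O →ₜ* Circle, χ a = 1) : a = 1 := by
  refine Subtype.ext (funext fun p => hG.separates _ fun χ => ?_)
  exact ha ⟨(χ : G →* Circle).comp ((Pi.evalMonoidHom _ p).comp (d₁ G O).range.subtype),
    (map_continuous χ).comp ((continuous_apply p).comp continuous_subtype_val)⟩

end Cochains

end AbelianGauge

end TorusLike

/-! ### Vanishing first homology and closed cochains. -/

section Homology

/-- As a homomorphism on chains, `c` kills the cycles and so factors through the group of
boundaries. Divisible groups are injective, so the factor extends to all chains one degree lower;
its values on the cells form `c₀`. -/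
theorem exists_coboundary_eq {ι κ : Type*} [Fintype ι] [Fintype κ] {G : Type*} [CommGroup G]
    (hdiv : ∀ n : ℤ, n ≠ 0 → ∀ g : G, ∃ h : G, h ^ n = g) (M : κ → ι → ℤ)
    (c : κ → G) (hc : ∀ z : κ → ℤ, boundary M z = 0 → ∏ k, c k ^ z k = 1) :
    ∃ c₀ : ι → G, coboundary M G c₀ = c := by
  classical
  let φ : (κ → ℤ) →+ Additive G := AddMonoidHom.mk' (fun z => Additive.ofMul (∏ k, c k ^ z k))
    (fun z w => by simp [zpow_add, Finset.prod_mul_distrib, ofMul_mul])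
  choose root hroot using hdiv
  let _ : DivisibleBy (Additive G) ℤ :=
    { div := fun g n => if h : n = 0 then 0 else Additive.ofMul (root n h g.toMul)
      div_zero := fun g => by simp
      div_cancel := fun {n} g h => by
        simp only [h, dite_false]
        exact congrArg Additive.ofMul (hroot n h g.toMul) }
  obtain ⟨h, hh⟩ := (Module.Baer.of_divisible (Additive G)).extension_property_addMonoidHom
    (QuotientAddGroup.kerLift (boundary M)) (QuotientAddGroup.kerLift_injective _)
    (QuotientAddGroup.lift (boundary M).ker φ fun z hz => congrArg Additive.ofMul (hc z hz))
  have hφ : ∀ z, h (boundary M z) = φ z := fun z => DFunLike.congr_fun hh (z : (κ → ℤ) ⧸ _)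
  refine ⟨fun i => (h (Pi.single i 1)).toMul, funext fun k => ?_⟩
  have h1 : boundary M (Pi.single k 1) = ∑ i, M k i • Pi.single i (1 : ℤ) := by
    ext i
    simp [boundary, Pi.single_apply]
  have h2 := hφ (Pi.single k 1)
  rw [h1, map_sum] at h2
  simp only [map_zsmul] at h2
  have h3 : φ (Pi.single k 1) = Additive.ofMul (c k) := by
    refine congrArg Additive.ofMul ?_
    rw [Finset.prod_eq_single k (fun j _ hj => by simp [hj]) (by simp)]
    simp
  rw [h3] at h2
  exact congrArg Additive.toMul h2

/-- A closed cochain is trivial on boundaries, hence on all cycles when the first homology vanishes,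
and is therefore exact. -/
theorem ker_d₁_le_range_d₀ {N : ℕ} {K : PolyhedralComplex N} {G : Type*} [CommGroup G]
    (hdiv : ∀ n : ℤ, n ≠ 0 → ∀ g : G, ∃ h : G, h ^ n = g)
    (O : K.CellOrientation) (hH : Subsingleton O.H₁) : (d₁ G O).ker ≤ (d₀ G O).range := by
  intro c hc
  refine exists_coboundary_eq hdiv O.inc₁ c fun z hz => ?_
  have h1 : z ∈ (boundary O.inc₂).range := by
    have h2 : (QuotientAddGroup.mk 0 : (boundary O.inc₁).ker ⧸
        (boundary O.inc₂).range.addSubgroupOf (boundary O.inc₁).ker) =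
        QuotientAddGroup.mk (⟨z, hz⟩ : (boundary O.inc₁).ker) :=
      @Subsingleton.elim O.H₁ hH _ _
    simpa [AddSubgroup.mem_addSubgroupOf] using QuotientAddGroup.eq.1 h2
  obtain ⟨w, rfl⟩ := h1
  have h3 : ∀ p, ∏ e, c e ^ O.inc₂ p e = 1 := fun p => congrFun hc p
  calc ∏ e, c e ^ boundary O.inc₂ w e = ∏ e, ∏ p, (c e ^ O.inc₂ p e) ^ w p := by
        refine Finset.prod_congr rfl fun e _ => ?_
        simp only [← zpow_mul]
        change c e ^ (∑ p, w p * O.inc₂ p e) = _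
        simp_rw [mul_comm (w _)]
        exact map_sum (zmultiplesHom (Additive G) (Additive.ofMul (c e))) _ _
    _ = ∏ p, (∏ e, c e ^ O.inc₂ p e) ^ w p := by
        rw [Finset.prod_comm]
        simp only [Finset.prod_zpow]
    _ = 1 := by simp [h3]

theorem AbelianGauge.IsTorusLike.exists_zpow_eq {G : Type*} [CommGroup G] [TopologicalSpace G]
    [IsTopologicalGroup G] (hG : IsTorusLike G) (n : ℤ) (hn : n ≠ 0) (g : G) :
    ∃ h : G, h ^ n = g := by
  obtain ⟨X, rfl⟩ := hG.exp_surjective g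
  refine ⟨((n : ℝ)⁻¹ • X).exp, ?_⟩
  rw [LieAlg.exp, ← LieAlg.zsmul_flow, ← Int.cast_smul_eq_zsmul ℝ, smul_smul,
    mul_inv_cancel₀ (by exact_mod_cast hn), one_smul, LieAlg.exp]

end Homology

/-! ### Renormalized inner products and coisometries. -/

section Renormalization

namespace AbelianGauge

variable {V W : Type*} [AddCommGroup V] [Module ℝ V] [AddCommGroup W] [Module ℝ W]

theorem IsInnerProduct.isSymm {B : LinearMap.BilinForm ℝ V} (hB : IsInnerProduct B) :
    B.IsSymm := ⟨hB.symm⟩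

theorem IsInnerProduct.eq_zero {B : LinearMap.BilinForm ℝ V} (hB : IsInnerProduct B) {x : V}
    (hx : B x x = 0) : x = 0 := by
  by_contra h
  exact (hB.pos x h).ne' hx

theorem IsInnerProduct.nonneg {B : LinearMap.BilinForm ℝ V} (hB : IsInnerProduct B) (x : V) :
    0 ≤ B x x := by
  by_cases h : x = 0
  · simp [h]
  · exact (hB.pos x h).le

theorem IsInnerProduct.nondegenerate {B : LinearMap.BilinForm ℝ V} (hB : IsInnerProduct B) :
    B.Nondegenerate :=
  ⟨fun x hx => hB.eq_zero (hx x), fun x hx => hB.eq_zero (hx x)⟩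

theorem IsInnerProduct.exists_orthonormal_basis [Module.Finite ℝ V] {B : LinearMap.BilinForm ℝ V}
    (hB : IsInnerProduct B) : ∃ (m : ℕ) (b : Module.Basis (Fin m) ℝ V),
      ∀ j k, B (b j) (b k) = if j = k then 1 else 0 := by
  obtain ⟨v, hv⟩ := LinearMap.BilinForm.exists_orthogonal_basis
    (⟨hB.symm⟩ : LinearMap.IsSymm B)
  have hpos : ∀ j, 0 < B (v j) (v j) := fun j => hB.pos _ (v.ne_zero j)
  refine ⟨_, v.unitsSMul fun j => Units.mk0 (Real.sqrt (B (v j) (v j)))⁻¹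
    (inv_ne_zero (Real.sqrt_pos.2 (hpos j)).ne'), fun j k => ?_⟩
  simp only [Module.Basis.unitsSMul_apply, Units.smul_mk0, map_smul, LinearMap.smul_apply,
    smul_eq_mul]
  split_ifs with h
  · subst h
    have := Real.mul_self_sqrt (hpos j).le
    have h0 := (Real.sqrt_pos.2 (hpos j)).ne'
    nth_rewrite 3 [← this]
    field_simp
  · rw [hv h]
    simp

theorem IsInnerProduct.exists_adjoint [Module.Finite ℝ V] {B : LinearMap.BilinForm ℝ V}
    (hB : IsInnerProduct B) (C : LinearMap.BilinForm ℝ W) (P : V →ₗ[ℝ] W) (w : W) :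
    ∃ x ∈ adjointRange B C P, ∀ v, B x v = C w (P v) := by
  refine ⟨(B.toDual hB.nondegenerate).symm (C w ∘ₗ P), ⟨w, fun v => ?_⟩, fun v => ?_⟩ <;>
  exact LinearMap.BilinForm.apply_toDual_symm_apply (hB := hB.nondegenerate) _ _

/-- Testing `v` against the adjoint image of `P v` gives `C (P v) (P v) = 0`. -/
theorem IsInnerProduct.orthogonal_adjointRange [Module.Finite ℝ V] {B : LinearMap.BilinForm ℝ V}
    (hB : IsInnerProduct B) {C : LinearMap.BilinForm ℝ W} (hC : IsInnerProduct C)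
    (P : V →ₗ[ℝ] W) : B.orthogonal (adjointRange B C P) = LinearMap.ker P := by
  ext v
  rw [LinearMap.BilinForm.mem_orthogonal_iff, LinearMap.mem_ker]
  constructor
  · intro h
    obtain ⟨x, hx, hxv⟩ := hB.exists_adjoint C P (P v)
    exact hC.eq_zero ((hxv v).symm.trans (h x hx))
  · rintro h x ⟨w, hw⟩
    change B x v = 0
    simp [hw, h]

theorem IsInnerProduct.isCompl_orthogonal [Module.Finite ℝ V] {B : LinearMap.BilinForm ℝ V}
    (hB : IsInnerProduct B) (U : Submodule ℝ V) : IsCompl U (B.orthogonal U) := by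
  refine LinearMap.BilinForm.isCompl_orthogonal_of_restrict_nondegenerate
    hB.isSymm.isRefl ?_
  have : IsInnerProduct (B.restrict U) :=
    ⟨fun x y => hB.symm _ _, fun x hx => hB.pos _ (by simpa using hx)⟩
  exact this.nondegenerate

/-- On finite-dimensional spaces the renormalized form is an inner product, and every vector `w` of
the target is the image of a vector `u` with `⟨u, v⟩ʳ = D w (P v)` for all `v`, provided that `P` is
surjective. -/
theorem renormStep_spec [Module.Finite ℝ V] {B : LinearMap.BilinForm ℝ V}
    (hB : IsInnerProduct B) {C : LinearMap.BilinForm ℝ W} (hC : IsInnerProduct C)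
    (P : V →ₗ[ℝ] W) {D : LinearMap.BilinForm ℝ W} (hD : IsInnerProduct D) :
    IsInnerProduct (renormStep B C P D) ∧ (Function.Surjective P →
      ∀ w, ∃ u, P u = w ∧ ∀ v, renormStep B C P D u v = D w (P v)) := by
  set U := adjointRange B C P with hU
  have h : IsCompl U (B.orthogonal U) := hB.isCompl_orthogonal U
  have hker := hB.orthogonal_adjointRange hC P
  set p := U.projection _ h
  set q := (B.orthogonal U).projection _ h.symm
  have hpq : ∀ v, p v + q v = v := fun v => Submodule.projection_add_projection_eq_self h v
  have hPq : ∀ v, P (q v) = 0 := fun v => by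
    have : q v ∈ B.orthogonal U := Submodule.projection_apply_mem _ v
    rwa [hker] at this
  have hPp : ∀ v, P (p v) = P v := fun v => by
    conv_rhs => rw [← hpq v, map_add, hPq, add_zero]
  -- The second summand is `Ker P`, so the projection `p` may be dropped inside `P`.
  have hval : ∀ x y, renormStep B C P D x y = D (P x) (P y) + B (q x) (q y) := by
    intro x y
    have : renormStep B C P D = D.comp (P ∘ₗ p) (P ∘ₗ p) + B.comp q q := by
      unfold renormStep
      rw [dif_pos h]
    rw [this]
    simp [hPp]
  refine ⟨⟨fun x y => ?_, fun x hx => ?_⟩, fun hP w => ?_⟩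
  · rw [hval, hval, hD.symm, hB.symm]
  · rw [hval]
    by_cases h1 : P x = 0
    · have h2 : q x = x := by
        have : x ∈ B.orthogonal U := by rw [hker]; exact h1
        exact Submodule.projection_apply_of_mem_left _ this
      rw [h1, h2]
      simpa using hB.pos x hx
    · exact add_pos_of_pos_of_nonneg (hD.pos _ h1) (hB.nonneg _)
  · obtain ⟨v, rfl⟩ := hP w
    -- The component of a preimage in `Im P*` is the right lift: it has the same image and no part
    -- in `Ker P`.
    refine ⟨p v, hPp v, fun y => ?_⟩
    have : q (p v) = 0 := by
      exact Submodule.projection_apply_of_mem_right _ (Submodule.projection_apply_mem _ v)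
    rw [hval, hPp, this]
    simp

/-- Both sums are squared dual norms in orthonormal bases. If `w` represents `ξ`, its lift `u`
represents `ξ ∘ P`, and `B u u = D w (P u) = D w w`. -/
theorem sum_sq_eq_of_coisometry {m m' : ℕ} {B : LinearMap.BilinForm ℝ V}
    {D : LinearMap.BilinForm ℝ W}
    {P : V →ₗ[ℝ] W} (hP : ∀ w, ∃ u, P u = w ∧ ∀ v, B u v = D w (P v))
    {b : Module.Basis (Fin m) ℝ V} (hb : ∀ j k, B (b j) (b k) = if j = k then 1 else 0)
    {b' : Module.Basis (Fin m') ℝ W} (hb' : ∀ j k, D (b' j) (b' k) = if j = k then 1 else 0)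
    (ξ : W →ₗ[ℝ] ℝ) : ∑ j, ξ (P (b j)) ^ 2 = ∑ k, ξ (b' k) ^ 2 := by
  set w := ∑ k, ξ (b' k) • b' k with hw
  have hξ : ξ = D w := b'.ext fun k => by
    simp [hw, hb']
  obtain ⟨u, hu, huv⟩ := hP w
  have h1 : ∀ j, ξ (P (b j)) = B u (b j) := fun j => by rw [hξ, huv]
  have hu' : u = ∑ j, B u (b j) • b j := by
    conv_lhs => rw [← b.sum_repr u]
    refine Finset.sum_congr rfl fun j _ => ?_
    congr 1
    conv_rhs => rw [← b.sum_repr u]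
    simp only [map_sum, map_smul, LinearMap.sum_apply, LinearMap.smul_apply, hb, smul_eq_mul]
    simp
  have h2 : ∑ j, ξ (P (b j)) ^ 2 = B u u := by
    conv_rhs => rw [hu']
    simp only [h1, map_sum, map_smul, LinearMap.sum_apply, LinearMap.smul_apply, smul_eq_mul]
    simp [hb, sq]
  have h3 : ∑ k, ξ (b' k) ^ 2 = D w w := by
    conv_rhs => rw [← hξ, hw]
    simp [sq]
  rw [h2, h3, huv, hu]

end AbelianGauge

end Renormalization

/-! ### Fourier coefficients determine measures. -/

section CharacterDensity

namespace AbelianGauge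

variable {A : Type*} [CommGroup A] [TopologicalSpace A] [IsTopologicalGroup A] [CompactSpace A]

/-- A character as a continuous complex-valued function. -/
noncomputable def charMap : (A →ₜ* Circle) →* C(A, ℂ) where
  toFun χ := ⟨fun a => χ a, continuous_subtype_val.comp (map_continuous χ)⟩
  map_one' := rfl
  map_mul' _ _ := rfl

variable (A) in
/-- The star algebra of trigonometric polynomials. -/
noncomputable def trigPolynomials : StarSubalgebra ℂ C(A, ℂ) where
  toSubalgebra := Algebra.adjoin ℂ (MonoidHom.mrange (charMap (A := A)) : Set C(A, ℂ))
  star_mem' := by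
    intro f hf
    induction hf using Algebra.adjoin_induction with
    | mem f hf =>
      obtain ⟨χ, rfl⟩ := hf
      refine Algebra.subset_adjoin ⟨χ⁻¹, ?_⟩
      ext a
      exact Circle.coe_inv_eq_conj _
    | algebraMap r =>
      rw [← algebraMap_star_comm]
      exact Subalgebra.algebraMap_mem _ _
    | add f g _ _ hf hg => rw [star_add]; exact Subalgebra.add_mem _ hf hg
    | mul f g _ _ hf hg => rw [star_mul]; exact Subalgebra.mul_mem _ hg hf

theorem trigPolynomials_toSubmodule : Subalgebra.toSubmodule (trigPolynomials A).toSubalgebra =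
    Submodule.span ℂ (Set.range (charMap (A := A))) := by
  change Subalgebra.toSubmodule (Algebra.adjoin ℂ _) = _
  rw [Algebra.adjoin_eq_span, Submonoid.closure_eq, MonoidHom.coe_mrange]

/-- Stone–Weierstrass: characters are closed under products and conjugation, so their span is a star
algebra, and it separates points. -/
theorem dense_span_charMap (hsep : ∀ a : A, (∀ χ : A →ₜ* Circle, χ a = 1) → a = 1) :
    Dense (Submodule.span ℂ (Set.range (charMap (A := A))) : Set C(A, ℂ)) := by
  have h1 := ContinuousMap.starSubalgebra_topologicalClosure_eq_top_of_separatesPoints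
    (trigPolynomials A) (by
      intro a b hab
      have : ∃ χ : A →ₜ* Circle, χ (a / b) ≠ 1 := by
        by_contra! h
        exact hab (div_eq_one.1 (hsep _ h))
      obtain ⟨χ, hχ⟩ := this
      refine ⟨charMap χ, ⟨charMap χ, Algebra.subset_adjoin ⟨χ, rfl⟩, rfl⟩, fun h => hχ ?_⟩
      rw [map_div, div_eq_one]
      exact Circle.ext h)
  rw [← trigPolynomials_toSubmodule]
  intro f
  have : f ∈ (trigPolynomials A).topologicalClosure := h1 ▸ trivial
  exact this

variable [MeasurableSpace A] [BorelSpace A]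

theorem integral_mul_eq_of_forall_char
    (hsep : ∀ a : A, (∀ χ : A →ₜ* Circle, χ a = 1) → a = 1)
    (μ ν : Measure A) [IsFiniteMeasure μ] [IsFiniteMeasure ν] (h : C(A, ℝ))
    (hchar : ∀ χ : A →ₜ* Circle, ∫ a, (h a : ℂ) * χ a ∂μ = ∫ a, (χ a : ℂ) ∂ν) (f : C(A, ℝ)) :
    ∫ a, h a * f a ∂μ = ∫ a, f a ∂ν := by
  have hint : ∀ (ρ : Measure A) [IsFiniteMeasure ρ] (g : C(A, ℂ)), Integrable g ρ :=
    fun ρ _ g => g.continuous.integrable_of_hasCompactSupport (HasCompactSupport.of_compactSpace _)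
  let hc : C(A, ℂ) := ⟨fun a => (h a : ℂ), by fun_prop⟩
  have hcont : ∀ (ρ : Measure A) [IsFiniteMeasure ρ],
      Continuous fun g : C(A, ℂ) => ∫ a, g a ∂ρ := by
    intro ρ _
    have := (ContinuousMap.toLp (E := ℂ) 1 ρ ℂ).continuous
    have h2 := (continuous_integral (μ := ρ) (G := ℂ)).comp this
    refine h2.congr fun g => ?_
    exact integral_congr_ae (ContinuousMap.coeFn_toLp ρ g)
  have key : ∀ g : C(A, ℂ), ∫ a, (h a : ℂ) * g a ∂μ = ∫ a, g a ∂ν := by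
    have h1 : IsClosed {g : C(A, ℂ) | ∫ a, (hc * g) a ∂μ = ∫ a, g a ∂ν} :=
      isClosed_eq ((hcont μ).comp (continuous_const_mul hc)) (hcont ν)
    have h2 : (Submodule.span ℂ (Set.range (charMap (A := A))) : Set C(A, ℂ)) ⊆
        {g : C(A, ℂ) | ∫ a, (hc * g) a ∂μ = ∫ a, g a ∂ν} := by
      intro g hg
      induction hg using Submodule.span_induction with
      | mem g hg =>
        obtain ⟨χ, rfl⟩ := hg
        exact hchar χ
      | zero => simp
      | add f g _ _ hf hg =>
        simp only [Set.mem_ofPred_eq, mul_add, ContinuousMap.add_apply] at hf hg ⊢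
        rw [integral_add (hint _ _) (hint _ _), integral_add (hint _ _) (hint _ _), hf, hg]
      | smul c g _ hg =>
        simp only [Set.mem_ofPred_eq, mul_smul_comm, ContinuousMap.smul_apply] at hg ⊢
        rw [integral_smul, integral_smul, hg]
    intro g
    exact (h1.closure_subset_iff.2 h2) (dense_span_charMap hsep g)
  have h3 := key ⟨fun a => (f a : ℂ), by fun_prop⟩
  simp only [ContinuousMap.coe_mk, ← Complex.ofReal_mul] at h3
  rw [integral_complex_ofReal, integral_complex_ofReal] at h3
  exact_mod_cast h3

/-- Testing with the negative part `f` of `h` gives `-∫ f² dμ = ∫ f dν ≥ 0`, so the continuous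
function `f` vanishes. -/
theorem nonneg_of_forall_integral_eq {μ ν : Measure A} [IsFiniteMeasure μ] [μ.IsOpenPosMeasure]
    {h : C(A, ℝ)} (heq : ∀ f : C(A, ℝ), ∫ a, h a * f a ∂μ = ∫ a, f a ∂ν) (a : A) : 0 ≤ h a := by
  let f : C(A, ℝ) := ⟨fun a => max (-h a) 0, by fun_prop⟩
  have hf : ∀ a, f a = max (-h a) 0 := fun _ => rfl
  have h1 : ∀ a, h a * f a = -(f a * f a) := fun a => by
    rw [hf]
    rcases le_total (-h a) 0 with h' | h'
    · simp [max_eq_right h']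
    · rw [max_eq_left h']; ring
  have h2 := heq f
  simp only [h1, integral_neg] at h2
  have h3 : 0 ≤ ∫ a, f a ∂ν := integral_nonneg fun a => le_max_right _ _
  have h4 : 0 ≤ ∫ a, f a * f a ∂μ := integral_nonneg fun a => mul_self_nonneg _
  have h5 : ∫ a, f a * f a ∂μ = 0 := by linarith
  have hc : Continuous fun a => f a * f a := by fun_prop
  have h6 := (integral_eq_zero_iff_of_nonneg (fun a => mul_self_nonneg (f a))
    (hc.integrable_of_hasCompactSupport (HasCompactSupport.of_compactSpace _))).1 h5
  have h7 := (Continuous.ae_eq_iff_eq μ hc continuous_const).1 h6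
  have h8 : f a * f a = 0 := congrFun h7 a
  rw [mul_self_eq_zero, hf] at h8
  have := le_max_left (-h a) 0
  linarith

/-- Positivity of `h` is a consequence of the coefficients. This matters because the definition of a
heat kernel does not include positivity. -/
theorem withDensity_eq_of_forall_char [T2Space A] [SecondCountableTopology A]
    (hsep : ∀ a : A, (∀ χ : A →ₜ* Circle, χ a = 1) → a = 1)
    (μ ν : Measure A) [IsFiniteMeasure μ] [μ.IsOpenPosMeasure] [IsFiniteMeasure ν] (h : C(A, ℝ))
    (hchar : ∀ χ : A →ₜ* Circle, ∫ a, (h a : ℂ) * χ a ∂μ = ∫ a, (χ a : ℂ) ∂ν) :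
    μ.withDensity (fun a => ENNReal.ofReal (h a)) = ν := by
  have heq := integral_mul_eq_of_forall_char hsep μ ν h hchar
  have hpos := nonneg_of_forall_integral_eq heq
  have hint : Integrable h μ :=
    h.continuous.integrable_of_hasCompactSupport (HasCompactSupport.of_compactSpace _)
  have : IsFiniteMeasure (μ.withDensity (fun a => ENNReal.ofReal (h a))) :=
    isFiniteMeasure_withDensity_ofReal hint.2
  let _ := TopologicalSpace.metrizableSpaceMetric A
  refine ext_of_forall_integral_eq_of_IsFiniteMeasure fun f => ?_
  rw [integral_withDensity_eq_integral_toReal_smul (by fun_prop)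
    (ae_of_all _ fun _ => ENNReal.ofReal_lt_top)]
  simp only [ENNReal.toReal_ofReal (hpos _), smul_eq_mul]
  exact heq f.toContinuousMap

/-- Finite measures on a compact Abelian group are determined by their Fourier coefficients. -/
theorem measure_eq_of_forall_char [T2Space A] [SecondCountableTopology A]
    (hsep : ∀ a : A, (∀ χ : A →ₜ* Circle, χ a = 1) → a = 1)
    (μ ν : Measure A) [IsFiniteMeasure μ] [IsFiniteMeasure ν]
    (hchar : ∀ χ : A →ₜ* Circle, ∫ a, (χ a : ℂ) ∂μ = ∫ a, (χ a : ℂ) ∂ν) : μ = ν := by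
  let _ := TopologicalSpace.metrizableSpaceMetric A
  refine ext_of_forall_integral_eq_of_IsFiniteMeasure fun f => ?_
  simpa using integral_mul_eq_of_forall_char hsep μ ν 1 (by simpa using hchar) f.toContinuousMap

instance isProbabilityMeasure_haarProb : IsProbabilityMeasure (haarProb A) :=
  ⟨Measure.haarMeasure_self⟩

end AbelianGauge

end CharacterDensity

/-! ### The Gaussian characteristic function. -/

section Gaussian

namespace AbelianGauge

/-- The standard Gaussian measure on `ℝ^m`. -/
noncomputable def stdGauss (m : ℕ) : Measure (Fin m → ℝ) :=
  Measure.pi fun _ => ProbabilityTheory.gaussianReal 0 1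

instance (m : ℕ) : IsProbabilityMeasure (stdGauss m) := by
  unfold stdGauss; infer_instance

theorem integral_exp_stdGauss {m : ℕ} (a : Fin m → ℝ) :
    ∫ x, (Circle.exp (∑ j, x j * a j) : ℂ) ∂stdGauss m = Real.exp (-(∑ j, a j ^ 2) / 2) := by
  have h1 : ∀ x : Fin m → ℝ, (Circle.exp (∑ j, x j * a j) : ℂ) =
      ∏ j, Complex.exp (a j * x j * Complex.I) := fun x => by
    rw [Circle.coe_exp, ← Complex.exp_sum]
    congr 1
    push_cast
    rw [Finset.sum_mul]
    exact Finset.sum_congr rfl fun j _ => by ring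
  simp only [h1]
  unfold stdGauss
  rw [integral_fintype_prod_eq_prod (𝕜 := ℂ) (f := fun j (x : ℝ) =>
    Complex.exp (a j * x * Complex.I))]
  simp_rw [← charFun_apply_real, ProbabilityTheory.charFun_gaussianReal]
  rw [← Complex.exp_sum, Complex.ofReal_exp]
  congr 1
  push_cast
  rw [neg_div, Finset.sum_div, ← Finset.sum_neg_distrib]
  exact Finset.sum_congr rfl fun j _ => by simp

end AbelianGauge

end Gaussian

/-! ### Exponential coordinates and integration by parts. -/

section HeatKernelFourier

namespace AbelianGauge

variable {V A : Type*} [AddCommGroup V] [Module ℝ V] [CommGroup A] [TopologicalSpace A]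

/-- The properties of the exponential map of a compact connected Abelian Lie group that are used in
the study of its heat kernel. -/
structure IsTorusExp (e : V → A) : Prop where
  map_add : ∀ X Y, e (X + Y) = e X * e Y
  surjective : Function.Surjective e
  continuous : ∀ {m : ℕ} (b : Fin m → V), Continuous fun x : Fin m → ℝ => e (∑ j, x j • b j)
  separates : ∀ a : A, (∀ χ : A →ₜ* Circle, χ a = 1) → a = 1

/-- The linear functional `ξ` is the differential of the character `χ`. -/
def IsDifferential (e : V → A) (χ : A →ₜ* Circle) (ξ : V →ₗ[ℝ] ℝ) : Prop :=
  ∀ X, χ (e X) = Circle.exp (ξ X)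

/-- The exponential map in linear coordinates. -/
def expCoord (e : V → A) {m : ℕ} (b : Fin m → V) (x : Fin m → ℝ) : A := e (∑ j, x j • b j)

theorem integrable_of_continuous [IsTopologicalGroup A] [CompactSpace A] [MeasurableSpace A]
    [BorelSpace A] {f : A → ℂ} (hf : Continuous f) : Integrable f (haarProb A) :=
  hf.integrable_of_hasCompactSupport (HasCompactSupport.of_compactSpace _)

namespace IsTorusExp

variable {e : V → A} (he : IsTorusExp e) {m : ℕ} (b : Module.Basis (Fin m) ℝ V)
include he

theorem map_zero : e 0 = 1 := by simpa using he.map_add 0 0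

theorem expCoord_add (b : Fin m → V) (x y : Fin m → ℝ) :
    expCoord e b (x + y) = expCoord e b x * expCoord e b y := by
  simp [expCoord, add_smul, Finset.sum_add_distrib, he.map_add]

theorem expCoord_zero (b : Fin m → V) : expCoord e b 0 = 1 := by
  simp [expCoord, he.map_zero]

theorem expCoord_single (b : Fin m → V) (j : Fin m) (s : ℝ) :
    expCoord e b (Pi.single j s) = e (s • b j) := by
  classical
  simp [expCoord, Pi.single_apply]

theorem continuous_expCoord (b : Fin m → V) : Continuous (expCoord e b) := he.continuous b

theorem surjective_expCoord : Function.Surjective (expCoord e b) := by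
  intro a
  obtain ⟨X, rfl⟩ := he.surjective a
  exact ⟨b.repr X, congrArg e (b.sum_repr X)⟩

theorem exists_differential [Module.Finite ℝ V] (χ : A →ₜ* Circle) :
    ∃ ξ, IsDifferential e χ ξ := by
  let b := Module.finBasis ℝ V
  obtain ⟨a, ha⟩ := exists_eq_exp_dot_of_continuous_character (f := fun x => χ (expCoord e b x))
    ((map_continuous χ).comp (he.continuous_expCoord b))
    (fun x y => by rw [he.expCoord_add, map_mul])
  refine ⟨b.constr ℝ a, fun X => ?_⟩
  have := ha (b.repr X)
  rw [expCoord, b.sum_repr] at this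
  rw [this, Module.Basis.constr_apply_fintype]
  rfl

variable [IsTopologicalGroup A] [CompactSpace A] [T2Space A]

theorem isQuotientMap_expCoord : IsQuotientMap (expCoord e b) :=
  (isOpenMap_of_surjective_of_add (he.continuous_expCoord b) (he.expCoord_add b)
    (he.surjective_expCoord b)).isQuotientMap (he.continuous_expCoord b) (he.surjective_expCoord b)

/-- Exponential coordinates form a quotient map, so continuity descends from the coordinate space.
-/
theorem continuous_of_contDiff {F : A → ℝ} (hF : ContDiff ℝ ∞ (F ∘ expCoord e b)) :
    Continuous F :=
  (he.isQuotientMap_expCoord b).continuous_iff.2 hF.continuous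

theorem hasDerivAt_expCoord {F : A → ℝ} (hF : ContDiff ℝ ∞ (F ∘ expCoord e b)) (j : Fin m)
    (x : Fin m → ℝ) (s : ℝ) : HasDerivAt (fun s : ℝ => F (expCoord e b x * e (s • b j)))
      (fderiv ℝ (F ∘ expCoord e b) (x + Pi.single j s) (Pi.single j 1)) s := by
  have h1 : (fun s : ℝ => F (expCoord e b x * e (s • b j))) =
      (F ∘ expCoord e b) ∘ fun s => x + Pi.single j s := by
    funext s
    simp only [Function.comp_apply]
    rw [he.expCoord_add, he.expCoord_single]
  rw [h1]
  have h2 : HasDerivAt (fun s : ℝ => x + Pi.single j s) (Pi.single j (1 : ℝ)) s :=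
    (hasDerivAt_single j s).const_add x
  exact (hF.differentiable (by simp) _).hasFDerivAt.comp_hasDerivAt s h2

theorem invDeriv_comp_expCoord {F : A → ℝ} (hF : ContDiff ℝ ∞ (F ∘ expCoord e b)) (j : Fin m) :
    invDeriv e (b j) F ∘ expCoord e b =
      fun x => fderiv ℝ (F ∘ expCoord e b) x (Pi.single j 1) := by
  funext x
  simpa [invDeriv] using (he.hasDerivAt_expCoord b hF j x 0).deriv

theorem contDiff_invDeriv {F : A → ℝ} (hF : ContDiff ℝ ∞ (F ∘ expCoord e b)) (j : Fin m) :
    ContDiff ℝ ∞ (invDeriv e (b j) F ∘ expCoord e b) := by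
  rw [he.invDeriv_comp_expCoord b hF]
  exact (hF.fderiv_right (m := ∞) (by simp)).clm_apply contDiff_const

theorem hasDerivAt_mul_exp {F : A → ℝ} (hF : ContDiff ℝ ∞ (F ∘ expCoord e b)) (j : Fin m)
    (a : A) (s : ℝ) : HasDerivAt (fun s : ℝ => F (a * e (s • b j)))
      (invDeriv e (b j) F (a * e (s • b j))) s := by
  obtain ⟨x, rfl⟩ := he.surjective_expCoord b a
  have h1 := he.hasDerivAt_expCoord b hF j x s
  have h2 := congrFun (he.invDeriv_comp_expCoord b hF j) (x + Pi.single j s)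
  simp only [Function.comp_apply] at h2
  rw [he.expCoord_add, he.expCoord_single] at h2
  rw [h2]
  exact h1

variable [MeasurableSpace A] [BorelSpace A]

/-- Translating `F` by `e (s b_j)` multiplies its integral against `χ` by `exp (-i s ξ(b_j))`, by
invariance of Haar measure; the formula is the derivative at `s = 0`. -/
theorem integral_invDeriv_mul_char {F : A → ℝ} (hF : ContDiff ℝ ∞ (F ∘ expCoord e b)) (j : Fin m)
    {χ : A →ₜ* Circle} {ξ : V →ₗ[ℝ] ℝ} (hξ : IsDifferential e χ ξ) :
    ∫ a, (invDeriv e (b j) F a : ℂ) * χ a ∂haarProb A =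
      -(ξ (b j) * Complex.I) * ∫ a, (F a : ℂ) * χ a ∂haarProb A := by
  have hFc := he.continuous_of_contDiff b hF
  have hDc := he.continuous_of_contDiff b (he.contDiff_invDeriv b hF j)
  have hχ : Continuous fun a => (χ a : ℂ) := continuous_subtype_val.comp (map_continuous χ)
  obtain ⟨C, hC⟩ := isCompact_univ.exists_bound_of_continuousOn hDc.continuousOn
  have h1 := hasDerivAt_integral_of_dominated_loc_of_deriv_le (μ := haarProb A) (𝕜 := ℝ)
    (F := fun (s : ℝ) a => (F (a * e (s • b j)) : ℂ) * χ a)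
    (F' := fun (s : ℝ) a => (invDeriv e (b j) F (a * e (s • b j)) : ℂ) * χ a)
    (x₀ := 0) (s := Set.univ) (bound := fun _ => C) univ_mem
    (Eventually.of_forall fun s => (integrable_of_continuous
      (by fun_prop)).aestronglyMeasurable)
    (integrable_of_continuous (by fun_prop))
    (integrable_of_continuous (by fun_prop)).aestronglyMeasurable
    (ae_of_all _ fun a s _ => by
      rw [norm_mul, Circle.norm_coe, mul_one, Complex.norm_real]
      exact hC _ (Set.mem_univ _))
    (integrable_const _)
    (ae_of_all _ fun a s _ => ((he.hasDerivAt_mul_exp b hF j a s).ofReal_comp).mul_const _)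
  have h2 : ∀ s : ℝ, ∫ a, (F (a * e (s • b j)) : ℂ) * χ a ∂haarProb A =
      Complex.exp (s * -(ξ (b j) * Complex.I)) * ∫ a, (F a : ℂ) * χ a ∂haarProb A := by
    intro s
    rw [← integral_mul_right_eq_self (fun a => (F a : ℂ) * χ a) (e (s • b j)),
      ← integral_const_mul]
    refine integral_congr_ae (ae_of_all _ fun a => ?_)
    simp only
    rw [map_mul, hξ, Circle.coe_mul, Circle.coe_exp, map_smul, smul_eq_mul]
    have : Complex.exp (s * -(ξ (b j) * Complex.I)) *
      Complex.exp (((s * ξ (b j) : ℝ) : ℂ) * Complex.I) = 1 := by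
      rw [← Complex.exp_add, Complex.exp_eq_one_iff]
      exact ⟨0, by push_cast; ring⟩
    linear_combination -(F (a * e (s • b j)) : ℂ) * χ a * this
  have h3 : HasDerivAt (fun s : ℝ => Complex.exp (s * -(ξ (b j) * Complex.I)) *
      ∫ a, (F a : ℂ) * χ a ∂haarProb A) (-(ξ (b j) * Complex.I) *
        ∫ a, (F a : ℂ) * χ a ∂haarProb A) 0 := by
    have h4 : HasDerivAt (fun s : ℝ => Complex.exp (s * -(ξ (b j) * Complex.I)))
        (Complex.exp ((0 : ℝ) * -(ξ (b j) * Complex.I)) * (1 * -(ξ (b j) * Complex.I))) 0 :=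
      (Complex.ofRealCLM.hasDerivAt.mul_const _).cexp
    refine (h4.mul_const _).congr_deriv ?_
    simp
  have h5 := h1.2
  simp only [h2] at h5
  have h6 := h5.unique h3
  simpa [he.map_zero] using h6

end IsTorusExp

end AbelianGauge
end HeatKernelFourier

/-! ### Fourier coefficients of an arbitrary heat kernel. -/

section HeatKernelUniqueness

namespace AbelianGauge

namespace IsTorusExp

variable {V A : Type*} [AddCommGroup V] [Module ℝ V] [CommGroup A] [TopologicalSpace A]
  [IsTopologicalGroup A] [CompactSpace A] [T2Space A] [MeasurableSpace A] [BorelSpace A]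
  {e : V → A} (he : IsTorusExp e) {m : ℕ} (b : Module.Basis (Fin m) ℝ V)
include he

theorem contDiff_heat_slice {H : ℝ → A → ℝ}
    (hs : ContDiffOn ℝ ∞ (fun q : ℝ × (Fin m → ℝ) => H q.1 (expCoord e b q.2))
      (Set.Ioi 0 ×ˢ Set.univ)) {t : ℝ} (ht : 0 < t) : ContDiff ℝ ∞ (H t ∘ expCoord e b) := by
  rw [← contDiffOn_univ]
  exact hs.comp (f := fun x : Fin m → ℝ => (t, x)) (by fun_prop) fun x _ => ⟨ht, trivial⟩

/-- Differentiating under the integral turns the time derivative into second invariant derivatives,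
and two integrations by parts turn each of these into the factor `-ξ(b_j)²`. -/
theorem hasDerivAt_integral_heat {H : ℝ → A → ℝ}
    (hs : ContDiffOn ℝ ∞ (fun q : ℝ × (Fin m → ℝ) => H q.1 (expCoord e b q.2))
      (Set.Ioi 0 ×ˢ Set.univ))
    (hheat : ∀ t, 0 < t → ∀ a : A,
      deriv (fun s => H s a) t = ∑ j, invDeriv e (b j) (invDeriv e (b j) (H t)) a)
    {χ : A →ₜ* Circle} {ξ : V →ₗ[ℝ] ℝ} (hξ : IsDifferential e χ ξ) {t : ℝ} (ht : 0 < t) :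
    HasDerivAt (fun t => ∫ a, (H t a : ℂ) * χ a ∂haarProb A)
      (-(∑ j, ξ (b j) ^ 2 : ℝ) * ∫ a, (H t a : ℂ) * χ a ∂haarProb A) t := by
  have hχ : Continuous fun a => (χ a : ℂ) := continuous_subtype_val.comp (map_continuous χ)
  obtain ⟨R, -, hR⟩ := exists_closedBall_surjective_of_add (he.continuous_expCoord b)
    (he.expCoord_add b) (he.surjective_expCoord b)
  set Φ := fun q : ℝ × (Fin m → ℝ) => H q.1 (expCoord e b q.2)
  have hUo : IsOpen (Set.Ioi (0 : ℝ) ×ˢ (Set.univ : Set (Fin m → ℝ))) := isOpen_Ioi.prod isOpen_univ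
  have hslice := fun {t : ℝ} (ht : 0 < t) => he.contDiff_heat_slice b hs ht
  have htime : ∀ s, 0 < s → ∀ x, HasDerivAt (fun s => H s (expCoord e b x))
      (fderiv ℝ Φ (s, x) (1, 0)) s := by
    intro s hs0 x
    have h1 : DifferentiableAt ℝ Φ (s, x) :=
      (hs.differentiableOn (by simp)).differentiableAt (hUo.mem_nhds ⟨hs0, trivial⟩)
    exact h1.hasFDerivAt.comp_hasDerivAt s ((hasDerivAt_id s).prodMk (hasDerivAt_const s x))
  -- A coordinate ball of radius `R` already covers `A`, so a bound on this compact set dominates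
  -- the time derivative on the whole group.
  have hcont : ContinuousOn (fun q => fderiv ℝ Φ q (1, 0))
      (Set.Icc (t / 2) (2 * t) ×ˢ Metric.closedBall 0 R) :=
    ((hs.continuousOn_fderiv_of_isOpen hUo (by simp)).clm_apply continuousOn_const).mono
      (Set.prod_mono (fun s hs => lt_of_lt_of_le (by positivity) hs.1) (Set.subset_univ _))
  obtain ⟨C, hC⟩ := (isCompact_Icc.prod (isCompact_closedBall _ _)).exists_bound_of_continuousOn
    hcont
  have hderiv_cont : Continuous fun a => deriv (fun s => H s a) t := by
    simp only [hheat t ht]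
    exact continuous_finsetSum _ fun j _ => he.continuous_of_contDiff b
      (he.contDiff_invDeriv b (he.contDiff_invDeriv b (hslice ht) j) j)
  have hHc : ∀ s, 0 < s → Continuous fun a => (H s a : ℂ) * χ a := fun s hs0 =>
    (Complex.continuous_ofReal.comp (he.continuous_of_contDiff b (hslice hs0))).mul hχ
  have h1 := hasDerivAt_integral_of_dominated_loc_of_deriv_le (μ := haarProb A) (𝕜 := ℝ)
    (F := fun (s : ℝ) a => (H s a : ℂ) * χ a)
    (F' := fun (s : ℝ) a => ((deriv (fun s => H s a) s : ℝ) : ℂ) * χ a)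
    (x₀ := t) (s := Set.Icc (t / 2) (2 * t)) (bound := fun _ => C)
    (Icc_mem_nhds (by linarith) (by linarith))
    (by
      filter_upwards [lt_mem_nhds ht] with s hs0
      exact (integrable_of_continuous (hHc s hs0)).aestronglyMeasurable)
    (integrable_of_continuous (hHc t ht))
    (integrable_of_continuous (by fun_prop)).aestronglyMeasurable
    (ae_of_all _ fun a s hsI => by
      rw [norm_mul, Circle.norm_coe, mul_one, Complex.norm_real]
      obtain ⟨x, hx, rfl⟩ := hR a
      rw [(htime s (lt_of_lt_of_le (by positivity) hsI.1) x).deriv]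
      exact hC (s, x) ⟨hsI, by simpa using hx⟩)
    (integrable_const _)
    (ae_of_all _ fun a s hsI => by
      obtain ⟨x, rfl⟩ := he.surjective_expCoord b a
      have h2 := htime s (lt_of_lt_of_le (by positivity) hsI.1) x
      have h3 := h2.deriv
      exact ((h3 ▸ h2).ofReal_comp).mul_const _)
  refine h1.2.congr_deriv ?_
  simp only [hheat t ht]
  push_cast
  simp only [Finset.sum_mul]
  rw [integral_finsetSum (f := fun j a =>
    (invDeriv e (b j) (invDeriv e (b j) (H t)) a : ℂ) * χ a) _ fun j _ => integrable_of_continuous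
    ((Complex.continuous_ofReal.comp (he.continuous_of_contDiff b
      (he.contDiff_invDeriv b (he.contDiff_invDeriv b (hslice ht) j) j))).mul hχ)]
  rw [neg_mul, Finset.sum_mul, ← Finset.sum_neg_distrib]
  refine Finset.sum_congr rfl fun j _ => ?_
  rw [he.integral_invDeriv_mul_char b (he.contDiff_invDeriv b (hslice ht) j) j hξ,
    he.integral_invDeriv_mul_char b (hslice ht) j hξ]
  linear_combination ((ξ (b j) : ℂ) ^ 2 * ∫ a, (H t a : ℂ) * χ a ∂haarProb A) * Complex.I_sq

/-- The Fourier coefficients of a heat kernel. -/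
theorem integral_heat_mul_char {H : ℝ → A → ℝ}
    (hs : ContDiffOn ℝ ∞ (fun q : ℝ × (Fin m → ℝ) => H q.1 (expCoord e b q.2))
      (Set.Ioi 0 ×ˢ Set.univ))
    (hheat : ∀ t, 0 < t → ∀ a : A,
      deriv (fun s => H s a) t = ∑ j, invDeriv e (b j) (invDeriv e (b j) (H t)) a)
    (hinit : ∀ f : C(A, ℝ), Tendsto (fun t => ∫ a, H t a * f a ∂(haarProb A)) (𝓝[>] 0) (𝓝 (f 1)))
    {χ : A →ₜ* Circle} {ξ : V →ₗ[ℝ] ℝ} (hξ : IsDifferential e χ ξ) {t : ℝ} (ht : 0 < t) :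
    ∫ a, (H t a : ℂ) * χ a ∂haarProb A = Real.exp (-(t * ∑ j, ξ (b j) ^ 2)) := by
  set q : ℝ := ∑ j, ξ (b j) ^ 2
  set c : ℝ → ℂ := fun t => ∫ a, (H t a : ℂ) * χ a ∂haarProb A with hc
  have hχ : Continuous fun a => (χ a : ℂ) := continuous_subtype_val.comp (map_continuous χ)
  -- The coefficient times the integrating factor is constant on `(0, ∞)`; its value is read off
  -- from the limit at `0`, where the coefficient tends to `χ 1 = 1`.
  have h1 : ∀ s : ℝ, 0 < s → HasDerivAt (fun s : ℝ => c s * Complex.exp (s * q)) 0 s := by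
    intro s hs0
    have h2 := he.hasDerivAt_integral_heat b hs hheat hξ hs0
    have h3 : HasDerivAt (fun s : ℝ => Complex.exp (s * q)) (Complex.exp (s * q) * (1 * q)) s :=
      (Complex.ofRealCLM.hasDerivAt.mul_const _).cexp
    exact (h2.mul h3).congr_deriv (by ring)
  obtain ⟨k, hk⟩ := isOpen_Ioi.exists_is_const_of_deriv_eq_zero isPreconnected_Ioi
    (fun s hs0 => (h1 s hs0).differentiableAt.differentiableWithinAt)
    (fun s hs0 => (h1 s hs0).deriv)
  have hclim : Tendsto c (𝓝[>] 0) (𝓝 1) := by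
    have hre := hinit ⟨fun a => (χ a : ℂ).re, by fun_prop⟩
    have him := hinit ⟨fun a => (χ a : ℂ).im, by fun_prop⟩
    simp only [ContinuousMap.coe_mk, map_one, Circle.coe_one, Complex.one_re,
      Complex.one_im] at hre him
    have h2 := (Complex.continuous_ofReal.tendsto _).comp hre
    have h3 := ((Complex.continuous_ofReal.tendsto _).comp him).mul_const Complex.I
    have h4 := h2.add h3
    simp only [Complex.ofReal_one, Complex.ofReal_zero, zero_mul, add_zero] at h4
    refine h4.congr' ?_
    filter_upwards [self_mem_nhdsWithin] with s hs0
    have hHc : Continuous (H s) := he.continuous_of_contDiff b (he.contDiff_heat_slice b hs hs0)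
    have h5 := integral_re_add_im (𝕜 := ℂ) (integrable_of_continuous (A := A)
      (f := fun a => (H s a : ℂ) * χ a) (by fun_prop))
    simp only [RCLike.re_to_complex, RCLike.im_to_complex, Complex.re_ofReal_mul,
      Complex.im_ofReal_mul] at h5
    exact h5
  have hlim : Tendsto (fun s : ℝ => c s * Complex.exp (s * q)) (𝓝[>] 0) (𝓝 1) := by
    have h2 : Tendsto (fun s : ℝ => Complex.exp (s * q)) (𝓝[>] 0) (𝓝 1) := by
      have : Continuous fun s : ℝ => Complex.exp (s * q) := by fun_prop
      exact (this.tendsto' 0 1 (by simp)).mono_left nhdsWithin_le_nhds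
    simpa using hclim.mul h2
  have hk1 : k = 1 := by
    refine tendsto_nhds_unique (tendsto_const_nhds.congr' ?_) hlim
    filter_upwards [self_mem_nhdsWithin] with s hs0
    exact (hk s hs0).symm
  have h2 := hk t ht
  rw [hk1] at h2
  rw [Complex.ofReal_exp]
  push_cast
  rw [Complex.exp_neg]
  exact eq_inv_of_mul_eq_one_left h2

/-- Scaling by `√(2t)` gives variance `2t`, which cancels the `1/2` in the Gaussian characteristic
function. The wrapped Gaussian is thus an honest probability measure with the coefficients of the
heat kernel. -/
theorem integral_char_map_gauss {χ : A →ₜ* Circle} {ξ : V →ₗ[ℝ] ℝ} (hξ : IsDifferential e χ ξ)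
    {t : ℝ} (ht : 0 < t) :
    ∫ a, (χ a : ℂ) ∂(stdGauss m).map (fun x => expCoord e b (Real.sqrt (2 * t) • x)) =
      Real.exp (-(t * ∑ j, ξ (b j) ^ 2)) := by
  have hm : Continuous fun x => expCoord e b (Real.sqrt (2 * t) • x) :=
    (he.continuous_expCoord b).comp (by fun_prop)
  have hχ : Continuous fun a => (χ a : ℂ) := continuous_subtype_val.comp (map_continuous χ)
  rw [integral_map hm.measurable.aemeasurable hχ.aestronglyMeasurable]
  have h1 : ∀ x : Fin m → ℝ, (χ (expCoord e b (Real.sqrt (2 * t) • x)) : ℂ) =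
      Circle.exp (∑ j, x j * (Real.sqrt (2 * t) * ξ (b j))) := by
    intro x
    rw [expCoord, hξ, map_sum]
    congr 2
    refine Finset.sum_congr rfl fun j _ => ?_
    simp only [Pi.smul_apply, map_smul, smul_eq_mul]
    ring
  simp only [h1]
  rw [integral_exp_stdGauss]
  congr 2
  simp only [mul_pow, Real.sq_sqrt (by positivity : 0 ≤ 2 * t), ← Finset.mul_sum]
  ring

end IsTorusExp

end AbelianGauge

end HeatKernelUniqueness

/-! ### Smoothness of exponential series. -/

section SmoothSeries

/-- The termwise derivative is a series of the same shape with coefficients `L i ⊗ w i`. Hence the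
coefficients live in an arbitrary space `F` and are summable against every power of `‖L i‖`: this
makes the induction on the order close. -/
theorem contDiffOn_tsum_cexp_smul {ι : Type*} {E₀ : Type} [NormedAddCommGroup E₀]
    [NormedSpace ℝ E₀] {U : Set E₀} (hU : IsOpen U) (hU' : IsPreconnected U)
    (L : ι → E₀ →L[ℝ] ℂ) (r : ι → ℝ) (hr0 : ∀ i, 0 ≤ r i)
    (hr : ∀ i, ∀ y ∈ U, ‖Complex.exp (L i y)‖ ≤ r i)
    (n : ℕ) : ∀ {F : Type} [NormedAddCommGroup F] [NormedSpace ℝ F] [NormedSpace ℂ F]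
      [IsScalarTower ℝ ℂ F] [CompleteSpace F] (w : ι → F)
      (_ : ∀ k : ℕ, Summable fun i => r i * ‖L i‖ ^ k * ‖w i‖),
      ContDiffOn ℝ n (fun y => ∑' i, Complex.exp (L i y) • w i) U := by
  have hsmul : ∀ {F : Type} [NormedAddCommGroup F] [NormedSpace ℝ F] [NormedSpace ℂ F]
      [IsScalarTower ℝ ℂ F] (c : E₀ →L[ℝ] ℂ) (f : F), ‖c.smulRight f‖ ≤ ‖c‖ * ‖f‖ := by
    intro F _ _ _ _ c f
    refine ContinuousLinearMap.opNorm_le_bound _ (by positivity) fun x => ?_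
    rw [ContinuousLinearMap.smulRight_apply, norm_smul]
    calc ‖c x‖ * ‖f‖ ≤ (‖c‖ * ‖x‖) * ‖f‖ := by gcongr; exact c.le_opNorm x
      _ = _ := by ring
  have hderiv : ∀ {F : Type} [NormedAddCommGroup F] [NormedSpace ℝ F] [NormedSpace ℂ F]
      [IsScalarTower ℝ ℂ F] [CompleteSpace F] (w : ι → F)
      (_ : ∀ k : ℕ, Summable fun i => r i * ‖L i‖ ^ k * ‖w i‖), ∀ y ∈ U,
      HasFDerivAt (fun y => ∑' i, Complex.exp (L i y) • w i)
        (∑' i, Complex.exp (L i y) • (L i).smulRight (w i)) y := by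
    intro F _ _ _ _ _ w hw y hy
    refine hasFDerivAt_tsum_of_isPreconnected (𝕜 := ℝ)
      (f := fun i y => Complex.exp (L i y) • w i)
      (f' := fun i y => Complex.exp (L i y) • (L i).smulRight (w i))
      (u := fun i => r i * ‖L i‖ ^ 1 * ‖w i‖) (hw 1) hU hU'
      (fun i x hx => ?_) (fun i x hx => ?_) hy ?_ hy
    · have h1 := ((L i).hasFDerivAt (x := x)).cexp.smul_const (w i)
      refine h1.congr_fderiv ?_
      ext v
      simp [smul_smul]
    · rw [norm_smul, pow_one, mul_assoc]
      exact mul_le_mul (hr i x hx) (hsmul _ _) (norm_nonneg _) (hr0 i)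
    · refine Summable.of_norm_bounded (hw 0) fun i => ?_
      rw [norm_smul, pow_zero, mul_one]
      gcongr
      exact hr i y hy
  induction n with
  | zero =>
    intro F _ _ _ _ _ w hw
    simp only [Nat.cast_zero]
    rw [contDiffOn_zero]
    exact fun y hy => (hderiv w hw y hy).continuousAt.continuousWithinAt
  | succ n ih =>
    intro F _ _ _ _ _ w hw
    push_cast
    rw [contDiffOn_succ_iff_fderiv_of_isOpen hU]
    refine ⟨fun y hy => (hderiv w hw y hy).differentiableAt.differentiableWithinAt, by simp, ?_⟩
    refine (ih (fun i => (L i).smulRight (w i)) fun k => ?_).congr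
      fun y hy => (hderiv w hw y hy).fderiv
    refine Summable.of_nonneg_of_le (fun i => ?_) (fun i => ?_) (hw (k + 1))
    · have := hr0 i
      positivity
    · have := hr0 i
      rw [pow_succ]
      calc r i * ‖L i‖ ^ k * ‖(L i).smulRight (w i)‖ ≤ r i * ‖L i‖ ^ k * (‖L i‖ * ‖w i‖) := by
            gcongr; exact hsmul _ _
        _ = _ := by ring

end SmoothSeries

/-! ### Discreteness of the frequencies and Gaussian sums over them. -/

section Frequencies

theorem exists_pow_mul_exp_neg_le {c : ℝ} (hc : 0 < c) (K : ℕ) :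
    ∃ C, ∀ x : ℝ, 0 ≤ x → x ^ K * Real.exp (-(c * x ^ 2)) ≤ C := by
  have h1 : ∀ y : ℝ, 0 ≤ y → y ^ K * Real.exp (-(c * y)) ≤ K.factorial / c ^ K := by
    intro y hy
    have h2 := Real.pow_div_factorial_le_exp (c * y) (by positivity) K
    rw [Real.exp_neg, ← div_eq_mul_inv, div_le_div_iff₀ (Real.exp_pos _) (by positivity)]
    rw [div_le_iff₀ (by positivity), mul_pow] at h2
    linarith
  refine ⟨1 + K.factorial / c ^ K, fun x hx => ?_⟩
  have h3 := h1 (x ^ 2) (by positivity)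
  have h4 : x ^ K ≤ 1 + (x ^ 2) ^ K := by
    rcases le_total x 1 with h | h
    · have := pow_le_one₀ hx h (n := K)
      have : 0 ≤ (x ^ 2) ^ K := by positivity
      linarith
    · have : x ^ K ≤ (x ^ 2) ^ K := pow_le_pow_left₀ hx (by nlinarith) K
      linarith
  calc x ^ K * Real.exp (-(c * x ^ 2)) ≤ (1 + (x ^ 2) ^ K) * Real.exp (-(c * x ^ 2)) := by gcongr
    _ = Real.exp (-(c * x ^ 2)) + (x ^ 2) ^ K * Real.exp (-(c * x ^ 2)) := by ring
    _ ≤ _ := add_le_add (Real.exp_le_one_iff.2 (by rw [neg_nonpos]; positivity)) h3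

theorem summable_pow_mul_exp_neg_sq {E : Type*} [NormedAddCommGroup E] [NormedSpace ℝ E]
    [FiniteDimensional ℝ E] (L : Submodule ℤ E) [DiscreteTopology L] {c : ℝ} (hc : 0 < c) (K : ℕ) :
    Summable fun z : L => (1 + ‖z‖) ^ K * Real.exp (-(c * ‖z‖ ^ 2)) := by
  set N := Module.finrank ℤ L + 1
  have hs := ZLattice.summable_norm_pow_inv L N (Nat.lt_succ_self _)
  obtain ⟨C, hC⟩ := exists_pow_mul_exp_neg_le hc N
  obtain ⟨C', hC'⟩ := exists_pow_mul_exp_neg_le hc (K + N)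
  refine Summable.of_norm_bounded_eventually (hs.mul_left (2 ^ K * (C + C'))) ?_
  -- The comparison term `‖z‖⁻¹ ^ N` is `0` at `z = 0`, so the bound is claimed only away from the
  -- origin.
  refine (Set.finite_singleton (0 : L)).subset fun z hz => ?_
  by_contra hz0
  refine hz ?_
  have hzpos : 0 < ‖z‖ := norm_pos_iff.2 hz0
  change ‖(1 + ‖z‖) ^ K * Real.exp (-(c * ‖z‖ ^ 2))‖ ≤ 2 ^ K * (C + C') * ‖z‖⁻¹ ^ N
  rw [Real.norm_of_nonneg (by positivity), inv_pow, ← div_eq_mul_inv, le_div_iff₀ (by positivity)]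
  have h1 : (1 + ‖z‖) ^ K ≤ 2 ^ K * (1 + ‖z‖ ^ K) := by
    rcases le_total ‖z‖ 1 with h | h
    · calc (1 + ‖z‖) ^ K ≤ 2 ^ K := pow_le_pow_left₀ (by positivity) (by linarith) _
        _ ≤ _ := le_mul_of_one_le_right (by positivity) (by simp)
    · calc (1 + ‖z‖) ^ K ≤ (2 * ‖z‖) ^ K := pow_le_pow_left₀ (by positivity) (by linarith) _
        _ = 2 ^ K * ‖z‖ ^ K := mul_pow _ _ _
        _ ≤ _ := by gcongr; simp
  have h2 := hC ‖z‖ hzpos.le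
  have h3 := hC' ‖z‖ hzpos.le
  calc (1 + ‖z‖) ^ K * Real.exp (-(c * ‖z‖ ^ 2)) * ‖z‖ ^ N ≤
      2 ^ K * (1 + ‖z‖ ^ K) * Real.exp (-(c * ‖z‖ ^ 2)) * ‖z‖ ^ N := by gcongr
    _ = 2 ^ K * (‖z‖ ^ N * Real.exp (-(c * ‖z‖ ^ 2)) +
        ‖z‖ ^ (K + N) * Real.exp (-(c * ‖z‖ ^ 2))) := by ring
    _ ≤ _ := by gcongr

namespace AbelianGauge

/-- If two differentials disagreed on `X`, a multiple of `X` would make their phases differ by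
exactly `π`. -/
theorem IsDifferential.unique {V A : Type*} [AddCommGroup V] [Module ℝ V] [CommGroup A]
    [TopologicalSpace A] {e : V → A} {χ : A →ₜ* Circle} {ξ η : V →ₗ[ℝ] ℝ}
    (hξ : IsDifferential e χ ξ) (hη : IsDifferential e χ η) : ξ = η := by
  ext X
  by_contra h
  have h1 : ∀ s : ℝ, Circle.exp (s * (ξ X - η X)) = 1 := by
    intro s
    have h2 := (hξ (s • X)).symm.trans (hη (s • X))
    rw [map_smul ξ, map_smul η, smul_eq_mul, smul_eq_mul] at h2
    rw [mul_sub, Circle.exp_sub, h2, div_self']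
  have h3 := h1 (Real.pi / (ξ X - η X))
  rw [div_mul_cancel₀ _ (sub_ne_zero.2 h)] at h3
  exact Circle.exp_pi_ne_one h3

theorem IsDifferential.mul {V A : Type*} [AddCommGroup V] [Module ℝ V] [CommGroup A]
    [TopologicalSpace A] {e : V → A} {χ ψ : A →ₜ* Circle} {ξ η : V →ₗ[ℝ] ℝ}
    (hξ : IsDifferential e χ ξ) (hη : IsDifferential e ψ η) :
    IsDifferential e (χ * ψ) (ξ + η) := fun X => by
  rw [ContinuousMonoidHom.mul_apply, hξ, hη, LinearMap.add_apply, Circle.exp_add]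

theorem IsDifferential.inv {V A : Type*} [AddCommGroup V] [Module ℝ V] [CommGroup A]
    [TopologicalSpace A] {e : V → A} {χ : A →ₜ* Circle} {ξ : V →ₗ[ℝ] ℝ}
    (hξ : IsDifferential e χ ξ) : IsDifferential e χ⁻¹ (-ξ) := fun X => by
  rw [LinearMap.neg_apply, Circle.exp_neg, ← hξ]
  rfl

namespace IsTorusExp

variable {V A : Type*} [AddCommGroup V] [Module ℝ V] [CommGroup A] [TopologicalSpace A]
  {e : V → A} (he : IsTorusExp e) {m : ℕ} (b : Module.Basis (Fin m) ℝ V)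
include he

/-- The frequencies of the characters form a subgroup. -/
def freqLattice : Submodule ℤ (Fin m → ℝ) := AddSubgroup.toIntSubmodule
  { carrier := {a | ∃ χ ξ, IsDifferential e χ ξ ∧ a = fun j => ξ (b j)}
    zero_mem' := ⟨1, 0, fun X => by simp, by ext; simp⟩
    add_mem' := by
      rintro _ _ ⟨χ, ξ, h, rfl⟩ ⟨ψ, η, h', rfl⟩
      exact ⟨χ * ψ, ξ + η, h.mul h', rfl⟩
    neg_mem' := by
      rintro _ ⟨χ, ξ, h, rfl⟩
      exact ⟨χ⁻¹, -ξ, h.inv, rfl⟩ }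

theorem injective_freq {ξ : (A →ₜ* Circle) → V →ₗ[ℝ] ℝ} (hξ : ∀ χ, IsDifferential e χ (ξ χ)) :
    Function.Injective fun χ (j : Fin m) => ξ χ (b j) := by
  intro χ ψ h
  have h1 : ξ χ = ξ ψ := b.ext fun j => congrFun h j
  refine ContinuousMonoidHom.ext fun a => ?_
  obtain ⟨X, rfl⟩ := he.surjective a
  rw [hξ, hξ, h1]

variable [IsTopologicalGroup A] [CompactSpace A] [T2Space A]

/-- A nontrivial frequency attains the phase `π` somewhere. The same group element has coordinates
of norm at most `R`, where a small enough frequency has phase less than `1` in absolute value; this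
is not congruent to `π` modulo `2π`. -/
theorem discreteTopology_freqLattice : DiscreteTopology (freqLattice (e := e) b) := by
  obtain ⟨R, hR0, hR⟩ := exists_closedBall_surjective_of_add (he.continuous_expCoord b)
    (he.expCoord_add b) (he.surjective_expCoord b)
  have key : ∀ a ∈ freqLattice (e := e) b, R * ∑ j, |a j| < 1 → a = 0 := by
    rintro _ ⟨χ, ξ, hξ, rfl⟩ hlt
    by_contra hne
    obtain ⟨j, hj⟩ := Function.ne_iff.1 hne
    simp only [Pi.zero_apply] at hj
    obtain ⟨y, hy, hyx⟩ := hR (e ((Real.pi / ξ (b j)) • b j))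
    have h1 := congrArg χ hyx
    rw [hξ, expCoord, hξ, map_smul, smul_eq_mul, div_mul_cancel₀ _ hj, map_sum] at h1
    obtain ⟨k, hk⟩ := Circle.exp_eq_exp.1 h1
    have h2 : |∑ i, ξ (y i • b i)| < 1 := by
      refine lt_of_le_of_lt ((Finset.abs_sum_le_sum_abs _ _).trans ?_) hlt
      rw [Finset.mul_sum]
      refine Finset.sum_le_sum fun i _ => ?_
      rw [map_smul, smul_eq_mul, abs_mul]
      gcongr
      exact (norm_le_pi_norm y i).trans hy
    rw [hk, abs_lt] at h2
    have hpi := Real.pi_gt_three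
    have h3 : (k : ℝ) < 0 := by
      by_contra! h
      nlinarith
    have h4 : (-1 : ℝ) < k := by
      by_contra! h
      nlinarith
    have h5 : k < 0 := by exact_mod_cast h3
    have h6 : -1 < k := by exact_mod_cast h4
    omega
  refine discreteTopology_of_isOpen_singleton_zero ?_
  refine ⟨{a | R * ∑ j, |a j| < 1}, isOpen_lt (by fun_prop) continuous_const, ?_⟩
  ext a
  constructor
  · intro h
    exact Subtype.ext (key a a.2 h)
  · rintro rfl
    simp

/-- A character is determined by its frequency, so this is dominated by a subfamily of a Gaussian
sum over a discrete subgroup of `ℝ^m`. -/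
theorem summable_freq {ξ : (A →ₜ* Circle) → V →ₗ[ℝ] ℝ} (hξ : ∀ χ, IsDifferential e χ (ξ χ))
    {c : ℝ} (hc : 0 < c) (K : ℕ) : Summable fun χ =>
      (1 + ‖fun j => ξ χ (b j)‖) ^ K * Real.exp (-(c * ∑ j, ξ χ (b j) ^ 2)) := by
  have := he.discreteTopology_freqLattice b
  have h1 := (summable_pow_mul_exp_neg_sq (freqLattice (e := e) b) hc K).comp_injective
    (i := fun χ => ⟨fun j => ξ χ (b j), χ, ξ χ, hξ χ, rfl⟩)
    (fun χ ψ h => he.injective_freq b hξ (congrArg Subtype.val h))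
  refine Summable.of_nonneg_of_le (fun χ => by positivity) (fun χ => ?_) h1
  have h2 : ‖fun j => ξ χ (b j)‖ ^ 2 ≤ ∑ j, ξ χ (b j) ^ 2 := by
    have h3 : ‖fun j => ξ χ (b j)‖ ≤ Real.sqrt (∑ j, ξ χ (b j) ^ 2) := by
      refine (pi_norm_le_iff_of_nonneg (Real.sqrt_nonneg _)).2 fun j => ?_
      refine Real.le_sqrt_of_sq_le ?_
      rw [Real.norm_eq_abs, sq_abs]
      exact Finset.single_le_sum (f := fun j => ξ χ (b j) ^ 2) (fun _ _ => sq_nonneg _)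
        (Finset.mem_univ j)
    calc ‖fun j => ξ χ (b j)‖ ^ 2 ≤ Real.sqrt (∑ j, ξ χ (b j) ^ 2) ^ 2 := by gcongr
      _ = _ := Real.sq_sqrt (by positivity)
  change _ ≤ (1 + ‖fun j => ξ χ (b j)‖) ^ K * Real.exp (-(c * ‖fun j => ξ χ (b j)‖ ^ 2))
  gcongr

end IsTorusExp
end AbelianGauge
end Frequencies

/-! ### The heat kernel as a Fourier series. -/

section HeatKernelExistence

namespace AbelianGauge

section TrigSeries

variable {V A : Type*} [AddCommGroup V] [Module ℝ V] [CommGroup A] [TopologicalSpace A]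

/-- The Fourier series with the given coefficients. -/
noncomputable def trigSeries (w : (A →ₜ* Circle) → ℂ) (a : A) : ℂ := ∑' χ, w χ * χ a

theorem norm_char (χ : A →ₜ* Circle) (a : A) : ‖(χ a : ℂ)‖ = 1 := Circle.norm_coe _

theorem summable_trigSeries {w : (A →ₜ* Circle) → ℂ} (hw : Summable fun χ => ‖w χ‖) (a : A) :
    Summable fun χ : A →ₜ* Circle => w χ * χ a :=
  Summable.of_norm_bounded hw fun χ => by simp [norm_char]

/-- Translation by `g` with `χ g ≠ 1` multiplies the integral by `χ g` without changing it. -/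
theorem integral_char [IsTopologicalGroup A] [CompactSpace A] [MeasurableSpace A] [BorelSpace A]
    (χ : A →ₜ* Circle) [Decidable (χ = 1)] :
    ∫ a, (χ a : ℂ) ∂haarProb A = if χ = 1 then 1 else 0 := by
  split_ifs with h
  · subst h
    simp
  · obtain ⟨g, hg⟩ : ∃ g, χ g ≠ 1 := by
      by_contra! h'
      exact h (ContinuousMonoidHom.ext h')
    have h1 := integral_mul_right_eq_self (μ := haarProb A) (fun a => (χ a : ℂ)) g
    simp only [map_mul, Circle.coe_mul, integral_mul_const] at h1
    have h2 : ((χ g : ℂ) - 1) * ∫ a, (χ a : ℂ) ∂haarProb A = 0 := by linear_combination h1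
    refine (mul_eq_zero.1 h2).resolve_left fun h3 => hg ?_
    exact Circle.ext (by simpa using sub_eq_zero.1 h3)

theorem integral_trigSeries_mul_char [IsTopologicalGroup A] [CompactSpace A] [MeasurableSpace A]
    [BorelSpace A] [Countable (A →ₜ* Circle)] {w : (A →ₜ* Circle) → ℂ}
    (hw : Summable fun χ => ‖w χ‖) (χ : A →ₜ* Circle) :
    ∫ a, trigSeries w a * χ a ∂haarProb A = w χ⁻¹ := by
  classical
  have hc : ∀ ψ : A →ₜ* Circle, Continuous fun a => (ψ a : ℂ) := fun ψ =>
    continuous_subtype_val.comp (map_continuous ψ)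
  have h1 := hasSum_integral_of_summable_integral_norm (μ := haarProb A)
    (F := fun (ψ : A →ₜ* Circle) a => w ψ * ψ a * χ a)
    (fun ψ => integrable_of_continuous ((continuous_const.mul (hc ψ)).mul (hc χ)))
    (by simpa [norm_char] using hw)
  have h2 : ∀ ψ : A →ₜ* Circle, ∫ a, w ψ * ψ a * χ a ∂haarProb A =
      if ψ = χ⁻¹ then w ψ else 0 := by
    intro ψ
    have h3 := integral_char (ψ * χ)
    simp only [ContinuousMonoidHom.mul_apply, Circle.coe_mul] at h3
    simp only [mul_assoc]
    rw [integral_const_mul, h3]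
    simp [mul_eq_one_iff_eq_inv]
  simp only [h2] at h1
  have h4 := h1.tsum_eq
  rw [tsum_ite_eq] at h4
  rw [h4]
  refine integral_congr_ae (ae_of_all _ fun a => ?_)
  simp only [trigSeries, tsum_mul_right]

theorem hasDerivAt_trigSeries {e : V → A}
    {ξ : (A →ₜ* Circle) → V →ₗ[ℝ] ℝ} (hξ : ∀ χ, IsDifferential e χ (ξ χ))
    {w : (A →ₜ* Circle) → ℂ} (hw : Summable fun χ => ‖w χ‖) {X : V}
    (hwX : Summable fun χ => ‖w χ‖ * |ξ χ X|) (a : A) (s : ℝ) :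
    HasDerivAt (fun s : ℝ => trigSeries w (a * e (s • X)))
      (trigSeries (fun χ => w χ * (ξ χ X * Complex.I)) (a * e (s • X))) s := by
  have h0 : ∀ (χ : A →ₜ* Circle) (s : ℝ), (χ (a * e (s • X)) : ℂ) =
      χ a * Complex.exp (s * (ξ χ X * Complex.I)) := fun χ s => by
    rw [map_mul, Circle.coe_mul, hξ, Circle.coe_exp, map_smul (ξ χ)]
    congr 2
    simp only [smul_eq_mul]
    push_cast
    ring
  refine hasDerivAt_tsum (𝕜 := ℝ) (u := fun χ => ‖w χ‖ * |ξ χ X|) (y₀ := 0)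
    (g := fun χ (s : ℝ) => w χ * χ (a * e (s • X)))
    (g' := fun χ (s : ℝ) => w χ * (ξ χ X * Complex.I) * χ (a * e (s • X)))
    hwX (fun χ s => ?_) (fun χ s => ?_) (summable_trigSeries hw _) s
  · simp only [h0]
    have h1 : HasDerivAt (fun s : ℝ => Complex.exp (s * (ξ χ X * Complex.I)))
        (Complex.exp (s * (ξ χ X * Complex.I)) * (1 * (ξ χ X * Complex.I))) s :=
      (Complex.ofRealCLM.hasDerivAt.mul_const _).cexp
    exact ((h1.const_mul (χ a : ℂ)).const_mul (w χ)).congr_deriv (by ring)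
  · rw [norm_mul, norm_char, mul_one]
    simp

theorem invDeriv_re_trigSeries {e : V → A} (he : IsTorusExp e)
    {ξ : (A →ₜ* Circle) → V →ₗ[ℝ] ℝ} (hξ : ∀ χ, IsDifferential e χ (ξ χ))
    {w : (A →ₜ* Circle) → ℂ} (hw : Summable fun χ => ‖w χ‖) {X : V}
    (hwX : Summable fun χ => ‖w χ‖ * |ξ χ X|) :
    invDeriv e X (fun a => (trigSeries w a).re) =
      fun a => (trigSeries (fun χ => w χ * (ξ χ X * Complex.I)) a).re := by
  funext a
  have h1 := hasDerivAt_trigSeries hξ hw hwX a 0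
  have h2 := (Complex.reCLM.hasFDerivAt.comp_hasDerivAt (0 : ℝ) h1).deriv
  simpa [invDeriv, he.map_zero, Function.comp_def] using h2

end TrigSeries

namespace IsTorusExp

variable {V A : Type*} [AddCommGroup V] [Module ℝ V] [CommGroup A] [TopologicalSpace A]
  [IsTopologicalGroup A] [CompactSpace A] [T2Space A]
  {e : V → A} (he : IsTorusExp e) {m : ℕ} (b : Module.Basis (Fin m) ℝ V)
  {ξ : (A →ₜ* Circle) → V →ₗ[ℝ] ℝ} (hξ : ∀ χ, IsDifferential e χ (ξ χ))

variable (ξ) in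
/-- The heat kernel as a Fourier series. -/
noncomputable def heatSeries (t : ℝ) (a : A) : ℝ :=
  (trigSeries (fun χ => Complex.exp (-(t * ∑ j, ξ χ (b j) ^ 2 : ℝ))) a).re

omit [IsTopologicalGroup A] [CompactSpace A] [T2Space A] in
theorem norm_heat_coeff (t : ℝ) (χ : A →ₜ* Circle) :
    ‖Complex.exp (-(t * ∑ j, ξ χ (b j) ^ 2 : ℝ))‖ = Real.exp (-(t * ∑ j, ξ χ (b j) ^ 2)) := by
  rw [← Complex.ofReal_neg, ← Complex.ofReal_exp, Complex.norm_real, Real.norm_of_nonneg]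
  positivity

omit [IsTopologicalGroup A] [CompactSpace A] [T2Space A] in
theorem abs_freq_le (χ : A →ₜ* Circle) (j : Fin m) :
    |ξ χ (b j)| ≤ 1 + ‖fun j => ξ χ (b j)‖ := by
  have := norm_le_pi_norm (fun j => ξ χ (b j)) j
  rw [Real.norm_eq_abs] at this
  linarith

omit [IsTopologicalGroup A] [CompactSpace A] [T2Space A] in
theorem sum_sq_freq_le (χ : A →ₜ* Circle) :
    ∑ j, ξ χ (b j) ^ 2 ≤ m * (1 + ‖fun j => ξ χ (b j)‖) ^ 2 := by
  have : ∑ j : Fin m, ξ χ (b j) ^ 2 ≤ ∑ j : Fin m, (1 + ‖fun j => ξ χ (b j)‖) ^ 2 :=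
    Finset.sum_le_sum fun j _ => by
      rw [← sq_abs]
      gcongr
      exact abs_freq_le b χ j
  simpa using this

include he hξ

theorem summable_heat_coeff {t : ℝ} (ht : 0 < t) (K : ℕ) {C : ℝ} {p : (A →ₜ* Circle) → ℝ}
    (hp0 : ∀ χ, 0 ≤ p χ) (hp : ∀ χ, p χ ≤ C * (1 + ‖fun j => ξ χ (b j)‖) ^ K) :
    Summable fun χ => ‖Complex.exp (-(t * ∑ j, ξ χ (b j) ^ 2 : ℝ))‖ * p χ := by
  refine Summable.of_nonneg_of_le (fun χ => mul_nonneg (norm_nonneg _) (hp0 χ)) (fun χ => ?_)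
    ((he.summable_freq b hξ ht K).mul_left C)
  rw [norm_heat_coeff]
  calc _ ≤ Real.exp (-(t * ∑ j, ξ χ (b j) ^ 2)) * (C * (1 + ‖fun j => ξ χ (b j)‖) ^ K) := by
        gcongr
        exact hp χ
    _ = _ := by ring

theorem summable_norm_heat_coeff {t : ℝ} (ht : 0 < t) :
    Summable fun χ => ‖Complex.exp (-(t * ∑ j, ξ χ (b j) ^ 2 : ℝ))‖ := by
  simpa using he.summable_heat_coeff b hξ ht 0 (C := 1) (p := fun _ => 1) (by simp) (by simp)

theorem hasDerivAt_heatSeries {t : ℝ} (ht : 0 < t) (a : A) :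
    HasDerivAt (fun t => heatSeries b ξ t a) (trigSeries (fun χ =>
      Complex.exp (-(t * ∑ j, ξ χ (b j) ^ 2 : ℝ)) * (-(∑ j, ξ χ (b j) ^ 2 : ℝ))) a).re t := by
  -- On `(t/2, ∞)` the differentiated terms are dominated by those with Gaussian factor at time
  -- `t/2`.
  have ht2 : 0 < t / 2 := by positivity
  have h1 := hasDerivAt_tsum_of_isPreconnected (𝕜 := ℝ) (t := Set.Ioi (t / 2))
    (u := fun χ => ‖Complex.exp (-((t / 2) * ∑ j, ξ χ (b j) ^ 2 : ℝ))‖ * ∑ j, ξ χ (b j) ^ 2)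
    (g := fun χ (t : ℝ) => Complex.exp (-(t * ∑ j, ξ χ (b j) ^ 2 : ℝ)) * χ a)
    (g' := fun χ (t : ℝ) => Complex.exp (-(t * ∑ j, ξ χ (b j) ^ 2 : ℝ)) *
      (-(∑ j, ξ χ (b j) ^ 2 : ℝ)) * χ a) (y₀ := t) (y := t)
    (he.summable_heat_coeff b hξ ht2 2 (fun χ => by positivity) (sum_sq_freq_le b))
    isOpen_Ioi isPreconnected_Ioi (fun χ s hs => ?_) (fun χ s hs => ?_)
    (by simpa using ht) (summable_trigSeries (he.summable_norm_heat_coeff b hξ ht) a)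
    (by simpa using ht)
  · exact Complex.reCLM.hasFDerivAt.comp_hasDerivAt t h1
  · set q := ∑ j, ξ χ (b j) ^ 2
    have h2 : HasDerivAt (fun s : ℝ => Complex.exp (-(s * q : ℝ)))
        (Complex.exp (-(s * q : ℝ)) * -(1 * q : ℝ)) s :=
      (((hasDerivAt_id s).mul_const q).ofReal_comp.neg).cexp
    exact (h2.mul_const _).congr_deriv (by simp)
  · rw [norm_mul, norm_mul, Circle.norm_coe, mul_one, norm_heat_coeff, norm_heat_coeff, norm_neg,
      Complex.norm_real, Real.norm_of_nonneg (by positivity)]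
    have : t / 2 ≤ s := le_of_lt hs
    gcongr

/-- Each invariant derivative along `b j` multiplies the coefficient of `χ` by `i ξ_χ(b j)`; two of
them give `-ξ_χ(b j)²`, and the sum over `j` matches the time derivative. -/
theorem heatSeries_heat_equation {t : ℝ} (ht : 0 < t) (a : A) :
    deriv (fun s => heatSeries b ξ s a) t =
      ∑ j, invDeriv e (b j) (invDeriv e (b j) (heatSeries b ξ t)) a := by
  rw [(he.hasDerivAt_heatSeries b hξ ht a).deriv]
  set w : (A →ₜ* Circle) → ℂ := fun χ => Complex.exp (-(t * ∑ j, ξ χ (b j) ^ 2 : ℝ)) with hwdef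
  have hw : Summable fun χ => ‖w χ‖ := he.summable_norm_heat_coeff b hξ ht
  have hw1 : ∀ j, Summable fun χ => ‖w χ‖ * |ξ χ (b j)| := fun j =>
    he.summable_heat_coeff b hξ ht 1 (C := 1) (fun χ => abs_nonneg _)
      (fun χ => by simpa using abs_freq_le b χ j)
  have hw2 : ∀ j, Summable fun χ => ‖w χ‖ * |ξ χ (b j)| ^ 2 := fun j =>
    he.summable_heat_coeff b hξ ht 2 (C := 1) (fun χ => by positivity) (fun χ => by
      rw [one_mul]
      gcongr
      exact abs_freq_le b χ j)
  have h1 : ∀ j, invDeriv e (b j) (invDeriv e (b j) (heatSeries b ξ t)) =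
      fun a => (trigSeries (fun χ => w χ * (ξ χ (b j) * Complex.I) *
        (ξ χ (b j) * Complex.I)) a).re := by
    intro j
    rw [show heatSeries b ξ t = fun a => (trigSeries w a).re from rfl,
      invDeriv_re_trigSeries he hξ hw (hw1 j), invDeriv_re_trigSeries he hξ]
    · simpa using hw1 j
    · simpa [mul_assoc, ← sq] using hw2 j
  simp only [h1]
  rw [← Complex.re_sum]
  congr 1
  change (∑' χ, w χ * (-(∑ j, ξ χ (b j) ^ 2 : ℝ)) * χ a) = _
  unfold trigSeries
  rw [← Summable.tsum_finsetSum fun j _ => summable_trigSeries (by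
    simpa [mul_assoc, ← sq] using hw2 j) a]
  refine tsum_congr fun χ => ?_
  push_cast
  rw [← Finset.sum_neg_distrib, Finset.mul_sum, Finset.sum_mul]
  refine Finset.sum_congr rfl fun j _ => ?_
  linear_combination -(w χ * (ξ χ (b j) : ℂ) ^ 2 * χ a) * Complex.I_sq

theorem contDiffOn_heatSeries (a : A) :
    ContDiffOn ℝ ∞ (fun q : ℝ × (Fin m → ℝ) => heatSeries b ξ q.1 (a * expCoord e b q.2))
      (Set.Ioi 0 ×ˢ Set.univ) := by
  -- Gaussian coefficient and character combine into the exponential of a form linear in `(t, x)`;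
  -- the base point `a` enters only through the coefficient `χ a`.
  let L : (A →ₜ* Circle) → (ℝ × (Fin m → ℝ)) →L[ℝ] ℂ := fun χ =>
    (ContinuousLinearMap.fst ℝ ℝ (Fin m → ℝ)).smulRight (-(∑ j, ξ χ (b j) ^ 2 : ℝ) : ℂ) +
      ∑ j, ((ContinuousLinearMap.proj (R := ℝ) (φ := fun _ : Fin m => ℝ) j).comp
        (ContinuousLinearMap.snd ℝ ℝ (Fin m → ℝ))).smulRight (ξ χ (b j) * Complex.I)
  have hL : ∀ χ q, L χ q = -(q.1 * ∑ j, ξ χ (b j) ^ 2 : ℝ) +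
      (∑ j, q.2 j * ξ χ (b j) : ℝ) * Complex.I := by
    intro χ q
    simp [L, Finset.sum_mul, mul_assoc]
  have hexp : ∀ χ q, Complex.exp (L χ q) =
      Complex.exp (-(q.1 * ∑ j, ξ χ (b j) ^ 2 : ℝ)) * χ (expCoord e b q.2) := by
    intro χ q
    rw [hL, Complex.exp_add, expCoord, hξ, Circle.coe_exp, map_sum]
    simp
  have hLnorm : ∀ χ, ‖L χ‖ ≤ 2 * m * (1 + ‖fun j => ξ χ (b j)‖) ^ 2 := by
    intro χ
    refine ContinuousLinearMap.opNorm_le_bound _ (by positivity) fun q => ?_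
    rw [hL]
    have h1 := sum_sq_freq_le (ξ := ξ) b χ
    have h2 : |∑ j, q.2 j * ξ χ (b j)| ≤ m * (1 + ‖fun j => ξ χ (b j)‖) ^ 2 * ‖q‖ := by
      calc |∑ j, q.2 j * ξ χ (b j)| ≤ ∑ j : Fin m, |q.2 j * ξ χ (b j)| :=
            Finset.abs_sum_le_sum_abs _ _
        _ ≤ ∑ j : Fin m, ‖q‖ * (1 + ‖fun j => ξ χ (b j)‖) ^ 2 := by
            refine Finset.sum_le_sum fun j _ => ?_
            rw [abs_mul]
            refine mul_le_mul ((norm_le_pi_norm q.2 j).trans (norm_snd_le q))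
              ((abs_freq_le b χ j).trans ?_) (abs_nonneg _) (norm_nonneg _)
            exact le_self_pow₀ (by simp) (by simp)
        _ = _ := by simp; ring
    calc _ ≤ ‖(-(q.1 * ∑ j, ξ χ (b j) ^ 2 : ℝ) : ℂ)‖ +
          ‖((∑ j, q.2 j * ξ χ (b j) : ℝ) : ℂ) * Complex.I‖ := norm_add_le _ _
      _ = |q.1| * ∑ j, ξ χ (b j) ^ 2 + |∑ j, q.2 j * ξ χ (b j)| := by
          rw [norm_neg, Complex.norm_real, norm_mul _ Complex.I, Complex.norm_I, mul_one,
            Complex.norm_real, Real.norm_eq_abs, Real.norm_eq_abs, abs_mul,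
            abs_of_nonneg (by positivity : 0 ≤ ∑ j, ξ χ (b j) ^ 2)]
      _ ≤ ‖q‖ * (m * (1 + ‖fun j => ξ χ (b j)‖) ^ 2) +
          m * (1 + ‖fun j => ξ χ (b j)‖) ^ 2 * ‖q‖ := by
          gcongr
          exact norm_fst_le q
      _ = _ := by ring
  -- Uniform bounds are available only for times above a fixed `s > 0`; smoothness is local, so
  -- these slabs suffice.
  have key : ∀ s : ℝ, 0 < s → ContDiffOn ℝ ∞
      (fun q : ℝ × (Fin m → ℝ) => heatSeries b ξ q.1 (a * expCoord e b q.2))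
      (Set.Ioi s ×ˢ Set.univ) := by
    intro s hs
    have h1 : ContDiffOn ℝ ∞ (fun q => ∑' χ, Complex.exp (L χ q) • (χ a : ℂ))
        (Set.Ioi s ×ˢ (Set.univ : Set (Fin m → ℝ))) := by
      rw [contDiffOn_infty]
      intro n
      refine contDiffOn_tsum_cexp_smul (isOpen_Ioi.prod isOpen_univ)
        (isPreconnected_Ioi.prod isPreconnected_univ) L
        (fun χ => ‖Complex.exp (-(s * ∑ j, ξ χ (b j) ^ 2 : ℝ))‖) (fun _ => norm_nonneg _)
        (fun χ q hq => ?_) n _ fun k => ?_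
      · rw [hexp, norm_mul, Circle.norm_coe, mul_one, norm_heat_coeff, norm_heat_coeff]
        have : s ≤ q.1 := le_of_lt hq.1
        gcongr
      · have := he.summable_heat_coeff b hξ hs (2 * k) (C := (2 * m) ^ k) (p := fun χ => ‖L χ‖ ^ k)
          (fun χ => by positivity) (fun χ => by
            calc ‖L χ‖ ^ k ≤ (2 * m * (1 + ‖fun j => ξ χ (b j)‖) ^ 2) ^ k := by
                  gcongr; exact hLnorm χ
              _ = _ := by rw [mul_pow _ _ k, ← pow_mul])
        simpa [norm_char] using this
    refine (Complex.reCLM.contDiff.comp_contDiffOn h1).congr fun q hq => ?_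
    simp only [heatSeries, trigSeries, hexp]
    congr 1
    refine tsum_congr fun χ => ?_
    rw [map_mul, Circle.coe_mul, smul_eq_mul]
    ring
  rintro ⟨t, x⟩ ⟨ht, -⟩
  have ht' : t / 2 < t := half_lt_self ht
  have := (key (t / 2) (half_pos ht)).contDiffAt (x := (t, x))
    ((isOpen_Ioi.prod isOpen_univ).mem_nhds ⟨ht', trivial⟩)
  exact this.contDiffWithinAt

end IsTorusExp

end AbelianGauge

end HeatKernelExistence

/-! ### Existence, positivity and coefficients of heat kernels. -/

section HeatKernelConclusion

namespace AbelianGauge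

namespace IsTorusExp

variable {V A : Type*} [AddCommGroup V] [Module ℝ V] [CommGroup A] [TopologicalSpace A]
  [IsTopologicalGroup A] [CompactSpace A] [T2Space A]
  {e : V → A} (he : IsTorusExp e)
include he

/-- A summable family of strictly positive numbers has a countable index set. -/
theorem countable_char [Module.Finite ℝ V] : Countable (A →ₜ* Circle) := by
  choose ξ hξ using he.exists_differential
  have := (he.summable_norm_heat_coeff (Module.finBasis ℝ V) hξ one_pos).countable_support
  rw [Function.support_eq_univ fun χ => (norm_pos_iff.2 (Complex.exp_ne_zero _)).ne'] at this
  exact Set.countable_univ_iff.1 this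

variable {m : ℕ} (b : Module.Basis (Fin m) ℝ V)
  {ξ : (A →ₜ* Circle) → V →ₗ[ℝ] ℝ} (hξ : ∀ χ, IsDifferential e χ (ξ χ))
include hξ

theorem sum_sq_freq_inv (χ : A →ₜ* Circle) :
    ∑ j, ξ χ⁻¹ (b j) ^ 2 = ∑ j, ξ χ (b j) ^ 2 := by
  rw [(hξ χ⁻¹).unique (hξ χ).inv]
  simp

/-- The coefficients are real and invariant under `χ ↦ χ⁻¹`, which is conjugation, so taking real
parts loses nothing. -/
theorem ofReal_heatSeries (t : ℝ) (a : A) : (heatSeries b ξ t a : ℂ) =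
    trigSeries (fun χ => Complex.exp (-(t * ∑ j, ξ χ (b j) ^ 2 : ℝ))) a := by
  rw [heatSeries, ← Complex.conj_eq_iff_re, trigSeries, Complex.conj_tsum,
    ← (Equiv.inv (A →ₜ* Circle)).tsum_eq]
  refine tsum_congr fun χ => ?_
  rw [Equiv.inv_apply, he.sum_sq_freq_inv b hξ, map_mul, ← Complex.ofReal_neg, ← Complex.ofReal_exp,
    Complex.conj_ofReal]
  congr 1
  change (starRingEnd ℂ) (((χ a)⁻¹ : Circle) : ℂ) = _
  rw [Circle.coe_inv_eq_conj, Complex.conj_conj]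

variable [MeasurableSpace A] [BorelSpace A]

theorem continuous_heatSeries {t : ℝ} (ht : 0 < t) : Continuous (heatSeries b ξ t) := by
  refine he.continuous_of_contDiff b (he.contDiff_heat_slice b ?_ ht)
  simpa using he.contDiffOn_heatSeries b hξ 1

theorem integral_heatSeries_mul_char {t : ℝ} (ht : 0 < t) (χ : A →ₜ* Circle) :
    ∫ a, (heatSeries b ξ t a : ℂ) * χ a ∂haarProb A =
      Real.exp (-(t * ∑ j, ξ χ (b j) ^ 2)) := by
  have : Module.Finite ℝ V := Module.Finite.of_basis b
  have := he.countable_char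
  simp only [he.ofReal_heatSeries b hξ]
  rw [integral_trigSeries_mul_char (he.summable_norm_heat_coeff b hξ ht),
    he.sum_sq_freq_inv b hξ, Complex.ofReal_exp, Complex.ofReal_neg]

/-- Equal Fourier coefficients turn the integral into a Gaussian average of `f` at points scaled by
`√(2t)`, and dominated convergence applies. -/
theorem tendsto_integral_heatSeries (f : C(A, ℝ)) :
    Tendsto (fun t => ∫ a, heatSeries b ξ t a * f a ∂haarProb A) (𝓝[>] 0) (𝓝 (f 1)) := by
  have hm : ∀ t : ℝ, Continuous fun x => expCoord e b (Real.sqrt (2 * t) • x) := fun t =>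
    (he.continuous_expCoord b).comp (by fun_prop)
  have h1 : ∀ t : ℝ, 0 < t → ∫ a, heatSeries b ξ t a * f a ∂haarProb A =
      ∫ x, f (expCoord e b (Real.sqrt (2 * t) • x)) ∂stdGauss m := by
    intro t ht
    have : IsProbabilityMeasure
        ((stdGauss m).map fun x => expCoord e b (Real.sqrt (2 * t) • x)) :=
      Measure.isProbabilityMeasure_map (hm t).measurable.aemeasurable
    rw [← integral_map (f := f) (hm t).measurable.aemeasurable
      f.continuous.measurable.aestronglyMeasurable]
    refine integral_mul_eq_of_forall_char he.separates (haarProb A)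
      ((stdGauss m).map fun x => expCoord e b (Real.sqrt (2 * t) • x))
      ⟨heatSeries b ξ t, he.continuous_heatSeries b hξ ht⟩ (fun χ => ?_) f
    rw [he.integral_char_map_gauss b (hξ χ) ht]
    exact he.integral_heatSeries_mul_char b hξ ht χ
  have h2 : Tendsto (fun t : ℝ => ∫ x, f (expCoord e b (Real.sqrt (2 * t) • x)) ∂stdGauss m)
      (𝓝 0) (𝓝 (∫ _, f 1 ∂stdGauss m)) := by
    refine tendsto_integral_filter_of_dominated_convergence (fun _ => ‖f‖)
      (Eventually.of_forall fun t => (f.continuous.comp (hm t)).aestronglyMeasurable)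
      (Eventually.of_forall fun t => ae_of_all _ fun x => f.norm_coe_le_norm _)
      (integrable_const _) (ae_of_all _ fun x => ?_)
    have h3 : Continuous fun t : ℝ => f (expCoord e b (Real.sqrt (2 * t) • x)) :=
      f.continuous.comp ((he.continuous_expCoord b).comp (by fun_prop))
    exact h3.tendsto' 0 _ (by simp [he.expCoord_zero])
  simp only [integral_const, probReal_univ, one_smul] at h2
  refine (h2.mono_left nhdsWithin_le_nhds).congr' ?_
  filter_upwards [self_mem_nhdsWithin] with t ht
  exact (h1 t ht).symm

omit hξ in
theorem isHeatKernel_heatKernel [Module.Finite ℝ V] {B : LinearMap.BilinForm ℝ V}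
    (hB : IsInnerProduct B) : IsHeatKernel e B (heatKernel e B) := by
  have h : ∃ H, IsHeatKernel e B H := by
    obtain ⟨m, b, hb⟩ := hB.exists_orthonormal_basis
    choose ξ hξ using he.exists_differential
    exact ⟨heatSeries b ξ, m, b, hb, fun a => he.contDiffOn_heatSeries b hξ a,
      fun t ht a => he.heatSeries_heat_equation b hξ ht a,
      fun f => he.tendsto_integral_heatSeries b hξ f⟩
  rw [heatKernel, dif_pos h]
  exact h.choose_spec

omit hξ in
/-- A heat kernel is a continuous probability density with the Fourier coefficients of a Gaussian
measure. -/
theorem exists_fourier_heat [SecondCountableTopology A] {B : LinearMap.BilinForm ℝ V}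
    {H : ℝ → A → ℝ}
    (hH : IsHeatKernel e B H) {t : ℝ} (ht : 0 < t) :
    Continuous (H t) ∧
    IsProbabilityMeasure ((haarProb A).withDensity fun a => ENNReal.ofReal (H t a)) ∧
    ∃ (m : ℕ) (b : Module.Basis (Fin m) ℝ V),
      (∀ j k, B (b j) (b k) = if j = k then 1 else 0) ∧
      ∀ χ ξ, IsDifferential e χ ξ →
        ∫ a, (χ a : ℂ) ∂(haarProb A).withDensity (fun a => ENNReal.ofReal (H t a)) =
          Real.exp (-(t * ∑ j, ξ (b j) ^ 2)) := by
  obtain ⟨m, b, hb, hs, hheat, hinit⟩ := hH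
  have hs1 : ContDiffOn ℝ ∞ (fun q : ℝ × (Fin m → ℝ) => H q.1 (expCoord e b q.2))
      (Set.Ioi 0 ×ˢ Set.univ) := by simpa [expCoord] using hs 1
  have hc : Continuous (H t) := he.continuous_of_contDiff b (he.contDiff_heat_slice b hs1 ht)
  have hm : Continuous fun x => expCoord e b (Real.sqrt (2 * t) • x) :=
    (he.continuous_expCoord b).comp (by fun_prop)
  have hp : IsProbabilityMeasure
      ((stdGauss m).map fun x => expCoord e b (Real.sqrt (2 * t) • x)) :=
    Measure.isProbabilityMeasure_map hm.measurable.aemeasurable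
  have : Module.Finite ℝ V := Module.Finite.of_basis b
  -- The heat kernel times Haar measure is the wrapped Gaussian; total mass one is inherited from
  -- it.
  have heq := withDensity_eq_of_forall_char he.separates (haarProb A)
    ((stdGauss m).map fun x => expCoord e b (Real.sqrt (2 * t) • x)) ⟨H t, hc⟩ (fun χ => by
      obtain ⟨ξ, hξ⟩ := he.exists_differential χ
      rw [he.integral_char_map_gauss b hξ ht]
      exact he.integral_heat_mul_char b hs1 hheat hinit hξ ht)
  simp only [ContinuousMap.coe_mk] at heq
  rw [heq]
  exact ⟨hc, hp, m, b, hb, fun χ ξ hξ => he.integral_char_map_gauss b hξ ht⟩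

end IsTorusExp

end AbelianGauge

end HeatKernelConclusion

/-! ### Characters of quotient groups. -/

section QuotientCharacters

namespace AbelianGauge

variable {T : Type*} [CommGroup T] [TopologicalSpace T] [IsTopologicalGroup T] [CompactSpace T]
  [T2Space T] [SecondCountableTopology T] [MeasurableSpace T] [BorelSpace T]

/-- The Haar measure of `H` moved to the coset `c H` has coefficients `χ c * ∫_H χ`, and `∫_H χ`
vanishes unless `χ` is trivial on `H`. If every such `χ` were trivial at `c`, the measures on `c H`
and `H` would agree, although the cosets are disjoint. -/
theorem exists_char_of_notMem (hsep : ∀ a : T, (∀ χ : T →ₜ* Circle, χ a = 1) → a = 1)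
    (H : Subgroup T) [hH : IsClosed (H : Set T)] {c : T} (hc : c ∉ H) :
    ∃ χ : T →ₜ* Circle, (∀ h ∈ H, χ h = 1) ∧ χ c ≠ 1 := by
  classical
  by_contra! hcon
  have : CompactSpace H := isCompact_iff_compactSpace.1 hH.isCompact
  have hm : ∀ c : T, Continuous fun h : H => c * h := fun c => by fun_prop
  have hp : ∀ c : T, IsProbabilityMeasure ((haarProb H).map fun h : H => c * h) := fun c =>
    Measure.isProbabilityMeasure_map (hm c).measurable.aemeasurable
  have hint : ∀ (c : T) (χ : T →ₜ* Circle),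
      ∫ a, (χ a : ℂ) ∂(haarProb H).map (fun h : H => c * h) =
        χ c * ∫ h : H, (χ h : ℂ) ∂haarProb H := fun c χ => by
    have hχ : Continuous fun a => (χ a : ℂ) := continuous_subtype_val.comp (map_continuous χ)
    rw [integral_map (hm c).measurable.aemeasurable hχ.measurable.aestronglyMeasurable]
    simp [integral_const_mul]
  have heq : (haarProb H).map (fun h : H => c * h) =
      (haarProb H).map (fun h : H => 1 * (h : T)) := by
    refine measure_eq_of_forall_char hsep _ _ fun χ => ?_
    rw [hint, hint]
    let ψ : H →ₜ* Circle := χ.comp ⟨H.subtype, continuous_subtype_val⟩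
    have h1 : ∫ h : H, (χ h : ℂ) ∂haarProb H = if ψ = 1 then 1 else 0 := integral_char ψ
    rw [h1]
    split_ifs with h
    · rw [hcon χ fun a ha => DFunLike.congr_fun h (⟨a, ha⟩ : H), map_one]
    · simp
  have h1 := congrArg (fun μ => μ (H : Set T)) heq
  rw [Measure.map_apply (hm c).measurable hH.measurableSet,
    Measure.map_apply (hm 1).measurable hH.measurableSet] at h1
  have h2 : (fun h : H => c * (h : T)) ⁻¹' (H : Set T) = ∅ := by
    ext h
    simpa [Subgroup.mul_mem_cancel_right H h.2] using hc
  have h3 : (fun h : H => 1 * (h : T)) ⁻¹' (H : Set T) = Set.univ := by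
    ext h
    simp
  rw [h2, h3, measure_empty, measure_univ] at h1
  exact zero_ne_one h1

theorem separates_quotient (hsep : ∀ a : T, (∀ χ : T →ₜ* Circle, χ a = 1) → a = 1)
    (H : Subgroup T) [IsClosed (H : Set T)] (q : T ⧸ H)
    (hq : ∀ χ : (T ⧸ H) →ₜ* Circle, χ q = 1) : q = 1 := by
  obtain ⟨c, rfl⟩ := QuotientGroup.mk_surjective q
  rw [QuotientGroup.eq_one_iff]
  by_contra hc
  obtain ⟨χ, h1, h2⟩ := exists_char_of_notMem hsep H hc
  exact h2 (hq ⟨QuotientGroup.lift H (χ : T →* Circle) h1,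
    (QuotientGroup.isQuotientMap_mk (N := H)).continuous_iff.2 (map_continuous χ)⟩)

end AbelianGauge

end QuotientCharacters

/-! ### Characters of the group of gauge equivalence classes. -/

section GaugeGroup

namespace AbelianGauge

theorem renormalized_spec {V : ℕ → Type*} [∀ i, AddCommGroup (V i)] [∀ i, Module ℝ (V i)]
    [∀ i, Module.Finite ℝ (V i)] {B : ∀ i, LinearMap.BilinForm ℝ (V i)}
    (hB : ∀ i, IsInnerProduct (B i)) (P : ∀ i, V (i + 1) →ₗ[ℝ] V i) (i : ℕ) :
    IsInnerProduct (renormalized B P i) := by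
  induction i with
  | zero => exact hB 0
  | succ i ih => exact (renormStep_spec (hB (i + 1)) (hB i) (P i) ih).1

variable {N N' : ℕ} {K : PolyhedralComplex N} {K' : PolyhedralComplex N'}
  {G : Type*} [CommGroup G] [TopologicalSpace G] [IsTopologicalGroup G]
  {O : K.CellOrientation} {O' : K'.CellOrientation}

theorem IsTorusLike.finite_lieImD₁ (hG : IsTorusLike G) (O : K.CellOrientation) :
    Module.Finite ℝ (LieImD₁ G O) := by
  have := hG.finite
  infer_instance

theorem IsTorusLike.isTorusExp_imExp (hG : IsTorusLike G) (O : K.CellOrientation) :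
    IsTorusExp (imExp G O) where
  map_add := imExp_add
  surjective := imExp_surjective hG
  continuous := continuous_imExp_sum
  separates := separates_imD₁ hG

theorem IsTorusLike.separates_pi (hG : IsTorusLike G) {ι : Type*} (c : ι → G)
    (hc : ∀ χ : (ι → G) →ₜ* Circle, χ c = 1) : c = 1 :=
  funext fun i => hG.separates _ fun χ =>
    hc ⟨(χ : G →* Circle).comp (Pi.evalMonoidHom _ i),
      (map_continuous χ).comp (continuous_apply i)⟩

variable [CompactSpace G] [T2Space G]

instance isClosed_range_d₀ (O : K.CellOrientation) :
    IsClosed ((d₀ G O).range : Set (K.Cell 1 → G)) :=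
  (isCompact_range (continuous_coboundary G O.inc₁)).isClosed

theorem continuous_rangeRestrict_d₁ (O : K.CellOrientation) :
    Continuous (d₁ G O).rangeRestrict :=
  (continuous_coboundary G O.inc₂).subtype_mk _

/-- A character of the group of gauge equivalence classes factors through the coboundary. -/
theorem exists_char_imD₁ (hker : (d₁ G O).ker ≤ (d₀ G O).range) (χ : GaugeQuot G O →ₜ* Circle) :
    ∃ ψ : ImD₁ G O →ₜ* Circle, ∀ c, ψ ((d₁ G O).rangeRestrict c) = χ (QuotientGroup.mk c) := by
  -- A continuous surjection from a compact space onto a Hausdorff space is a quotient map, so the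
  -- algebraic factor `ψ` is continuous.
  have hq : IsQuotientMap (d₁ G O).rangeRestrict :=
    ((continuous_rangeRestrict_d₁ O).isClosedMap).isQuotientMap (continuous_rangeRestrict_d₁ O)
      (MonoidHom.rangeRestrict_surjective _)
  let φ : (K.Cell 1 → G) →* Circle := (χ : GaugeQuot G O →* Circle).comp (QuotientGroup.mk' _)
  have hφ : ∀ c, φ c = χ (QuotientGroup.mk c) := fun c => rfl
  let ψ : ImD₁ G O →* Circle := (d₁ G O).rangeRestrict.liftOfSurjective
    (MonoidHom.rangeRestrict_surjective _) ⟨φ, fun c hc => by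
      rw [MonoidHom.ker_rangeRestrict] at hc
      rw [MonoidHom.mem_ker, hφ, (QuotientGroup.eq_one_iff c).2 (hker hc), map_one]⟩
  have hψ : ∀ c, ψ ((d₁ G O).rangeRestrict c) = φ c := fun c =>
    MonoidHom.liftOfRightInverse_comp_apply _ _ _ _ c
  refine ⟨⟨ψ, hq.continuous_iff.2 ?_⟩, hψ⟩
  have : (ψ : ImD₁ G O → Circle) ∘ (d₁ G O).rangeRestrict = φ := funext hψ
  change Continuous ((ψ : ImD₁ G O → Circle) ∘ (d₁ G O).rangeRestrict)
  rw [this]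
  exact (map_continuous χ).comp continuous_quotient_mk'

end AbelianGauge

end GaugeGroup

/-! ### Villain measures and their compatibility. -/

section VillainMeasures

namespace AbelianGauge

variable {N N' : ℕ} {K : PolyhedralComplex N} {K' : PolyhedralComplex N'}
  {G : Type*} [CommGroup G] [TopologicalSpace G] [IsTopologicalGroup G] [CompactSpace G]
  [T2Space G] [SecondCountableTopology G] [MeasurableSpace G] [BorelSpace G]
  {O : K.CellOrientation} {O' : K'.CellOrientation}

instance borelSpace_gaugeQuot (O : K.CellOrientation) : BorelSpace (GaugeQuot G O) := by
  have : PolishSpace G := by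
    let _ := TopologicalSpace.metrizableSpaceMetric G
    infer_instance
  infer_instance

instance secondCountable_imD₁ (O : K.CellOrientation) : SecondCountableTopology (ImD₁ G O) :=
  TopologicalSpace.Subtype.secondCountableTopology ((d₁ G O).range : Set (K.Cell 2 → G))

instance secondCountable_gaugeQuot (O : K.CellOrientation) :
    SecondCountableTopology (GaugeQuot G O) :=
  inferInstanceAs (SecondCountableTopology ((K.Cell 1 → G) ⧸ (d₀ G O).range))

theorem measurable_gaugeQuot_mk (O : K.CellOrientation) :
    Measurable (QuotientGroup.mk (s := (d₀ G O).range)) :=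
  QuotientGroup.measurable_coe

/-- A continuous surjective homomorphism of compact groups carries normalized Haar measure to
normalized Haar measure. Integrals over `C¹` of functions of `d₁ c` thereby reduce to `Im d₁`. -/
theorem measurePreserving_rangeRestrict_d₁ (O : K.CellOrientation) :
    MeasurePreserving (d₁ G O).rangeRestrict (haarProb (K.Cell 1 → G)) (haarProb (ImD₁ G O)) :=
  MonoidHom.measurePreserving (continuous_rangeRestrict_d₁ O)
    (MonoidHom.rangeRestrict_surjective _) (by rw [measure_univ, measure_univ])

variable {B : LinearMap.BilinForm ℝ (LieImD₁ G O)} {β : ℝ}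

/-- The normalization constant of a Villain measure is `1`. -/
theorem villainMeasure_eq (hG : IsTorusLike G) (hB : IsInnerProduct B) (hβ : 0 < β) :
    villainMeasure O B β = (haarProb (K.Cell 1 → G)).withDensity (villainDensity O B β) := by
  have := hG.finite_lieImD₁ O
  obtain ⟨hc, hp, -⟩ := (hG.isTorusExp_imExp O).exists_fourier_heat
    ((hG.isTorusExp_imExp O).isHeatKernel_heatKernel hB) hβ
  have h1 := (measurePreserving_rangeRestrict_d₁ (G := G) O).lintegral_comp
    (f := fun a => ENNReal.ofReal (heatKernel (imExp G O) B β a)) (by fun_prop)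
  have h2 := hp.measure_univ
  rw [withDensity_apply _ MeasurableSet.univ, Measure.restrict_univ] at h2
  rw [villainMeasure]
  simp only [villainDensity] at h1 ⊢
  rw [h1, h2, inv_one, one_smul]

theorem map_villainMeasure (hG : IsTorusLike G) (hB : IsInnerProduct B) (hβ : 0 < β) :
    (villainMeasure O B β).map (d₁ G O).rangeRestrict = (haarProb (ImD₁ G O)).withDensity
      fun a => ENNReal.ofReal (heatKernel (imExp G O) B β a) := by
  have := hG.finite_lieImD₁ O
  obtain ⟨hc, -, -⟩ := (hG.isTorusExp_imExp O).exists_fourier_heat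
    ((hG.isTorusExp_imExp O).isHeatKernel_heatKernel hB) hβ
  have hm := measurePreserving_rangeRestrict_d₁ (G := G) O
  rw [villainMeasure_eq hG hB hβ]
  ext s hs
  rw [Measure.map_apply hm.measurable hs, withDensity_apply _ (hm.measurable hs),
    withDensity_apply _ hs]
  exact hm.setLIntegral_comp_preimage
    (f := fun a => ENNReal.ofReal (heatKernel (imExp G O) B β a)) hs (by fun_prop)

theorem isProbabilityMeasure_villainMeasure (hG : IsTorusLike G) (hB : IsInnerProduct B)
    (hβ : 0 < β) : IsProbabilityMeasure (villainMeasure O B β) := by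
  have := hG.finite_lieImD₁ O
  obtain ⟨-, hp, -⟩ := (hG.isTorusExp_imExp O).exists_fourier_heat
    ((hG.isTorusExp_imExp O).isHeatKernel_heatKernel hB) hβ
  have hm := measurePreserving_rangeRestrict_d₁ (G := G) O
  have h1 := hp.measure_univ
  rw [← map_villainMeasure hG hB hβ, Measure.map_apply hm.measurable MeasurableSet.univ] at h1
  exact ⟨h1⟩

theorem isProbabilityMeasure_villainMeasureBar (hG : IsTorusLike G) (hB : IsInnerProduct B)
    (hβ : 0 < β) : IsProbabilityMeasure (villainMeasureBar O B β) := by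
  have := isProbabilityMeasure_villainMeasure hG hB hβ
  exact Measure.isProbabilityMeasure_map
    (measurable_gaugeQuot_mk O).aemeasurable

/-- Integrating `χ` over gauge classes and `ψ` over `Im d₁` pulls back to the same integral over
`C¹`, so the coefficient is that of the heat kernel. -/
theorem exists_fourier_villainMeasureBar (hG : IsTorusLike G) (hB : IsInnerProduct B)
    (hβ : 0 < β) : ∃ (m : ℕ) (b : Module.Basis (Fin m) ℝ (LieImD₁ G O)),
      (∀ j k, B (b j) (b k) = if j = k then 1 else 0) ∧
      ∀ (χ : GaugeQuot G O →ₜ* Circle) (ψ : ImD₁ G O →ₜ* Circle) (ξ),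
        (∀ c, ψ ((d₁ G O).rangeRestrict c) = χ (QuotientGroup.mk c)) →
        IsDifferential (imExp G O) ψ ξ →
        ∫ x, (χ x : ℂ) ∂villainMeasureBar O B β = Real.exp (-(β * ∑ j, ξ (b j) ^ 2)) := by
  have := hG.finite_lieImD₁ O
  obtain ⟨-, -, m, b, hb, hF⟩ := (hG.isTorusExp_imExp O).exists_fourier_heat
    ((hG.isTorusExp_imExp O).isHeatKernel_heatKernel hB) hβ
  refine ⟨m, b, hb, fun χ ψ ξ hψ hξ => ?_⟩
  have hχ : Continuous fun a => (χ a : ℂ) := continuous_subtype_val.comp (map_continuous χ)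
  have hψc : Continuous fun a => (ψ a : ℂ) := continuous_subtype_val.comp (map_continuous ψ)
  rw [← hF ψ ξ hξ, ← map_villainMeasure hG hB hβ, villainMeasureBar,
    integral_map (measurable_gaugeQuot_mk O).aemeasurable
      hχ.measurable.aestronglyMeasurable,
    integral_map (continuous_rangeRestrict_d₁ O).measurable.aemeasurable
      hψc.measurable.aestronglyMeasurable]
  simp only [hψ]

theorem SurjCochainMap.continuous_bar (f : SurjCochainMap G O O') : Continuous f.bar :=
  (QuotientGroup.isQuotientMap_mk (N := (d₀ G O).range)).continuous_iff.2
    (continuous_quotient_mk'.comp (map_continuous f.P₁))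

/-- Villain measures are compatible with cochain maps that are coisometric for the inner products
on the Lie algebras. -/
theorem map_villainMeasureBar (hG : IsTorusLike G) (hker : (d₁ G O).ker ≤ (d₀ G O).range)
    (hker' : (d₁ G O').ker ≤ (d₀ G O').range) (hB : IsInnerProduct B)
    {B' : LinearMap.BilinForm ℝ (LieImD₁ G O')} (hB' : IsInnerProduct B') (hβ : 0 < β)
    (f : SurjCochainMap G O O') (hf : ∀ w, ∃ u, f.lieP₂ u = w ∧ ∀ v, B u v = B' w (f.lieP₂ v)) :
    (villainMeasureBar O B β).map f.bar = villainMeasureBar O' B' β := by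
  have := isProbabilityMeasure_villainMeasureBar hG hB hβ
  have := isProbabilityMeasure_villainMeasureBar hG hB' hβ
  have := hG.finite_lieImD₁ O
  have := hG.finite_lieImD₁ O'
  have hbar := f.continuous_bar
  have : IsProbabilityMeasure ((villainMeasureBar O B β).map f.bar) :=
    Measure.isProbabilityMeasure_map hbar.measurable.aemeasurable
  have hsep := separates_quotient hG.separates_pi (d₀ G O').range
  refine measure_eq_of_forall_char hsep _ _ fun χ => ?_
  obtain ⟨m, b, hb, hF⟩ := exists_fourier_villainMeasureBar hG hB hβ
  obtain ⟨m', b', hb', hF'⟩ := exists_fourier_villainMeasureBar hG hB' hβ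
  obtain ⟨ψ', hψ'⟩ := exists_char_imD₁ hker' χ
  obtain ⟨χ₁, hχ₁⟩ : ∃ χ₁ : GaugeQuot G O →ₜ* Circle, ∀ x, χ₁ x = χ (f.bar x) :=
    ⟨⟨(χ : GaugeQuot G O' →* Circle).comp f.bar, (map_continuous χ).comp hbar⟩, fun _ => rfl⟩
  obtain ⟨ψ, hψ⟩ := exists_char_imD₁ hker χ₁
  obtain ⟨ξ, hξ⟩ := (hG.isTorusExp_imExp O').exists_differential ψ'
  -- The pulled-back character also factors through the coboundary; its differential is the old one
  -- composed with the map of Lie algebras, after which only the dual norms remain to be compared.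
  have hξ' : IsDifferential (imExp G O) ψ (ξ ∘ₗ f.lieP₂) := by
    intro X
    obtain ⟨c, hc⟩ := (d₁ G O).rangeRestrict_surjective (imExp G O X)
    have h1 : (d₁ G O').rangeRestrict (f.P₁ c) = imExp G O' (f.lieP₂ X) := by
      refine Subtype.ext ?_
      rw [imExp_lieP₂, ← hc]
      exact (f.comm₁ c).symm
    rw [LinearMap.comp_apply, ← hξ, ← h1, hψ', ← hc, hψ, hχ₁]
    rfl
  have hχ : Continuous fun a => (χ a : ℂ) := continuous_subtype_val.comp (map_continuous χ)
  rw [integral_map hbar.measurable.aemeasurable hχ.measurable.aestronglyMeasurable,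
    hF' χ ψ' ξ hψ' hξ, ← sum_sq_eq_of_coisometry hf hb hb' ξ]
  have h2 := hF χ₁ ψ _ hψ hξ'
  simp only [hχ₁] at h2
  exact h2

end AbelianGauge

end VillainMeasures

/-! ### Limits of projective systems on compact spaces. -/

section ProjectiveLimit

namespace AbelianGauge

variable {X : ℕ → Type*} [∀ i, TopologicalSpace (X i)] [∀ i, MeasurableSpace (X i)]
  {p : ∀ {i j : ℕ}, j ≤ i → X i → X j} {μ : ∀ i, Measure (X i)}

/-- On the limit, lower coordinates are functions of higher ones, so the σ-algebras of single
coordinates increase and their union is a generating π-system. -/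
theorem IsProjectiveSystem.eq_of_map_eq (hp : IsProjectiveSystem p μ)
    {ρ ν : Measure (ProjLimit p)} [IsProbabilityMeasure ρ] [IsProbabilityMeasure ν]
    (h : ∀ i, ρ.map (fun x => x.1 i) = ν.map (fun x => x.1 i)) : ρ = ν := by
  have hb := hp.borel
  let m : ℕ → MeasurableSpace (ProjLimit p) := fun i =>
    MeasurableSpace.comap (fun x => x.1 i) inferInstance
  have hm : ∀ i, Measurable fun x : ProjLimit p => x.1 i := fun i =>
    (measurable_pi_apply i).comp measurable_subtype_coe
  have hmono : Monotone m := by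
    intro i j hij
    have h1 : (fun x : ProjLimit p => x.1 i) = p hij ∘ fun x => x.1 j :=
      funext fun x => (x.2 j i hij).symm
    have h2 : m i = MeasurableSpace.comap (fun x => x.1 j)
        (MeasurableSpace.comap (p hij) inferInstance) := by
      rw [MeasurableSpace.comap_comp, ← h1]
    rw [h2]
    exact MeasurableSpace.comap_mono (hp.continuous hij).measurable.comap_le
  have hgen : (inferInstance : MeasurableSpace (ProjLimit p)) =
      MeasurableSpace.generateFrom (⋃ i, {t | MeasurableSet[m i] t}) := by
    refine Eq.trans ?_ (MeasurableSpace.generateFrom_iUnion_measurableSet m).symm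
    change MeasurableSpace.comap Subtype.val (⨆ i, MeasurableSpace.comap _ _) = _
    rw [MeasurableSpace.comap_iSup]
    simp only [MeasurableSpace.comap_comp]
    rfl
  refine ext_of_generate_finite _ hgen (isPiSystem_iUnion_of_monotone _
    (fun i => @MeasurableSpace.isPiSystem_measurableSet _ (m i))
    (fun i j hij t ht => hmono hij t ht)) ?_ (by rw [measure_univ, measure_univ])
  intro s hs
  obtain ⟨i, t, ht, rfl⟩ := Set.mem_iUnion.1 hs
  rw [← Measure.map_apply (hm i) ht, h, Measure.map_apply (hm i) ht]

variable [∀ i, CompactSpace (X i)] [∀ i, T2Space (X i)] [∀ i, SecondCountableTopology (X i)]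

/-- Each `μ n` is spread over the full product, and a weak limit along an ultrafilter exists by
compactness. Marginals and compatibility relations stabilize from some `n` on, so they survive in
the limit. -/
theorem IsProjectiveSystem.exists_measure_pi (hp : IsProjectiveSystem p μ) :
    ∃ ρ : Measure (∀ i, X i), IsProbabilityMeasure ρ ∧ (∀ i, ρ.map (fun x => x i) = μ i) ∧
      ∀ i j (h : j ≤ i), ∀ᵐ x ∂ρ, p h (x i) = x j := by
  classical
  have hb := hp.borel
  have hprob := hp.isProbabilityMeasure
  have hne : ∀ i, Nonempty (X i) := fun i => (μ i).nonempty_of_neZero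
  let q : ∀ n, X n → ∀ i, X i := fun n x i => if h : i ≤ n then p h x else Classical.arbitrary _
  have hq : ∀ n, Measurable (q n) := fun n => measurable_pi_lambda _ fun i => by
    by_cases h : i ≤ n
    · simpa [q, h] using (hp.continuous h).measurable
    · simp [q, h]
  let M : ℕ → ProbabilityMeasure (∀ i, X i) := fun n =>
    ⟨(μ n).map (q n), Measure.isProbabilityMeasure_map (hq n).aemeasurable⟩
  let U : Ultrafilter ℕ := Ultrafilter.of atTop
  obtain ⟨ρ, -, hρ⟩ := isCompact_univ.ultrafilter_le_nhds (U.map M) (by simp)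
  -- A continuous image whose law is eventually constant along the sequence has that law under the
  -- limit.
  have hlim : ∀ {Y : Type _} [TopologicalSpace Y] [MeasurableSpace Y] [BorelSpace Y]
      [CompactSpace Y] [T2Space Y] [SecondCountableTopology Y] (g : (∀ i, X i) → Y)
      (_ : Continuous g) (τ : Measure Y) (k : ℕ),
      (∀ n, k ≤ n → (μ n).map (g ∘ q n) = τ) → (ρ : Measure (∀ i, X i)).map g = τ := by
    intro Y _ _ _ _ _ _ g hg τ k hk
    let _ := TopologicalSpace.metrizableSpaceMetric Y
    have h1 := ProbabilityMeasure.tendsto_map_of_tendsto_of_continuous (L := (U : Filter ℕ))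
      M ρ hρ hg
    have h2 : ∀ᶠ n in (U : Filter ℕ),
        (M n).map hg.measurable.aemeasurable = (M k).map hg.measurable.aemeasurable := by
      filter_upwards [(Ultrafilter.of_le atTop : (U : Filter ℕ) ≤ atTop)
        (eventually_ge_atTop k)] with n hn
      refine Subtype.ext ?_
      change ((μ n).map (q n)).map g = ((μ k).map (q k)).map g
      rw [Measure.map_map hg.measurable (hq n), Measure.map_map hg.measurable (hq k), hk n hn,
        hk k le_rfl]
    have h3 := tendsto_nhds_unique (h1.congr' h2) tendsto_const_nhds
    have h4 := congrArg (fun ν : ProbabilityMeasure Y => (ν : Measure Y)) h3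
    change (ρ : Measure (∀ i, X i)).map g = ((μ k).map (q k)).map g at h4
    rw [h4, Measure.map_map hg.measurable (hq k), hk k le_rfl]
  refine ⟨ρ, inferInstance, fun i => hlim _ (continuous_apply i) _ i fun n hn => ?_,
    fun i j h => ?_⟩
  · have : (fun x : ∀ i, X i => x i) ∘ q n = p hn := by
      funext x
      simp [q, hn]
    rw [this, hp.map_eq]
  -- Compatibility is expressed as a law: the pair `(x j, p h (x i))` is distributed on the diagonal
  -- of `X j`.
  · have hpair : Continuous fun x : ∀ i, X i => (x j, p h (x i)) :=
      (continuous_apply j).prodMk ((hp.continuous h).comp (continuous_apply i))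
    have hd : Continuous fun x : X j => (x, x) := by fun_prop
    have h1 := hlim _ hpair ((μ j).map fun x => (x, x)) i fun n hn => by
      have : (fun x : ∀ i, X i => (x j, p h (x i))) ∘ q n =
          (fun x => (x, x)) ∘ p (h.trans hn) := by
        funext x
        simp [q, hn, h.trans hn, hp.map_map]
      rw [this, ← Measure.map_map hd.measurable (hp.continuous _).measurable, hp.map_eq]
    have h2 : ∀ᵐ y ∂((μ j).map fun x => (x, x)), y.2 = y.1 :=
      (ae_map_iff hd.measurable.aemeasurable
        (isClosed_eq continuous_snd continuous_fst).measurableSet).2 (ae_of_all _ fun x => rfl)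
    rw [← h1] at h2
    exact ae_of_ae_map hpair.measurable.aemeasurable h2

/-- A projective system of Borel probability measures on compact metrizable spaces has a unique
limit measure. -/
theorem IsProjectiveSystem.existsUnique_limit (hp : IsProjectiveSystem p μ) :
    ∃! ρ : Measure (ProjLimit p), IsProbabilityMeasure ρ ∧ ∀ i, ρ.map (fun x => x.1 i) = μ i := by
  have hb := hp.borel
  obtain ⟨M, hM, hMi, hMp⟩ := hp.exists_measure_pi
  have hS : MeasurableSet {x : ∀ i, X i | ∀ i j (h : j ≤ i), p h (x i) = x j} := by
    refine IsClosed.measurableSet ?_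
    simp only [Set.ofPred_forall]
    exact isClosed_iInter fun i => isClosed_iInter fun j => isClosed_iInter fun h =>
      isClosed_eq ((hp.continuous h).comp (continuous_apply i)) (continuous_apply j)
  have hae : ∀ᵐ x ∂M, x ∈ {x : ∀ i, X i | ∀ i j (h : j ≤ i), p h (x i) = x j} := by
    simp only [Set.mem_ofPred_eq, ae_all_iff]
    exact hMp
  -- The compatible families form a closed set of full measure, so passing to the subspace loses no
  -- mass.
  let ρ : Measure (ProjLimit p) := M.comap Subtype.val
  have hmap : ρ.map Subtype.val = M :=
    (map_comap_subtype_coe hS M).trans (Measure.restrict_eq_self_of_ae_mem hae)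
  have hρ : IsProbabilityMeasure ρ := by
    refine ⟨?_⟩
    rw [← measure_univ (μ := M), ← hmap,
      Measure.map_apply measurable_subtype_coe MeasurableSet.univ, Set.preimage_univ]
  have hρi : ∀ i, ρ.map (fun x => x.1 i) = μ i := fun i => by
    rw [← hMi i, ← hmap, Measure.map_map (measurable_pi_apply i) measurable_subtype_coe]
    rfl
  refine ⟨ρ, ⟨hρ, hρi⟩, ?_⟩
  rintro ν ⟨hν, hνi⟩
  exact hp.eq_of_map_eq fun i => (hνi i).trans (hρi i).symm

end AbelianGauge

end ProjectiveLimit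

/-! ### From consecutive maps to a projective system. -/

section Iterates

namespace AbelianGauge

variable {N N' N'' : ℕ} {K : PolyhedralComplex N} {K' : PolyhedralComplex N'}
  {K'' : PolyhedralComplex N''} {G : Type*} [CommGroup G] [TopologicalSpace G]
  [IsTopologicalGroup G]
  {O : K.CellOrientation} {O' : K'.CellOrientation} {O'' : K''.CellOrientation}

theorem SurjCochainMap.bar_id (x : GaugeQuot G O) : (SurjCochainMap.id O).bar x = x := by
  obtain ⟨c, rfl⟩ := QuotientGroup.mk_surjective x
  rfl

theorem SurjCochainMap.bar_comp (g : SurjCochainMap G O' O'') (f : SurjCochainMap G O O')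
    (x : GaugeQuot G O) : (g.comp f).bar x = g.bar (f.bar x) := by
  obtain ⟨c, rfl⟩ := QuotientGroup.mk_surjective x
  rfl

section

variable {N : ℕ → ℕ} {K : ∀ i, PolyhedralComplex (N i)} {O : ∀ i, (K i).CellOrientation}
  (P : ∀ i, SurjCochainMap G (O (i + 1)) (O i))

theorem iterate_self (i : ℕ) : iterate P (le_refl i) = SurjCochainMap.id (O i) :=
  Nat.leRecOn_self _

theorem iterate_succ {i j : ℕ} (h : j ≤ i) :
    iterate P (h.trans i.le_succ) = (iterate P h).comp (P i) :=
  Nat.leRecOn_succ h _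

theorem bar_iterate_trans {i j k : ℕ} (h : j ≤ i) (h' : k ≤ j) (x : GaugeQuot G (O i)) :
    (iterate P h').bar ((iterate P h).bar x) = (iterate P (h'.trans h)).bar x := by
  induction i, h using Nat.le_induction with
  | base => rw [iterate_self, SurjCochainMap.bar_id]
  | succ i h ih =>
    rw [iterate_succ P h, iterate_succ P (h'.trans h), SurjCochainMap.bar_comp,
      SurjCochainMap.bar_comp, ih]

/-- A sequence of measures that are compatible with the maps between consecutive groups is a
projective system. -/
theorem isProjectiveSystem_of_succ [CompactSpace G] [T2Space G] [SecondCountableTopology G]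
    [MeasurableSpace G] [BorelSpace G] {μ : ∀ i, Measure (GaugeQuot G (O i))}
    (hμ : ∀ i, IsProbabilityMeasure (μ i)) (hmap : ∀ i, (μ (i + 1)).map (P i).bar = μ i) :
    IsProjectiveSystem (X := fun i => GaugeQuot G (O i)) (fun {_ _} h => (iterate P h).bar) μ where
  borel i := borelSpace_gaugeQuot (O i)
  continuous h := (iterate P h).continuous_bar
  map_self i x := by rw [iterate_self, SurjCochainMap.bar_id]
  map_map h h' x := bar_iterate_trans P h h' x
  isProbabilityMeasure := hμ
  map_eq {i j} h := by
    induction i, h using Nat.le_induction with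
    | base =>
      have : ⇑(iterate P (le_refl j)).bar = id := funext fun x => by
        rw [iterate_self, SurjCochainMap.bar_id, id]
      rw [this, Measure.map_id]
    | succ i h ih =>
      have : ⇑(iterate P (h.trans i.le_succ)).bar = (iterate P h).bar ∘ (P i).bar :=
        funext fun x => by rw [iterate_succ P h, SurjCochainMap.bar_comp, Function.comp]
      rw [this, ← Measure.map_map (iterate P h).continuous_bar.measurable
        (P i).continuous_bar.measurable, hmap, ih]

end

end AbelianGauge

end Iterates

/-! ### Conclusion. -/

theorem theorem4p1 {n : ℕ} (G : Type*) [CommGroup G] [TopologicalSpace G]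
    [ChartedSpace (EuclideanSpace ℝ (Fin n)) G] [LieGroup (𝓡 n) ∞ G] [IsTopologicalGroup G]
    [T2Space G] [SecondCountableTopology G] [CompactSpace G] [ConnectedSpace G]
    [MeasurableSpace G] [BorelSpace G]
    (N : ℕ → ℕ) (K : ∀ i, PolyhedralComplex (N i)) (O : ∀ i, (K i).CellOrientation)
    (_hconn : ∀ i, IsConnected (K i).support) (_hH₁ : ∀ i, Subsingleton (O i).H₁)
    (P : ∀ i, SurjCochainMap G (O (i + 1)) (O i))
    (B : ∀ i, LinearMap.BilinForm ℝ (LieImD₁ G (O i))) (_hB : ∀ i, IsInnerProduct (B i))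
    (β : ℝ) (_hβ : 0 < β) :
    -- the renormalized forms are inner products
    (∀ i, IsInnerProduct (renormalized B (fun i => (P i).lieP₂) i)) ∧
    -- the heat kernels in the definition of the measures exist
    (∀ i, IsHeatKernel (imExp G (O i)) (renormalized B (fun i => (P i).lieP₂) i)
      (heatKernel (imExp G (O i)) (renormalized B (fun i => (P i).lieP₂) i))) ∧
    -- the measures form a projective system
    IsProjectiveSystem (X := fun i => GaugeQuot G (O i))
      (fun {_ _} h => (iterate P h).bar)
      (fun i => villainMeasureBar (O i) (renormalized B (fun i => (P i).lieP₂) i) β) ∧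
    -- which has a limit measure
    (∃! μ : Measure (ProjLimit (X := fun i => GaugeQuot G (O i))
        (fun {_ _} h => (iterate P h).bar)),
      IsProbabilityMeasure μ ∧
        ∀ i, μ.map (fun x => x.1 i) =
          villainMeasureBar (O i) (renormalized B (fun i => (P i).lieP₂) i) β) := by
  have hG : IsTorusLike G := isTorusLike_of_lieGroup n G
  have hfin := fun i => hG.finite_lieImD₁ (O i)
  have hB := renormalized_spec _hB fun i => (P i).lieP₂
  have hker := fun i => ker_d₁_le_range_d₀ hG.exists_zpow_eq (O i) (_hH₁ i)
  have hsys : IsProjectiveSystem (X := fun i => GaugeQuot G (O i))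
      (fun {_ _} h => (iterate P h).bar)
      (fun i => villainMeasureBar (O i) (renormalized B (fun i => (P i).lieP₂) i) β) :=
    isProjectiveSystem_of_succ P
      (fun i => isProbabilityMeasure_villainMeasureBar hG (hB i) _hβ)
      -- The coisometry property comes from the renormalization step together with surjectivity of
      -- the map of Lie algebras.
      fun i => map_villainMeasureBar hG (hker (i + 1)) (hker i) (hB (i + 1)) (hB i) _hβ (P i)
        ((renormStep_spec (_hB (i + 1)) (_hB i) (P i).lieP₂ (hB i)).2
          ((P i).lieP₂_surjective hG))
  exact ⟨hB, fun i => (hG.isTorusExp_imExp (O i)).isHeatKernel_heatKernel (hB i), hsys,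
    hsys.existsUnique_limit⟩
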